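/- **Theorem 2.3.** Let $0<T\le\infty$, $\Gamma=\{(z,t):0<z<\infty,\ 0<t<T\}$, and let $r$ be of Schwartz class on $\bar\Gamma$ (the restriction to $\bar\Gamma=\{z\ge 0,\ 0\le t\le T,\ t<\infty\}$ of a Schwartz function on $\mathbb R^2$), solving in $\Gamma$ the equation $$ i r_t+r_{zz}+|r|^2r-i|r|^2r_z=0 .$$ Put $\lambda=\varsigma^2-\tfrac12$, $\sigma=\mathrm{diag}(1,-1)$, $R=\begin{pmatrix}0&r\\-\bar r&0\end{pmatrix}$, $e^{x\hat\sigma}M=e^{x\sigma}Me^{-x\sigma}$, $$A=\varsigma R+\tfrac i4R^2\sigma,\qquad B=-2\varsigma^3R-i\varsigma^2R^2\sigma+\varsigma\left(R+i\sigma R_z-\tfrac12R^3\right)-\tfrac i8R^4\sigma+\tfrac14(RR_z-R_zR),$$ $$\Theta=\Theta_1dz+\Theta_2dt=\tfrac14|r|^2dz+\left(\tfrac18|r|^4+\tfrac i4(\bar rr_z-r\bar r_z)\right)dt,\qquad A_1dz+B_1dt=e^{-i\int_{(0,0)}^{(z,t)}\Theta\,\hat\sigma}(A\,dz+B\,dt-i\Theta\sigma).$$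 (The form $\Theta$ is closed; the integral is taken along $(0,0)\to(0,t)\to(z,t)$.) Let $H_1,H_2,H_3$ be the eigenfunctions given, column by column (for those $\varsigma$ for which the column exists), as the solutions, continuous and bounded in $(z,t)\in\bar\Gamma$, of $$H_1=\mathrm I+\int_0^ze^{i\lambda(z-\zeta)\hat\sigma}(A_1H_1)(\zeta,t)\,d\zeta+e^{i\lambda z\hat\sigma}\int_0^te^{-2i\lambda^2(t-\tau)\hat\sigma}(B_1H_1)(0,\tau)\,d\tau,$$ $$H_2=\mathrm I+\int_0^ze^{i\lambda(z-\zeta)\hat\sigma}(A_1H_2)(\zeta,t)\,d\zeta-e^{i\lambda z\hat\sigma}\int_t^Te^{-2i\lambda^2(t-\tau)\hat\sigma}(B_1H_2)(0,\tau)\,d\tau,$$ $$H_3=\mathrm I-\int_z^\infty e^{i\lambda(z-\zeta)\hat\sigma}(A_1H_3)(\zeta,t)\,d\zeta .$$ Write $[H_j]_k$ for the $k$-th column of $H_j$, and set $(v,u)^T(\varsigma)=[H_3]_2(0,0,\varsigma)$, $(V,U)^T(\varsigma)=[H_2]_2(0,0,\varsigma)$, $f^*(\varsigma)=\overline{f(\bar\varsigma)}$,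 $$\beta=uU^*+vV^*,\qquad \delta=\frac{v}{u^*},\qquad \Delta=-\frac{V^*}{u\beta},\qquad \eta=-\lambda z+2\lambda^2t .$$ With $\phi=-i\lambda$ and $\psi=-2i\lambda^2$ let $D_1=\{\mathrm{Re}\,\phi>0,\mathrm{Re}\,\psi>0\}$, $D_2=\{\mathrm{Re}\,\phi>0,\mathrm{Re}\,\psi<0\}$, $D_3=\{\mathrm{Re}\,\phi<0,\mathrm{Re}\,\psi<0\}$, $D_4=\{\mathrm{Re}\,\phi<0,\mathrm{Re}\,\psi>0\}$, and define $$E_+=\left([H_3]_1,\tfrac{[H_2]_2}{\beta^*}\right)\ \text{on }\bar D_1,\qquad E_-=\left([H_3]_1,\tfrac{[H_1]_2}{u^*}\right)\ \text{on }\bar D_2,$$ $$E_-=\left(\tfrac{[H_2]_1}{\beta},[H_3]_2\right)\ \text{on }\bar D_3,\qquad E_+=\left(\tfrac{[H_1]_1}{u},[H_3]_2\right)\ \text{on }\bar D_4 .$$ Then for all $(z,t)\in\bar\Gamma$ and all $\varsigma$ with $\varsigma^2\ne\frac12$ on one of the four rays below at which the denominators occurring in $E_\pm$ and $G$ do not vanish,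 $$E_-(z,t,\varsigma)=E_+(z,t,\varsigma)\,G(z,t,\varsigma),$$ where $G=G_1,\ G_2,\ G_3,\ G_4$ on the rays $\arg(\tfrac12-\varsigma^2)=\tfrac\pi2,\ \pi,\ \tfrac{3\pi}2,\ 0$, respectively, and $$G_1=\begin{pmatrix}1&0\\ \Delta e^{2i\eta}&1\end{pmatrix},\quad G_3=\begin{pmatrix}1&\Delta^*e^{-2i\eta}\\0&1\end{pmatrix},\quad G_4=\begin{pmatrix}1&-\delta e^{-2i\eta}\\-\delta^*e^{2i\eta}&1+\delta\delta^*\end{pmatrix},\quad G_2=G_3G_4^{-1}G_1 .$$ -/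

import Mathlib

open MeasureTheory
open scoped SchwartzMap ComplexConjugate

noncomputable section

namespace CLL

/-! ### The equation and its Lax pair -/

/-- The closed space-time domain: `0 ≤ z`, `0 ≤ t ≤ T`, where `T` may be `⊤` (then `t` is any
nonnegative real). -/
def closedDomain (T : EReal) : Set (ℝ × ℝ) :=
  {p | 0 ≤ p.1 ∧ 0 ≤ p.2 ∧ (p.2 : EReal) ≤ T}

/-- The partial derivative `r_z`. -/
def dz (r : ℝ × ℝ → ℂ) (z t : ℝ) : ℂ := deriv (fun x : ℝ => r (x, t)) z

/-- The second partial derivative `r_zz`. -/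
def dzz (r : ℝ × ℝ → ℂ) (z t : ℝ) : ℂ := deriv (fun x : ℝ => dz r x t) z

/-- The partial derivative `r_t`. -/
def dt (r : ℝ × ℝ → ℂ) (z t : ℝ) : ℂ := deriv (fun s : ℝ => r (z, s)) t

/-- `r` solves `i r_t + r_zz + |r|² r - i |r|² r_z = 0` for `0 < z`, `0 < t < T`. -/
def SolvesCLLNLS (T : EReal) (r : ℝ × ℝ → ℂ) : Prop :=
  ∀ z t : ℝ, 0 < z → 0 < t → (t : EReal) < T →
    Complex.I * dt r z t + dzz r z t + (‖r (z, t)‖ : ℂ) ^ 2 * r (z, t)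
      - Complex.I * (‖r (z, t)‖ : ℂ) ^ 2 * dz r z t = 0

/-- `σ = diag(1, -1)`. -/
def sigma : Matrix (Fin 2) (Fin 2) ℂ := !![1, 0; 0, -1]

/-- The off-diagonal matrix with entries `q` and `-conj q`; `R = offDiag r`, `R_z = offDiag r_z`. -/
def offDiag (q : ℂ) : Matrix (Fin 2) (Fin 2) ℂ := !![0, q; -conj q, 0]

/-- `λ(ς) = ς² - 1/2`. -/
def lam (s : ℂ) : ℂ := s ^ 2 - 1 / 2

/-- `A = ς R + (i/4) R² σ`, so that the `z`-part of the Lax pair is `Ψ_z = (i λ σ + A) Ψ`. -/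
def laxA (r : ℝ × ℝ → ℂ) (z t : ℝ) (s : ℂ) : Matrix (Fin 2) (Fin 2) ℂ :=
  let R := offDiag (r (z, t))
  s • R + (Complex.I / 4) • (R ^ 2 * sigma)

/-- `B = -2ς³R - iς²R²σ + ς(R + iσR_z - R³/2) - (i/8)R⁴σ + (R R_z - R_z R)/4`, so that the
`t`-part of the Lax pair is `Ψ_t = (-2 i λ² σ + B) Ψ`. -/
def laxB (r : ℝ × ℝ → ℂ) (z t : ℝ) (s : ℂ) : Matrix (Fin 2) (Fin 2) ℂ :=
  let R := offDiag (r (z, t))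
  let Rz := offDiag (dz r z t)
  (-2 * s ^ 3) • R - (Complex.I * s ^ 2) • (R ^ 2 * sigma)
    + s • (R + Complex.I • (sigma * Rz) - (1 / 2 : ℂ) • R ^ 3)
    - (Complex.I / 8) • (R ^ 4 * sigma) + (1 / 4 : ℂ) • (R * Rz - Rz * R)

/-- `Θ₁ = |r|²/4`, the `dz`-coefficient of the closed 1-form `Θ`. -/
def theta1 (r : ℝ × ℝ → ℂ) (z t : ℝ) : ℝ := ‖r (z, t)‖ ^ 2 / 4

/-- `Θ₂ = |r|⁴/8 + (i/4)(conj r · r_z - r · conj r_z)`, the `dt`-coefficient of `Θ`; the second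
summand equals `-Im (conj r · r_z) / 2`. -/
def theta2 (r : ℝ × ℝ → ℂ) (z t : ℝ) : ℝ :=
  ‖r (z, t)‖ ^ 4 / 8 - (conj (r (z, t)) * dz r z t).im / 2

/-- `∫_{(0,0)}^{(z,t)} Θ`, along the path `(0,0) → (0,t) → (z,t)`. -/
def thetaInt (r : ℝ × ℝ → ℂ) (z t : ℝ) : ℝ :=
  (∫ τ in (0 : ℝ)..t, theta2 r 0 τ) + ∫ ζ in (0 : ℝ)..z, theta1 r ζ t

/-- `e^{x σ̂} M = e^{xσ} M e^{-xσ}`. -/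
def expHat (x : ℂ) (M : Matrix (Fin 2) (Fin 2) ℂ) : Matrix (Fin 2) (Fin 2) ℂ :=
  Matrix.diagonal ![Complex.exp x, Complex.exp (-x)] * M *
    Matrix.diagonal ![Complex.exp (-x), Complex.exp x]

/-- `A₁ = e^{-i ∫Θ σ̂} (A - i Θ₁ σ)`. -/
def A1 (r : ℝ × ℝ → ℂ) (z t : ℝ) (s : ℂ) : Matrix (Fin 2) (Fin 2) ℂ :=
  expHat (-Complex.I * (thetaInt r z t : ℂ))
    (laxA r z t s - (Complex.I * (theta1 r z t : ℂ)) • sigma)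

/-- `B₁ = e^{-i ∫Θ σ̂} (B - i Θ₂ σ)`. -/
def B1 (r : ℝ × ℝ → ℂ) (z t : ℝ) (s : ℂ) : Matrix (Fin 2) (Fin 2) ℂ :=
  expHat (-Complex.I * (thetaInt r z t : ℂ))
    (laxB r z t s - (Complex.I * (theta2 r z t : ℂ)) • sigma)

/-! ### The eigenfunctions, column by column

The three matrix integral equations decouple into equations for the two columns. A column is the
solution of its equation that is continuous and bounded on the closed space-time domain. Columns are
indexed by `Fin 2`: index `0` is the first column, index `1` the second one. -/

/-- The diagonal entries of `σ`. -/
def sgn : Fin 2 → ℂ := ![1, -1]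

/-- The action of `e^{x σ̂}` on the `k`-th column of a matrix. -/
def expHatCol (k : Fin 2) (x : ℂ) (v : Fin 2 → ℂ) : Fin 2 → ℂ :=
  fun i => Complex.exp (x * (sgn i - sgn k)) * v i

theorem expHat_col (x : ℂ) (M : Matrix (Fin 2) (Fin 2) ℂ) (k i : Fin 2) :
    expHat x M i k = expHatCol k x (fun j => M j k) i := by
  have h : ∀ a b c : ℂ, Complex.exp a * c * Complex.exp b = Complex.exp (a + b) * c := by
    intro a b c
    rw [Complex.exp_add]
    ring
  fin_cases i <;> fin_cases k <;>
    simp [expHat, expHatCol, sgn, Matrix.mul_apply, Matrix.diagonal, h] <;>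
    ring_nf <;> simp

/-- Continuity and boundedness on the closed space-time domain. -/
def BoundedCont (T : EReal) (F : ℝ → ℝ → Fin 2 → ℂ) : Prop :=
  ContinuousOn (fun p : ℝ × ℝ => F p.1 p.2) (closedDomain T) ∧
    ∃ C : ℝ, ∀ p ∈ closedDomain T, ‖F p.1 p.2‖ ≤ C

/-- `F` is the `k`-th column of the eigenfunction `H₁` normalized at `(0, 0)`. -/
def IsH1Col (T : EReal) (r : ℝ × ℝ → ℂ) (k : Fin 2) (s : ℂ) (F : ℝ → ℝ → Fin 2 → ℂ) : Prop :=
  BoundedCont T F ∧ ∀ z t : ℝ, (z, t) ∈ closedDomain T →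
    F z t = Pi.single k 1
      + (∫ ζ in (0 : ℝ)..z,
          expHatCol k (Complex.I * lam s * ((z : ℂ) - ζ)) ((A1 r ζ t s).mulVec (F ζ t)))
      + expHatCol k (Complex.I * lam s * z)
          (∫ τ in (0 : ℝ)..t,
            expHatCol k (-2 * Complex.I * lam s ^ 2 * ((t : ℂ) - τ))
              ((B1 r 0 τ s).mulVec (F 0 τ)))

/-- `F` is the `k`-th column of the eigenfunction `H₂` normalized at `(0, T)`. -/
def IsH2Col (T : EReal) (r : ℝ × ℝ → ℂ) (k : Fin 2) (s : ℂ) (F : ℝ → ℝ → Fin 2 → ℂ) : Prop :=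
  BoundedCont T F ∧ ∀ z t : ℝ, (z, t) ∈ closedDomain T →
    F z t = Pi.single k 1
      + (∫ ζ in (0 : ℝ)..z,
          expHatCol k (Complex.I * lam s * ((z : ℂ) - ζ)) ((A1 r ζ t s).mulVec (F ζ t)))
      - expHatCol k (Complex.I * lam s * z)
          (∫ τ in {τ : ℝ | t < τ ∧ (τ : EReal) < T},
            expHatCol k (-2 * Complex.I * lam s ^ 2 * ((t : ℂ) - τ))
              ((B1 r 0 τ s).mulVec (F 0 τ)))

/-- `F` is the `k`-th column of the eigenfunction `H₃` normalized at `z = ∞`. -/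
def IsH3Col (T : EReal) (r : ℝ × ℝ → ℂ) (k : Fin 2) (s : ℂ) (F : ℝ → ℝ → Fin 2 → ℂ) : Prop :=
  BoundedCont T F ∧ ∀ z t : ℝ, (z, t) ∈ closedDomain T →
    F z t = Pi.single k 1
      - ∫ ζ in Set.Ioi z,
          expHatCol k (Complex.I * lam s * ((z : ℂ) - ζ)) ((A1 r ζ t s).mulVec (F ζ t))

/-- The `k`-th column `[H₁]_k(z, t, ς)`: the solution of its integral equation. -/
def H1 (T : EReal) (r : ℝ × ℝ → ℂ) (k : Fin 2) (s : ℂ) : ℝ → ℝ → Fin 2 → ℂ :=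
  Classical.epsilon (IsH1Col T r k s)

/-- The `k`-th column `[H₂]_k(z, t, ς)`. -/
def H2 (T : EReal) (r : ℝ × ℝ → ℂ) (k : Fin 2) (s : ℂ) : ℝ → ℝ → Fin 2 → ℂ :=
  Classical.epsilon (IsH2Col T r k s)

/-- The `k`-th column `[H₃]_k(z, t, ς)`. -/
def H3 (T : EReal) (r : ℝ × ℝ → ℂ) (k : Fin 2) (s : ℂ) : ℝ → ℝ → Fin 2 → ℂ :=
  Classical.epsilon (IsH3Col T r k s)

/-! ### The spectral functions

`w(ς) = H₃(0,0,ς)` has second column `(v, u)` and `W(ς) = H₂(0,0,ς)` has second column `(V, U)`. -/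

def uFun (T : EReal) (r : ℝ × ℝ → ℂ) (s : ℂ) : ℂ := H3 T r 1 s 0 0 1

def vFun (T : EReal) (r : ℝ × ℝ → ℂ) (s : ℂ) : ℂ := H3 T r 1 s 0 0 0

def UFun (T : EReal) (r : ℝ × ℝ → ℂ) (s : ℂ) : ℂ := H2 T r 1 s 0 0 1

def VFun (T : EReal) (r : ℝ × ℝ → ℂ) (s : ℂ) : ℂ := H2 T r 1 s 0 0 0

/-- The Schwarz conjugate `ς ↦ conj (f (conj ς))`. -/
def schwarzConj (f : ℂ → ℂ) (s : ℂ) : ℂ := conj (f (conj s))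

/-- `β(ς) = u(ς) conj(U(conj ς)) + v(ς) conj(V(conj ς))`. -/
def beta (T : EReal) (r : ℝ × ℝ → ℂ) (s : ℂ) : ℂ :=
  uFun T r s * schwarzConj (UFun T r) s + vFun T r s * schwarzConj (VFun T r) s

/-- `δ(ς) = v(ς) / conj(u(conj ς))`. -/
def delta (T : EReal) (r : ℝ × ℝ → ℂ) (s : ℂ) : ℂ := vFun T r s / schwarzConj (uFun T r) s

/-- `Δ(ς) = - conj(V(conj ς)) / (u(ς) β(ς))`. -/
def Delta (T : EReal) (r : ℝ × ℝ → ℂ) (s : ℂ) : ℂ :=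
  -schwarzConj (VFun T r) s / (uFun T r s * beta T r s)

/-- `η = -λ z + 2 λ² t`. -/
def eta (z t : ℝ) (s : ℂ) : ℂ := -lam s * z + 2 * lam s ^ 2 * t

/-! ### The regions and the sectionally defined matrix `E` -/

def phi (s : ℂ) : ℂ := -Complex.I * lam s

def psi (s : ℂ) : ℂ := -2 * Complex.I * lam s ^ 2

def D1 : Set ℂ := {s | 0 < (phi s).re ∧ 0 < (psi s).re}

def D2 : Set ℂ := {s | 0 < (phi s).re ∧ (psi s).re < 0}

def D3 : Set ℂ := {s | (phi s).re < 0 ∧ (psi s).re < 0}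

def D4 : Set ℂ := {s | (phi s).re < 0 ∧ 0 < (psi s).re}

/-- The matrix with columns `a` and `b`. -/
def ofCols (a b : Fin 2 → ℂ) : Matrix (Fin 2) (Fin 2) ℂ := !![a 0, b 0; a 1, b 1]

/-- `E` on the closure of `D₁`: `([H₃]₁, [H₂]₂ / conj(β(conj ς)))`. -/
def E1 (T : EReal) (r : ℝ × ℝ → ℂ) (z t : ℝ) (s : ℂ) : Matrix (Fin 2) (Fin 2) ℂ :=
  ofCols (H3 T r 0 s z t) ((schwarzConj (beta T r) s)⁻¹ • H2 T r 1 s z t)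

/-- `E` on the closure of `D₂`: `([H₃]₁, [H₁]₂ / conj(u(conj ς)))`. -/
def E2 (T : EReal) (r : ℝ × ℝ → ℂ) (z t : ℝ) (s : ℂ) : Matrix (Fin 2) (Fin 2) ℂ :=
  ofCols (H3 T r 0 s z t) ((schwarzConj (uFun T r) s)⁻¹ • H1 T r 1 s z t)

/-- `E` on the closure of `D₃`: `([H₂]₁ / β, [H₃]₂)`. -/
def E3 (T : EReal) (r : ℝ × ℝ → ℂ) (z t : ℝ) (s : ℂ) : Matrix (Fin 2) (Fin 2) ℂ :=
  ofCols ((beta T r s)⁻¹ • H2 T r 0 s z t) (H3 T r 1 s z t)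

/-- `E` on the closure of `D₄`: `([H₁]₁ / u, [H₃]₂)`. -/
def E4 (T : EReal) (r : ℝ × ℝ → ℂ) (z t : ℝ) (s : ℂ) : Matrix (Fin 2) (Fin 2) ℂ :=
  ofCols ((uFun T r s)⁻¹ • H1 T r 0 s z t) (H3 T r 1 s z t)

open Classical in
/-- `E₊`, on the union of the closures of `D₁` and `D₄` (these meet only where `ς² = 1/2`). -/
def EPlus (T : EReal) (r : ℝ × ℝ → ℂ) (z t : ℝ) (s : ℂ) : Matrix (Fin 2) (Fin 2) ℂ :=
  if s ∈ closure D1 then E1 T r z t s else E4 T r z t s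

open Classical in
/-- `E₋`, on the union of the closures of `D₂` and `D₃` (these meet only where `ς² = 1/2`). -/
def EMinus (T : EReal) (r : ℝ × ℝ → ℂ) (z t : ℝ) (s : ℂ) : Matrix (Fin 2) (Fin 2) ℂ :=
  if s ∈ closure D2 then E2 T r z t s else E3 T r z t s

/-! ### The jump matrices -/

def G1 (T : EReal) (r : ℝ × ℝ → ℂ) (z t : ℝ) (s : ℂ) : Matrix (Fin 2) (Fin 2) ℂ :=
  !![1, 0;
     Delta T r s * Complex.exp (2 * Complex.I * eta z t s), 1]

def G3 (T : EReal) (r : ℝ × ℝ → ℂ) (z t : ℝ) (s : ℂ) : Matrix (Fin 2) (Fin 2) ℂ :=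
  !![1, schwarzConj (Delta T r) s * Complex.exp (-2 * Complex.I * eta z t s);
     0, 1]

def G4 (T : EReal) (r : ℝ × ℝ → ℂ) (z t : ℝ) (s : ℂ) : Matrix (Fin 2) (Fin 2) ℂ :=
  !![1, -delta T r s * Complex.exp (-2 * Complex.I * eta z t s);
     -schwarzConj (delta T r) s * Complex.exp (2 * Complex.I * eta z t s),
       1 + delta T r s * schwarzConj (delta T r) s]

def G2 (T : EReal) (r : ℝ × ℝ → ℂ) (z t : ℝ) (s : ℂ) : Matrix (Fin 2) (Fin 2) ℂ :=
  G3 T r z t s * (G4 T r z t s)⁻¹ * G1 T r z t s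

end CLL

end

noncomputable section

namespace CLL

open Set Filter Topology Asymptotics

open scoped LineDeriv

/-! ### Volterra equations with integrable coefficients -/

/-- The integrand of the Volterra equations for the `k`-th column. -/
def kernelCol (k : Fin 2) (c : ℂ) (M : Matrix (Fin 2) (Fin 2) ℂ) (z ζ : ℝ) (v : Fin 2 → ℂ) :
    Fin 2 → ℂ :=
  expHatCol k (c * ((z : ℂ) - ζ)) (M.mulVec v)

theorem expHatCol_add_right (k : Fin 2) (x : ℂ) (v w : Fin 2 → ℂ) :
    expHatCol k x (v + w) = expHatCol k x v + expHatCol k x w := by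
  ext i; simp [expHatCol, mul_add]

theorem expHatCol_sub_right (k : Fin 2) (x : ℂ) (v w : Fin 2 → ℂ) :
    expHatCol k x (v - w) = expHatCol k x v - expHatCol k x w := by
  ext i; simp [expHatCol, mul_sub]

theorem expHatCol_zero (k : Fin 2) (v : Fin 2 → ℂ) : expHatCol k 0 v = v := by
  ext i; simp [expHatCol]

theorem expHatCol_single (k : Fin 2) (x : ℂ) :
    expHatCol k x (Pi.single k 1) = Pi.single k 1 := by
  ext i
  by_cases h : i = k
  · subst h; simp [expHatCol]
  · simp [expHatCol, h]

theorem expHatCol_comp (k : Fin 2) (x y : ℂ) (v : Fin 2 → ℂ) :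
    expHatCol k x (expHatCol k y v) = expHatCol k (x + y) v := by
  ext i; simp [expHatCol, add_mul, Complex.exp_add, mul_assoc]

theorem continuous_expHatCol {X : Type*} [TopologicalSpace X] (k : Fin 2) {f : X → ℂ}
    {g : X → Fin 2 → ℂ} (hf : Continuous f) (hg : Continuous g) :
    Continuous fun p => expHatCol k (f p) (g p) := by
  unfold expHatCol
  fun_prop

theorem norm_mulVec_le {M : Matrix (Fin 2) (Fin 2) ℂ} {b : ℝ} (hM : ∀ i j, ‖M i j‖ ≤ b)
    (v : Fin 2 → ℂ) : ‖M.mulVec v‖ ≤ 2 * b * ‖v‖ := by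
  have hb : 0 ≤ b := (norm_nonneg _).trans (hM 0 0)
  refine (pi_norm_le_iff_of_nonneg (by positivity)).2 fun i => ?_
  have h : ∀ j, ‖M i j * v j‖ ≤ b * ‖v‖ := fun j => by
    rw [norm_mul]
    exact mul_le_mul (hM i j) (norm_le_pi_norm v j) (norm_nonneg _) hb
  simp only [Matrix.mulVec, dotProduct, Fin.sum_univ_two]
  linarith [norm_add_le (M i 0 * v 0) (M i 1 * v 1), h 0, h 1]

theorem norm_expHatCol_le {k : Fin 2} {x : ℂ} (hx : ∀ i, (x * (sgn i - sgn k)).re ≤ 0)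
    (v : Fin 2 → ℂ) : ‖expHatCol k x v‖ ≤ ‖v‖ := by
  refine (pi_norm_le_iff_of_nonneg (norm_nonneg _)).2 fun i => ?_
  rw [expHatCol, norm_mul, Complex.norm_exp]
  have h1 : Real.exp (x * (sgn i - sgn k)).re ≤ 1 := Real.exp_le_one_iff.2 (hx i)
  calc _ ≤ 1 * ‖v‖ := mul_le_mul h1 (norm_le_pi_norm v i) (norm_nonneg _) zero_le_one
    _ = ‖v‖ := one_mul _

theorem norm_kernelCol_le {k : Fin 2} {c : ℂ} (hc : ∀ i, 0 ≤ (c * (sgn i - sgn k)).re)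
    {M : Matrix (Fin 2) (Fin 2) ℂ} {b : ℝ} (hM : ∀ i j, ‖M i j‖ ≤ b) {z ζ : ℝ} (h : z ≤ ζ)
    (v : Fin 2 → ℂ) : ‖kernelCol k c M z ζ v‖ ≤ 2 * b * ‖v‖ := by
  refine (norm_expHatCol_le (fun i => ?_) _).trans (norm_mulVec_le hM v)
  have : c * ((z : ℂ) - ζ) * (sgn i - sgn k) = ((z - ζ : ℝ) : ℂ) * (c * (sgn i - sgn k)) := by
    push_cast; ring
  rw [this, Complex.re_ofReal_mul]
  exact mul_nonpos_of_nonpos_of_nonneg (by linarith) (hc i)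

/-- The weight turning Volterra operators into contractions. -/
def weight (K x : ℝ) : ℝ := Real.exp (-K * Real.arctan x)

theorem weight_pos (K x : ℝ) : 0 < weight K x := Real.exp_pos _

theorem continuous_weight (K : ℝ) : Continuous (weight K) := by
  unfold weight
  exact Real.continuous_exp.comp (continuous_const.mul Real.continuous_arctan)

theorem hasDerivAt_weight (K x : ℝ) :
    HasDerivAt (weight K) (-K * (weight K x / (1 + x ^ 2))) x := by
  have := ((Real.hasDerivAt_arctan x).const_mul (-K)).exp
  refine this.congr_deriv ?_
  unfold weight
  ring

theorem weight_le {K : ℝ} (hK : 0 ≤ K) (x : ℝ) : weight K x ≤ Real.exp (K * Real.pi) := by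
  refine Real.exp_le_exp.2 ?_
  nlinarith [Real.neg_pi_div_two_lt_arctan x, Real.pi_pos]

theorem le_weight {K : ℝ} (hK : 0 ≤ K) (x : ℝ) : Real.exp (-(K * Real.pi)) ≤ weight K x := by
  refine Real.exp_le_exp.2 ?_
  nlinarith [Real.arctan_lt_pi_div_two x, Real.pi_pos]

theorem integrable_weight {K : ℝ} (hK : 0 ≤ K) :
    Integrable fun ζ => weight K ζ / (1 + ζ ^ 2) := by
  have h := (integrable_inv_one_add_sq).const_mul (Real.exp (K * Real.pi))
  have hcont : Continuous fun ζ => weight K ζ / (1 + ζ ^ 2) :=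
    (continuous_weight K).div (by fun_prop) fun x => by positivity
  refine h.mono' hcont.aestronglyMeasurable (Eventually.of_forall fun x => ?_)
  rw [Real.norm_of_nonneg (div_nonneg (weight_pos K x).le (by positivity)), div_eq_mul_inv]
  exact mul_le_mul_of_nonneg_right (weight_le hK x) (by positivity)

theorem integral_weight_le {K : ℝ} (hK : 0 < K) (z : ℝ) (J : Set ℝ) :
    ∫ ζ in Ioi z ∩ J, weight K ζ / (1 + ζ ^ 2) ≤ weight K z / K := by
  have h0 : ∀ ζ, 0 ≤ weight K ζ / (1 + ζ ^ 2) := fun ζ =>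
    div_nonneg (weight_pos K ζ).le (by positivity)
  have hi := integrable_weight hK.le
  have h1 : ∫ ζ in Ioi z ∩ J, weight K ζ / (1 + ζ ^ 2)
      ≤ ∫ ζ in Ioi z, weight K ζ / (1 + ζ ^ 2) :=
    setIntegral_mono_set hi.integrableOn (Eventually.of_forall h0)
      (LE.le.eventuallyLE inter_subset_left)
  have hd : ∀ x ∈ Ici z, HasDerivAt (fun x => -(weight K x / K)) (weight K x / (1 + x ^ 2)) x := by
    intro x _
    refine ((hasDerivAt_weight K x).div_const K).neg.congr_deriv ?_
    field_simp
  have ht : Tendsto (fun x => -(weight K x / K)) atTop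
      (𝓝 (-(Real.exp (-K * (Real.pi / 2)) / K))) := by
    refine (Tendsto.div_const ?_ K).neg
    exact (Real.continuous_exp.tendsto _).comp
      ((Real.tendsto_arctan_atTop.mono_right nhdsWithin_le_nhds).const_mul (-K))
  have h2 := integral_Ioi_of_hasDerivAt_of_tendsto' hd hi.integrableOn ht
  rw [h2] at h1
  have : 0 < Real.exp (-K * (Real.pi / 2)) / K := by positivity
  linarith

/-- The basic contraction estimate. -/
theorem norm_setIntegral_kernelCol_le {k : Fin 2} {c : ℂ}
    (hc : ∀ i, 0 ≤ (c * (sgn i - sgn k)).re) {M : ℝ → Matrix (Fin 2) (Fin 2) ℂ} {C : ℝ}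
    (hM : ∀ ζ i j, ‖M ζ i j‖ ≤ C / (1 + ζ ^ 2)) {K : ℝ} (hK : 0 < K) {N : ℝ} {J : Set ℝ}
    (hJ : MeasurableSet J) {z : ℝ} {F : ℝ → Fin 2 → ℂ}
    (hF : ∀ ζ ∈ Ioi z ∩ J, ‖F ζ‖ ≤ N * weight K ζ) :
    ‖∫ ζ in Ioi z ∩ J, kernelCol k c (M ζ) z ζ (F ζ)‖ ≤ |2 * C * N| / K * weight K z := by
  have h1 : ‖∫ ζ in Ioi z ∩ J, kernelCol k c (M ζ) z ζ (F ζ)‖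
      ≤ ∫ ζ in Ioi z ∩ J, |2 * C * N| * (weight K ζ / (1 + ζ ^ 2)) := by
    refine norm_integral_le_of_norm_le ((integrable_weight hK.le).const_mul _).integrableOn ?_
    refine (ae_restrict_iff' (measurableSet_Ioi.inter hJ)).2 (Eventually.of_forall fun ζ hζ => ?_)
    refine (norm_kernelCol_le hc (hM ζ) (le_of_lt hζ.1) _).trans ?_
    have hC : 0 ≤ C / (1 + ζ ^ 2) := (norm_nonneg _).trans (hM ζ 0 0)
    calc 2 * (C / (1 + ζ ^ 2)) * ‖F ζ‖ ≤ 2 * (C / (1 + ζ ^ 2)) * (N * weight K ζ) :=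
          mul_le_mul_of_nonneg_left (hF ζ hζ) (by positivity)
      _ = (2 * C * N) * (weight K ζ / (1 + ζ ^ 2)) := by ring
      _ ≤ _ := mul_le_mul_of_nonneg_right (le_abs_self _)
          (div_nonneg (weight_pos K ζ).le (by positivity))
  rw [integral_const_mul] at h1
  refine h1.trans ?_
  calc _ ≤ |2 * C * N| * (weight K z / K) :=
        mul_le_mul_of_nonneg_left (integral_weight_le hK z J) (abs_nonneg _)
    _ = _ := by ring

/-- A function that vanishes because any multiplicative bound on it can be halved. -/
theorem eq_zero_of_halving {α E : Type*} [NormedAddCommGroup E] {S : Set α} {Y : α → E}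
    {w : α → ℝ} {N₀ : ℝ} (hN₀ : 0 ≤ N₀) (h0 : ∀ x ∈ S, ‖Y x‖ ≤ N₀ * w x)
    (h : ∀ N, 0 ≤ N → (∀ x ∈ S, ‖Y x‖ ≤ N * w x) → ∀ x ∈ S, ‖Y x‖ ≤ N / 2 * w x) :
    ∀ x ∈ S, Y x = 0 := by
  have key : ∀ n : ℕ, ∀ x ∈ S, ‖Y x‖ ≤ N₀ * (1 / 2) ^ n * w x := by
    intro n
    induction n with
    | zero => simpa using h0
    | succ n ih =>
      intro x hx
      refine (h _ (by positivity) ih x hx).trans (le_of_eq ?_)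
      rw [pow_succ]; ring
  intro x hx
  have ht : Tendsto (fun n : ℕ => N₀ * (1 / 2 : ℝ) ^ n * w x) atTop (𝓝 (N₀ * 0 * w x)) :=
    ((tendsto_pow_atTop_nhds_zero_of_lt_one (by norm_num) (by norm_num)).const_mul _).mul_const _
  have := ge_of_tendsto' ht fun n => key n x hx
  simpa using this

theorem continuous_setIntegral_kernelCol {k : Fin 2} {c : ℂ}
    (hc : ∀ i, 0 ≤ (c * (sgn i - sgn k)).re) {M : ℝ → ℝ → Matrix (Fin 2) (Fin 2) ℂ}
    (hMc : Continuous fun p : ℝ × ℝ => M p.1 p.2) {C : ℝ}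
    (hM : ∀ ζ t i j, ‖M ζ t i j‖ ≤ C / (1 + ζ ^ 2)) {J : Set ℝ}
    {F : ℝ → ℝ → Fin 2 → ℂ} (hF : Continuous fun p : ℝ × ℝ => F p.1 p.2)
    {N : ℝ} (hN : ∀ z t, ‖F z t‖ ≤ N) :
    Continuous fun p : ℝ × ℝ =>
      ∫ ζ in Ioi p.1 ∩ J, kernelCol k c (M ζ p.2) p.1 ζ (F ζ p.2) := by
  have hker : Continuous fun q : (ℝ × ℝ) × ℝ =>
      kernelCol k c (M q.2 q.1.2) q.1.1 q.2 (F q.2 q.1.2) := by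
    unfold kernelCol
    refine continuous_expHatCol k (by fun_prop) ?_
    exact (hMc.comp (continuous_snd.prodMk (continuous_snd.comp continuous_fst))).matrix_mulVec
      (hF.comp (continuous_snd.prodMk (continuous_snd.comp continuous_fst)))
  have hrw : ∀ p : ℝ × ℝ, ∫ ζ in Ioi p.1 ∩ J, kernelCol k c (M ζ p.2) p.1 ζ (F ζ p.2)
      = ∫ ζ in J, (Ioi p.1).indicator
          (fun ζ => kernelCol k c (M ζ p.2) p.1 ζ (F ζ p.2)) ζ := fun p => by
    rw [integral_indicator measurableSet_Ioi, Measure.restrict_restrict measurableSet_Ioi]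
  simp_rw [hrw]
  refine continuous_iff_continuousAt.2 fun p => ?_
  refine continuousAt_of_dominated (bound := fun ζ => 2 * C * N * (1 + ζ ^ 2)⁻¹) ?_ ?_ ?_ ?_
  · refine Eventually.of_forall fun q => ?_
    exact ((hker.comp (continuous_const.prodMk continuous_id)).aestronglyMeasurable).indicator
      measurableSet_Ioi
  · refine Eventually.of_forall fun q => Eventually.of_forall fun ζ => ?_
    have hC : 0 ≤ C / (1 + ζ ^ 2) := (norm_nonneg _).trans (hM ζ 0 0 0)
    have hb : 2 * (C / (1 + ζ ^ 2)) * ‖F ζ q.2‖ ≤ 2 * C * N * (1 + ζ ^ 2)⁻¹ := by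
      calc _ ≤ 2 * (C / (1 + ζ ^ 2)) * N := mul_le_mul_of_nonneg_left (hN _ _) (by positivity)
        _ = _ := by ring
    by_cases h : ζ ∈ Ioi q.1
    · rw [indicator_of_mem h]
      exact (norm_kernelCol_le hc (hM ζ q.2) (le_of_lt h) _).trans hb
    · rw [indicator_of_notMem h, norm_zero]
      exact le_trans (by positivity) hb
  · exact (integrable_inv_one_add_sq.const_mul _).integrableOn
  · have hne : ∀ᵐ ζ ∂(volume.restrict J), ζ ≠ p.1 :=
      ae_restrict_of_ae (Measure.ae_ne volume p.1)
    filter_upwards [hne] with ζ hζ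
    have hk : Continuous fun q : ℝ × ℝ => kernelCol k c (M ζ q.2) q.1 ζ (F ζ q.2) := by
      have := hker.comp (f := fun q : ℝ × ℝ => (q, ζ)) (by fun_prop)
      simpa only [Function.comp_def] using this
    rcases lt_or_gt_of_ne hζ with h | h
    · have : (fun q : ℝ × ℝ => (Ioi q.1).indicator
          (fun ζ => kernelCol k c (M ζ q.2) q.1 ζ (F ζ q.2)) ζ) =ᶠ[𝓝 p] fun _ => 0 := by
        filter_upwards [continuous_fst.continuousAt.eventually (lt_mem_nhds h)] with q hq
        exact indicator_of_notMem (by simpa using le_of_lt hq) _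
      exact continuousAt_const.congr this.symm
    · have : (fun q : ℝ × ℝ => (Ioi q.1).indicator
          (fun ζ => kernelCol k c (M ζ q.2) q.1 ζ (F ζ q.2)) ζ) =ᶠ[𝓝 p]
            fun q => kernelCol k c (M ζ q.2) q.1 ζ (F ζ q.2) := by
        filter_upwards [continuous_fst.continuousAt.eventually (gt_mem_nhds h)] with q hq
        exact indicator_of_mem (by simpa using hq) _
      exact hk.continuousAt.congr this.symm

theorem kernelCol_sub (k : Fin 2) (c : ℂ) (M : Matrix (Fin 2) (Fin 2) ℂ) (z ζ : ℝ)
    (v w : Fin 2 → ℂ) :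
    kernelCol k c M z ζ (v - w) = kernelCol k c M z ζ v - kernelCol k c M z ζ w := by
  rw [kernelCol, Matrix.mulVec_sub, expHatCol_sub_right]; rfl

theorem continuous_kernelCol {X : Type*} [TopologicalSpace X] (k : Fin 2) (c : ℂ)
    {M : X → Matrix (Fin 2) (Fin 2) ℂ} {z ζ : X → ℝ} {F : X → Fin 2 → ℂ} (hM : Continuous M)
    (hz : Continuous z) (hζ : Continuous ζ) (hF : Continuous F) :
    Continuous fun x => kernelCol k c (M x) (z x) (ζ x) (F x) := by
  unfold kernelCol
  exact continuous_expHatCol k (by fun_prop) (hM.matrix_mulVec hF)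

theorem integrableOn_kernelCol {k : Fin 2} {c : ℂ}
    (hc : ∀ i, 0 ≤ (c * (sgn i - sgn k)).re) {M : ℝ → Matrix (Fin 2) (Fin 2) ℂ} {C : ℝ}
    (hM : ∀ ζ i j, ‖M ζ i j‖ ≤ C / (1 + ζ ^ 2)) {S : Set ℝ} (hS : MeasurableSet S) {z : ℝ}
    (hSz : S ⊆ Ici z) (hMc : ContinuousOn M S) {F : ℝ → Fin 2 → ℂ} (hF : ContinuousOn F S)
    {N : ℝ} (hN : ∀ ζ ∈ S, ‖F ζ‖ ≤ N) :
    IntegrableOn (fun ζ => kernelCol k c (M ζ) z ζ (F ζ)) S := by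
  have hcont : ContinuousOn (fun ζ => kernelCol k c (M ζ) z ζ (F ζ)) S := by
    rw [continuousOn_iff_continuous_domRestrict] at *
    exact continuous_kernelCol k c hMc continuous_const continuous_subtype_val hF
  refine Integrable.mono' ((integrable_inv_one_add_sq.const_mul (2 * C * N)).integrableOn)
    (hcont.aestronglyMeasurable hS) ?_
  refine (ae_restrict_iff' hS).2 (Eventually.of_forall fun ζ hζ => ?_)
  have hC : 0 ≤ C / (1 + ζ ^ 2) := (norm_nonneg _).trans (hM ζ 0 0)
  refine (norm_kernelCol_le hc (hM ζ) (hSz hζ) _).trans ?_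
  calc _ ≤ 2 * (C / (1 + ζ ^ 2)) * N := mul_le_mul_of_nonneg_left (hN _ hζ) (by positivity)
    _ = _ := by ring

open BoundedContinuousFunction in
/-- Volterra equations based at `+∞` have bounded continuous solutions. -/
theorem exists_volterra_Ioi {k : Fin 2} {c : ℂ}
    (hc : ∀ i, 0 ≤ (c * (sgn i - sgn k)).re) {M : ℝ → ℝ → Matrix (Fin 2) (Fin 2) ℂ}
    (hMc : Continuous fun p : ℝ × ℝ => M p.1 p.2) {C : ℝ}
    (hM : ∀ ζ t i j, ‖M ζ t i j‖ ≤ C / (1 + ζ ^ 2)) {J : Set ℝ}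
    (hJ : MeasurableSet J) {f : ℝ → ℝ → Fin 2 → ℂ} (hf : Continuous fun p : ℝ × ℝ => f p.1 p.2)
    {N : ℝ} (hN : ∀ z t, ‖f z t‖ ≤ N) :
    ∃ F : ℝ → ℝ → Fin 2 → ℂ, (Continuous fun p : ℝ × ℝ => F p.1 p.2) ∧
      (∃ N', ∀ z t, ‖F z t‖ ≤ N') ∧
      ∀ z t, F z t = f z t - ∫ ζ in Ioi z ∩ J, kernelCol k c (M ζ t) z ζ (F ζ t) := by
  have hC : 0 ≤ C := by
    have := (norm_nonneg _).trans (hM 0 0 0 0)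
    simpa using this
  obtain ⟨K, hK, hCK⟩ : ∃ K : ℝ, 0 < K ∧ 2 * C / K ≤ 1 / 2 := by
    refine ⟨4 * C + 1, by positivity, ?_⟩
    rw [div_le_div_iff₀ (by positivity) (by norm_num)]
    linarith
  let E := (ℝ × ℝ) →ᵇ (Fin 2 → ℂ)
  let Fg : E → ℝ → ℝ → Fin 2 → ℂ := fun g z t => weight K z • g (z, t)
  have hFgc : ∀ g : E, Continuous fun p : ℝ × ℝ => Fg g p.1 p.2 := fun g =>
    ((continuous_weight K).comp continuous_fst).smul g.continuous
  have hFgw : ∀ g : E, ∀ z t, ‖Fg g z t‖ ≤ ‖g‖ * weight K z := fun g z t => by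
    rw [norm_smul, Real.norm_of_nonneg (weight_pos K z).le, mul_comm]
    exact mul_le_mul_of_nonneg_right (g.norm_coe_le_norm _) (weight_pos K z).le
  have hFgb : ∀ g : E, ∀ z t, ‖Fg g z t‖ ≤ ‖g‖ * Real.exp (K * Real.pi) := fun g z t =>
    (hFgw g z t).trans (mul_le_mul_of_nonneg_left (weight_le hK.le z) (norm_nonneg _))
  let Q : E → ℝ → ℝ → Fin 2 → ℂ := fun g z t =>
    ∫ ζ in Ioi z ∩ J, kernelCol k c (M ζ t) z ζ (Fg g ζ t)
  have hQc : ∀ g : E, Continuous fun p : ℝ × ℝ => Q g p.1 p.2 := fun g =>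
    continuous_setIntegral_kernelCol hc hMc hM (hFgc g) (hFgb g)
  have hQ : ∀ g : E, ∀ z t, ‖Q g z t‖ ≤ |2 * C * ‖g‖| / K * weight K z := fun g z t =>
    norm_setIntegral_kernelCol_le hc (fun ζ => hM ζ t) hK hJ fun ζ _ => hFgw g ζ t
  have hQsub : ∀ g h : E, ∀ z t, Q g z t - Q h z t = Q (g - h) z t := fun g h z t => by
    have hi : ∀ g : E, IntegrableOn (fun ζ => kernelCol k c (M ζ t) z ζ (Fg g ζ t))
        (Ioi z ∩ J) := fun g =>
      integrableOn_kernelCol hc (fun ζ => hM ζ t) (measurableSet_Ioi.inter hJ)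
        (fun ζ hζ => le_of_lt hζ.1)
        (hMc.comp (Continuous.prodMk_left t)).continuousOn
        ((hFgc g).comp (Continuous.prodMk_left t)).continuousOn (fun ζ _ => hFgb g ζ t)
    rw [← integral_sub (hi g) (hi h)]
    refine integral_congr_ae (Eventually.of_forall fun ζ => ?_)
    simp only [← kernelCol_sub, Fg, ← smul_sub]
    rfl
  have hwinv : Continuous fun p : ℝ × ℝ => (weight K p.1)⁻¹ :=
    ((continuous_weight K).comp continuous_fst).inv₀ fun p => (weight_pos K p.1).ne'
  let Tm : E → E := fun g => BoundedContinuousFunction.ofNormedAddCommGroup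
    (fun p => (weight K p.1)⁻¹ • (f p.1 p.2 - Q g p.1 p.2)) (hwinv.smul (hf.sub (hQc g)))
    ((Real.exp (-(K * Real.pi)))⁻¹ * N + |2 * C * ‖g‖| / K) fun p => by
      rw [norm_smul, norm_inv, Real.norm_of_nonneg (weight_pos K _).le]
      have h1 := norm_sub_le (f p.1 p.2) (Q g p.1 p.2)
      have h2 := hQ g p.1 p.2
      have h3 := hN p.1 p.2
      have hw := weight_pos K p.1
      have hN0 : 0 ≤ N := (norm_nonneg _).trans h3
      calc _ ≤ (weight K p.1)⁻¹ * (N + |2 * C * ‖g‖| / K * weight K p.1) :=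
            mul_le_mul_of_nonneg_left (by linarith) (by positivity)
        _ = (weight K p.1)⁻¹ * N + |2 * C * ‖g‖| / K := by field_simp
        _ ≤ _ := by
          gcongr
          exact le_weight hK.le _
  have hT : ContractingWith (1 / 2) Tm := by
    refine ⟨by rw [← NNReal.coe_lt_coe]; norm_num, LipschitzWith.of_dist_le_mul fun g h => ?_⟩
    rw [dist_eq_norm, dist_eq_norm]
    refine (BoundedContinuousFunction.norm_le (by positivity)).2 fun p => ?_
    have hw := weight_pos K p.1
    have : (Tm g - Tm h) p = (weight K p.1)⁻¹ • Q (h - g) p.1 p.2 := by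
      rw [← hQsub]
      change (weight K p.1)⁻¹ • (f p.1 p.2 - Q g p.1 p.2)
        - (weight K p.1)⁻¹ • (f p.1 p.2 - Q h p.1 p.2) = _
      rw [← smul_sub]; congr 1; abel
    rw [this, norm_smul, norm_inv, Real.norm_of_nonneg hw.le, norm_sub_rev g h]
    calc _ ≤ (weight K p.1)⁻¹ * (|2 * C * ‖h - g‖| / K * weight K p.1) :=
          mul_le_mul_of_nonneg_left (hQ _ _ _) (by positivity)
      _ = (2 * C / K) * ‖h - g‖ := by
          rw [abs_of_nonneg (by positivity)]; field_simp
      _ ≤ 1 / 2 * ‖h - g‖ := mul_le_mul_of_nonneg_right hCK (norm_nonneg _)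
      _ = _ := by norm_num
  have hfix := hT.fixedPoint_isFixedPt
  set g := hT.fixedPoint with hg
  refine ⟨Fg g, hFgc g, ⟨_, hFgb g⟩, fun z t => ?_⟩
  have h1 : g (z, t) = (weight K z)⁻¹ • (f z t - Q g z t) :=
    congrArg (fun h : E => h (z, t)) hfix.symm
  change weight K z • g (z, t) = f z t - Q g z t
  rw [h1, smul_smul, mul_inv_cancel₀ (weight_pos K z).ne', one_smul]

theorem kernelCol_neg (k : Fin 2) (c : ℂ) (M : Matrix (Fin 2) (Fin 2) ℂ) (z ζ : ℝ)
    (v : Fin 2 → ℂ) : kernelCol k (-c) (-M) (-z) (-ζ) v = -kernelCol k c M z ζ v := by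
  ext i
  simp only [kernelCol, expHatCol, Matrix.neg_mulVec, Pi.neg_apply, mul_neg]
  push_cast
  ring_nf

/-- Volterra equations based at `0`. -/
theorem exists_volterra_Ioc {k : Fin 2} {c : ℂ}
    (hc : ∀ i, (c * (sgn i - sgn k)).re ≤ 0) {M : ℝ → ℝ → Matrix (Fin 2) (Fin 2) ℂ}
    (hMc : Continuous fun p : ℝ × ℝ => M p.1 p.2) {C : ℝ}
    (hM : ∀ ζ t i j, ‖M ζ t i j‖ ≤ C / (1 + ζ ^ 2))
    {f : ℝ → ℝ → Fin 2 → ℂ} (hf : Continuous fun p : ℝ × ℝ => f p.1 p.2)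
    {N : ℝ} (hN : ∀ z t, ‖f z t‖ ≤ N) :
    ∃ F : ℝ → ℝ → Fin 2 → ℂ, (Continuous fun p : ℝ × ℝ => F p.1 p.2) ∧
      (∃ N', ∀ z t, ‖F z t‖ ≤ N') ∧
      ∀ z t, 0 ≤ z → F z t = f z t + ∫ ζ in (0 : ℝ)..z, kernelCol k c (M ζ t) z ζ (F ζ t) := by
  have hneg : Continuous fun p : ℝ × ℝ => (-p.1, p.2) := by fun_prop
  obtain ⟨F, hFc, ⟨N', hN'⟩, hF⟩ := exists_volterra_Ioi (k := k) (c := -c)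
    (M := fun ζ t => -M (-ζ) t) (C := C) (J := Iio 0) (f := fun z t => f (-z) t) (N := N)
    (fun i => by rw [neg_mul, Complex.neg_re]; linarith [hc i]) (hMc.comp hneg).neg
    (fun ζ t i j => by simpa using hM (-ζ) t i j) measurableSet_Iio (hf.comp hneg)
    (fun z t => hN _ _)
  refine ⟨fun z t => F (-z) t, hFc.comp hneg, ⟨N', fun z t => hN' _ _⟩, fun z t hz => ?_⟩
  change F (-z) t = f z t + ∫ ζ in (0 : ℝ)..z, kernelCol k c (M ζ t) z ζ (F (-ζ) t)
  rw [hF (-z) t]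
  simp only [neg_neg]
  rw [Ioi_inter_Iio, sub_eq_add_neg]
  congr 1
  rw [← integral_Ioc_eq_integral_Ioo, ← intervalIntegral.integral_of_le (by linarith),
    ← intervalIntegral.integral_neg]
  have h := intervalIntegral.integral_comp_neg (a := 0) (b := z)
    (fun ζ => -kernelCol k (-c) (-M (-ζ) t) (-z) ζ (F ζ t))
  rw [neg_zero] at h
  rw [← h]
  refine intervalIntegral.integral_congr fun ζ _ => ?_
  simp only [neg_neg, kernelCol_neg]

/-- The Volterra equation for the `k`-th column based at `+∞`, for points of `S`. -/
def SolvesBackward (k : Fin 2) (c : ℂ) (M : ℝ → Matrix (Fin 2) (Fin 2) ℂ) (S J : Set ℝ)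
    (D : ℝ → Fin 2 → ℂ) : Prop :=
  ∀ z ∈ S, D z = Pi.single k 1 - ∫ ζ in Ioi z ∩ J, kernelCol k c (M ζ) z ζ (D ζ)

theorem SolvesBackward.unique {k : Fin 2} {c : ℂ} (hc : ∀ i, 0 ≤ (c * (sgn i - sgn k)).re)
    {M : ℝ → Matrix (Fin 2) (Fin 2) ℂ} (hMc : Continuous M) {C : ℝ}
    (hM : ∀ ζ i j, ‖M ζ i j‖ ≤ C / (1 + ζ ^ 2)) {S J : Set ℝ} (hJ : MeasurableSet J)
    (hSJ : ∀ z ∈ S, Ioi z ∩ J ⊆ S) {D D' : ℝ → Fin 2 → ℂ}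
    (hD : SolvesBackward k c M S J D) (hD' : SolvesBackward k c M S J D')
    (hDc : ContinuousOn D S) (hDc' : ContinuousOn D' S) {N N' : ℝ}
    (hN : ∀ z ∈ S, ‖D z‖ ≤ N) (hN' : ∀ z ∈ S, ‖D' z‖ ≤ N') : ∀ z ∈ S, D z = D' z := by
  have hC : 0 ≤ C := by
    have := (norm_nonneg _).trans (hM 0 0 0)
    simpa using this
  obtain ⟨K, hK, hCK⟩ : ∃ K : ℝ, 0 < K ∧ 2 * C / K ≤ 1 / 2 := by
    refine ⟨4 * C + 1, by positivity, ?_⟩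
    rw [div_le_div_iff₀ (by positivity) (by norm_num)]
    linarith
  rcases S.eq_empty_or_nonempty with rfl | ⟨z₀, hz₀⟩
  · simp
  have hNN : 0 ≤ N + N' :=
    add_nonneg ((norm_nonneg _).trans (hN z₀ hz₀)) ((norm_nonneg _).trans (hN' z₀ hz₀))
  have key := eq_zero_of_halving (S := S) (Y := fun z => D z - D' z) (w := weight K)
    (N₀ := (N + N') * (Real.exp (-(K * Real.pi)))⁻¹) (by positivity) ?_ ?_
  · exact fun z hz => sub_eq_zero.1 (key z hz)
  · intro z hz
    have h1 : 1 ≤ (Real.exp (-(K * Real.pi)))⁻¹ * weight K z := by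
      rw [inv_mul_eq_div, one_le_div (Real.exp_pos _)]
      exact le_weight hK.le z
    calc ‖D z - D' z‖ ≤ N + N' := (norm_sub_le _ _).trans (add_le_add (hN z hz) (hN' z hz))
      _ ≤ (N + N') * ((Real.exp (-(K * Real.pi)))⁻¹ * weight K z) :=
          le_mul_of_one_le_right hNN h1
      _ = _ := by ring
  · intro B hB hb z hz
    have hi : ∀ {D : ℝ → Fin 2 → ℂ} {N : ℝ}, ContinuousOn D S → (∀ z ∈ S, ‖D z‖ ≤ N) →
        IntegrableOn (fun ζ => kernelCol k c (M ζ) z ζ (D ζ)) (Ioi z ∩ J) := fun h1 h2 =>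
      integrableOn_kernelCol hc hM (measurableSet_Ioi.inter hJ) (fun ζ hζ => le_of_lt hζ.1)
        hMc.continuousOn (h1.mono (hSJ z hz)) fun ζ hζ => h2 ζ (hSJ z hz hζ)
    have h1 : D z - D' z
        = -∫ ζ in Ioi z ∩ J, kernelCol k c (M ζ) z ζ (D ζ - D' ζ) := by
      simp_rw [kernelCol_sub]
      rw [integral_sub (hi hDc hN) (hi hDc' hN'), hD z hz, hD' z hz]
      abel
    rw [h1, norm_neg]
    refine (norm_setIntegral_kernelCol_le hc hM hK hJ
      fun ζ hζ => hb ζ (hSJ z hz hζ)).trans ?_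
    rw [abs_of_nonneg (by positivity)]
    have hw := weight_pos K z
    calc 2 * C * B / K * weight K z = 2 * C / K * (B * weight K z) := by ring
      _ ≤ 1 / 2 * (B * weight K z) := mul_le_mul_of_nonneg_right hCK (by positivity)
      _ = _ := by ring

/-! ### The Schwarz symmetry -/

/-- The real-linear map relating the second column at `conj ς` to the first one at `ς`. -/
def conjSwap : (Fin 2 → ℂ) →L[ℝ] (Fin 2 → ℂ) :=
  LinearMap.toContinuousLinearMap
    { toFun := fun v => ![conj (v 1), -conj (v 0)]
      map_add' := fun v w => by ext i; fin_cases i <;> simp [add_comm]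
      map_smul' := fun a v => by ext i; fin_cases i <;> simp }

theorem conjSwap_apply (v : Fin 2 → ℂ) : conjSwap v = ![conj (v 1), -conj (v 0)] := rfl

theorem conjSwap_kernelCol {c : ℂ} {M M' : Matrix (Fin 2) (Fin 2) ℂ}
    (hM : M' = !![conj (M 1 1), -conj (M 1 0); -conj (M 0 1), conj (M 0 0)]) (z ζ : ℝ)
    (v : Fin 2 → ℂ) :
    conjSwap (kernelCol 1 c M z ζ v) = kernelCol 0 (-conj c) M' z ζ (conjSwap v) := by
  subst hM
  ext i
  fin_cases i <;>
    simp [conjSwap_apply, kernelCol, expHatCol, sgn, Matrix.mulVec, dotProduct,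
      Fin.sum_univ_two, ← Complex.exp_conj] <;> ring_nf

theorem SolvesBackward.conjSwap {c : ℂ} {M M' : ℝ → Matrix (Fin 2) (Fin 2) ℂ}
    (hM : ∀ ζ, M' ζ = !![conj (M ζ 1 1), -conj (M ζ 1 0); -conj (M ζ 0 1), conj (M ζ 0 0)])
    {S J : Set ℝ} {D : ℝ → Fin 2 → ℂ} (hD : SolvesBackward 1 c M S J D)
    (hi : ∀ z ∈ S, IntegrableOn (fun ζ => kernelCol 1 c (M ζ) z ζ (D ζ)) (Ioi z ∩ J)) :
    SolvesBackward 0 (-conj c) M' S J fun z => conjSwap (D z) := by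
  intro z hz
  have h1 : CLL.conjSwap (Pi.single 1 1) = Pi.single 0 1 := by
    ext i; fin_cases i <;> simp [conjSwap_apply]
  change CLL.conjSwap (D z) = _
  rw [hD z hz, map_sub, h1, ← ContinuousLinearMap.integral_comp_comm _ (hi z hz)]
  simp_rw [conjSwap_kernelCol (hM _)]

/-! ### From integral equations to differential equations -/

/-- `expHatCol` as a continuous linear map. -/
def expHatColL (k : Fin 2) (x : ℂ) : (Fin 2 → ℂ) →L[ℂ] (Fin 2 → ℂ) :=
  ContinuousLinearMap.pi fun i => Complex.exp (x * (sgn i - sgn k)) • ContinuousLinearMap.proj i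

theorem expHatColL_apply (k : Fin 2) (x : ℂ) (v : Fin 2 → ℂ) :
    expHatColL k x v = expHatCol k x v := rfl

theorem expHatCol_kernelCol (k : Fin 2) (c : ℂ) (M : Matrix (Fin 2) (Fin 2) ℂ) (a z ζ : ℝ)
    (v : Fin 2 → ℂ) :
    expHatCol k (c * ((z : ℂ) - a)) (kernelCol k c M a ζ v) = kernelCol k c M z ζ v := by
  rw [kernelCol, expHatCol_comp, kernelCol]
  congr 1; ring

theorem SolvesBackward.eq_forward {k : Fin 2} {c : ℂ} {M : ℝ → Matrix (Fin 2) (Fin 2) ℂ}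
    {S J : Set ℝ} (hJ : MeasurableSet J) {D : ℝ → Fin 2 → ℂ} (hD : SolvesBackward k c M S J D)
    {a z : ℝ} (haz : a ≤ z) (ha : a ∈ S) (hz : z ∈ S) (hJa : Ioo a z ⊆ J)
    (hi : IntegrableOn (fun ζ => kernelCol k c (M ζ) a ζ (D ζ)) (Ioi a ∩ J)) :
    D z = expHatCol k (c * ((z : ℂ) - a)) (D a)
      + ∫ ζ in a..z, kernelCol k c (M ζ) z ζ (D ζ) := by
  set h := fun ζ => kernelCol k c (M ζ) a ζ (D ζ) with hh
  have hker : ∀ ζ, kernelCol k c (M ζ) z ζ (D ζ) = expHatColL k (c * ((z : ℂ) - a)) (h ζ) :=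
    fun ζ => by rw [expHatColL_apply, hh, expHatCol_kernelCol]
  have hae : (Ioc a z ∩ J : Set ℝ) =ᵐ[volume] Ioc a z := by
    refine EventuallyLE.antisymm (LE.le.eventuallyLE inter_subset_left) ?_
    exact Ioo_ae_eq_Ioc.symm.le.trans
      (LE.le.eventuallyLE (subset_inter Ioo_subset_Ioc_self hJa))
  have hsplit : Ioi a ∩ J = (Ioc a z ∩ J) ∪ (Ioi z ∩ J) := by
    rw [← union_inter_distrib_right, Ioc_union_Ioi_eq_Ioi haz]
  have hi1 : IntegrableOn h (Ioc a z ∩ J) := hi.mono_set (by rw [hsplit]; exact subset_union_left)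
  have hi2 : IntegrableOn h (Ioi z ∩ J) := hi.mono_set (by rw [hsplit]; exact subset_union_right)
  have hi3 : IntegrableOn h (Ioc a z) := hi1.congr_set_ae hae.symm
  have e1 : ∫ ζ in Ioi a ∩ J, h ζ = (∫ ζ in Ioc a z, h ζ) + ∫ ζ in Ioi z ∩ J, h ζ := by
    rw [hsplit, setIntegral_union ?_ (measurableSet_Ioi.inter hJ) hi1 hi2,
      setIntegral_congr_set hae]
    exact disjoint_left.2 fun x hx hx' => not_lt.2 hx.1.2 hx'.1
  have e2 : D z = Pi.single k 1
      - expHatCol k (c * ((z : ℂ) - a)) (∫ ζ in Ioi z ∩ J, h ζ) := by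
    rw [hD z hz, ← expHatColL_apply, ← ContinuousLinearMap.integral_comp_comm _ hi2]
    simp_rw [hker]
  rw [e2, hD a ha, e1, expHatCol_sub_right, expHatCol_add_right, expHatCol_single,
    intervalIntegral.integral_of_le haz]
  simp_rw [hker]
  rw [ContinuousLinearMap.integral_comp_comm _ hi3, expHatColL_apply]
  abel

/-- The action of `c (σ - σ_kk)` on a `k`-th column. -/
def adCol (k : Fin 2) (c : ℂ) (v : Fin 2 → ℂ) : Fin 2 → ℂ := fun i => c * (sgn i - sgn k) * v i

theorem hasDerivAt_duhamel (k : Fin 2) (c : ℂ) (g : Fin 2 → ℂ) {h : ℝ → Fin 2 → ℂ}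
    (hh : Continuous h) (a z : ℝ) :
    HasDerivAt (fun z : ℝ => expHatCol k (c * ((z : ℂ) - a)) g
        + ∫ ζ in a..z, expHatCol k (c * ((z : ℂ) - ζ)) (h ζ))
      (adCol k c (expHatCol k (c * ((z : ℂ) - a)) g
        + ∫ ζ in a..z, expHatCol k (c * ((z : ℂ) - ζ)) (h ζ)) + h z) z := by
  have hcont : Continuous fun ζ : ℝ => expHatCol k (c * ((a : ℂ) - ζ)) (h ζ) :=
    continuous_expHatCol k (by fun_prop) hh
  have e : ∀ z : ℝ, expHatCol k (c * ((z : ℂ) - a)) g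
      + ∫ ζ in a..z, expHatCol k (c * ((z : ℂ) - ζ)) (h ζ)
      = expHatCol k (c * ((z : ℂ) - a))
        (g + ∫ ζ in a..z, expHatCol k (c * ((a : ℂ) - ζ)) (h ζ)) := fun z => by
    rw [expHatCol_add_right]
    congr 1
    rw [← expHatColL_apply, ← ContinuousLinearMap.intervalIntegral_comp_comm _
      (hcont.intervalIntegrable _ _)]
    refine intervalIntegral.integral_congr fun ζ _ => ?_
    simp only [expHatColL_apply, expHatCol_comp]
    congr 1; ring
  simp_rw [e]
  have hG := (intervalIntegral.integral_hasDerivAt_right (hcont.intervalIntegrable a z)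
    (hcont.stronglyMeasurableAtFilter _ _) hcont.continuousAt).const_add g
  rw [hasDerivAt_pi] at hG ⊢
  intro i
  have h1 : HasDerivAt (fun z : ℝ => Complex.exp (c * ((z : ℂ) - a) * (sgn i - sgn k)))
      (Complex.exp (c * ((z : ℂ) - a) * (sgn i - sgn k)) * (c * (sgn i - sgn k))) z := by
    have := (((Complex.ofRealCLM.hasDerivAt (x := z)).sub_const (a : ℂ)).const_mul c).mul_const
      (sgn i - sgn k)
    simpa using this.cexp
  refine (h1.mul (hG i)).congr_deriv ?_
  simp only [adCol, expHatCol, Pi.add_apply]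
  have h2 : Complex.exp (c * ((z : ℂ) - a) * (sgn i - sgn k))
      * Complex.exp (c * ((a : ℂ) - z) * (sgn i - sgn k)) = 1 := by
    rw [← Complex.exp_add, ← Complex.exp_zero]
    congr 1; ring
  linear_combination (h z i) * h2

/-! ### Schwartz functions on the plane and their partial derivatives -/

/-- The partial derivative in the first variable. -/
def pz (f : 𝓢(ℝ × ℝ, ℂ)) : 𝓢(ℝ × ℝ, ℂ) := ∂_{((1, 0) : ℝ × ℝ)} f

/-- The partial derivative in the second variable. -/
def pt (f : 𝓢(ℝ × ℝ, ℂ)) : 𝓢(ℝ × ℝ, ℂ) := ∂_{((0, 1) : ℝ × ℝ)} f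

theorem hasDerivAt_fst (f : 𝓢(ℝ × ℝ, ℂ)) (z t : ℝ) :
    HasDerivAt (fun x => f (x, t)) (pz f (z, t)) z := by
  rw [pz, SchwartzMap.lineDerivOp_apply_eq_fderiv]
  exact f.differentiableAt.hasFDerivAt.comp_hasDerivAt z
    ((hasDerivAt_id z).prodMk (hasDerivAt_const z t))

theorem hasDerivAt_snd (f : 𝓢(ℝ × ℝ, ℂ)) (z t : ℝ) :
    HasDerivAt (fun x => f (z, x)) (pt f (z, t)) t := by
  rw [pt, SchwartzMap.lineDerivOp_apply_eq_fderiv]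
  exact f.differentiableAt.hasFDerivAt.comp_hasDerivAt t
    ((hasDerivAt_const t z).prodMk (hasDerivAt_id t))

theorem dz_eq (r : 𝓢(ℝ × ℝ, ℂ)) (z t : ℝ) : dz r z t = pz r (z, t) := (hasDerivAt_fst r z t).deriv

theorem dzz_eq (r : 𝓢(ℝ × ℝ, ℂ)) (z t : ℝ) : dzz r z t = pz (pz r) (z, t) := by
  unfold dzz
  simp_rw [dz_eq]
  exact (hasDerivAt_fst (pz r) z t).deriv

theorem dt_eq (r : 𝓢(ℝ × ℝ, ℂ)) (z t : ℝ) : dt r z t = pt r (z, t) := (hasDerivAt_snd r z t).deriv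

/-- The comparison function for the decay of the coefficients. -/
def decayFun (p : ℝ × ℝ) : ℝ := 1 / (1 + ‖p‖ ^ 2)

theorem decayFun_nonneg (p : ℝ × ℝ) : 0 ≤ decayFun p := by unfold decayFun; positivity

theorem decayFun_le_fst (p : ℝ × ℝ) : decayFun p ≤ 1 / (1 + p.1 ^ 2) := by
  unfold decayFun
  refine one_div_le_one_div_of_le (by positivity) ?_
  have := norm_fst_le p
  rw [Real.norm_eq_abs] at this
  rw [← sq_abs p.1]
  gcongr

theorem decayFun_le_snd (p : ℝ × ℝ) : decayFun p ≤ 1 / (1 + p.2 ^ 2) := by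
  unfold decayFun
  refine one_div_le_one_div_of_le (by positivity) ?_
  have := norm_snd_le p
  rw [Real.norm_eq_abs] at this
  rw [← sq_abs p.2]
  gcongr

theorem isBigO_decayFun (f : 𝓢(ℝ × ℝ, ℂ)) : f =O[⊤] decayFun := by
  obtain ⟨C0, h0⟩ := f.decay 0 0
  obtain ⟨C2, h2⟩ := f.decay 2 0
  refine IsBigO.of_bound (C0 + C2) (Eventually.of_forall fun p => ?_)
  have h0 := h0.2 p
  have h2 := h2.2 p
  simp only [pow_zero, one_mul, norm_iteratedFDeriv_zero] at h0 h2
  rw [Real.norm_of_nonneg (decayFun_nonneg p), decayFun, mul_one_div, le_div_iff₀ (by positivity)]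
  linarith

theorem isBigO_one (f : 𝓢(ℝ × ℝ, ℂ)) : f =O[⊤] fun _ => (1 : ℝ) :=
  (isBigO_decayFun f).trans <| IsBigO.of_bound 1 <| Eventually.of_forall fun p => by
    rw [Real.norm_of_nonneg (decayFun_nonneg p), decayFun]
    simp only [norm_one, mul_one]
    exact (div_le_one (by positivity)).2 (by nlinarith [sq_nonneg ‖p‖])

/-! ### The phase -/

theorem ofReal_theta1 (r : 𝓢(ℝ × ℝ, ℂ)) (z t : ℝ) :
    (theta1 r z t : ℂ) = r (z, t) * conj (r (z, t)) / 4 := by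
  rw [theta1, Complex.mul_conj, Complex.normSq_eq_norm_sq]
  push_cast; ring

theorem ofReal_theta2 (r : 𝓢(ℝ × ℝ, ℂ)) (z t : ℝ) :
    (theta2 r z t : ℂ) = (r (z, t) * conj (r (z, t))) ^ 2 / 8
      + Complex.I / 4 * (conj (r (z, t)) * pz r (z, t) - r (z, t) * conj (pz r (z, t))) := by
  rw [theta2, dz_eq, Complex.mul_conj, Complex.normSq_eq_norm_sq]
  set a := r (z, t)
  set b := pz r (z, t)
  have h := Complex.sub_conj (conj a * b)
  rw [map_mul, Complex.conj_conj] at h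
  rw [h]
  push_cast
  linear_combination (-((conj a * b).im : ℂ) / 2) * Complex.I_sq

theorem continuous_theta1 (r : 𝓢(ℝ × ℝ, ℂ)) : Continuous fun p : ℝ × ℝ => theta1 r p.1 p.2 := by
  unfold theta1
  have := r.continuous
  fun_prop

theorem continuous_theta2 (r : 𝓢(ℝ × ℝ, ℂ)) : Continuous fun p : ℝ × ℝ => theta2 r p.1 p.2 := by
  unfold theta2
  simp_rw [dz_eq]
  have h1 := r.continuous
  have h2 := (pz r).continuous
  refine Continuous.sub (by fun_prop) (Continuous.div_const (Complex.continuous_im.comp ?_) _)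
  exact (Complex.continuous_conj.comp (by fun_prop)).mul (by fun_prop)

theorem continuous_thetaInt (r : 𝓢(ℝ × ℝ, ℂ)) :
    Continuous fun p : ℝ × ℝ => thetaInt r p.1 p.2 := by
  unfold thetaInt
  refine Continuous.add ?_ ?_
  · refine intervalIntegral.continuous_parametric_intervalIntegral_of_continuous
      (f := fun (_ : ℝ × ℝ) τ => theta2 r 0 τ) ?_ continuous_snd
    exact (continuous_theta2 r).comp (f := fun q : (ℝ × ℝ) × ℝ => ((0 : ℝ), q.2)) (by fun_prop)
  · refine intervalIntegral.continuous_parametric_intervalIntegral_of_continuous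
      (f := fun (p : ℝ × ℝ) ζ => theta1 r ζ p.2) ?_ continuous_fst
    exact (continuous_theta1 r).comp (f := fun q : (ℝ × ℝ) × ℝ => (q.2, q.1.2)) (by fun_prop)

theorem hasDerivAt_thetaInt_fst (r : 𝓢(ℝ × ℝ, ℂ)) (z t : ℝ) :
    HasDerivAt (fun z => thetaInt r z t) (theta1 r z t) z := by
  have hc : Continuous fun ζ => theta1 r ζ t :=
    (continuous_theta1 r).comp (f := fun ζ : ℝ => (ζ, t)) (by fun_prop)
  exact (intervalIntegral.integral_hasDerivAt_right (hc.intervalIntegrable _ _)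
    (hc.stronglyMeasurableAtFilter _ _) hc.continuousAt).const_add _

/-- Differentiation under the integral sign for jointly continuous derivatives. -/
theorem hasDerivAt_intervalIntegral_param {E : Type*} [NormedAddCommGroup E] [NormedSpace ℝ E]
    {f f' : ℝ → ℝ → E} (hf : Continuous fun p : ℝ × ℝ => f p.1 p.2)
    (hf' : Continuous fun p : ℝ × ℝ => f' p.1 p.2)
    (h : ∀ x τ, HasDerivAt (fun x => f x τ) (f' x τ) x) (a b x₀ : ℝ) :
    HasDerivAt (fun x => ∫ τ in a..b, f x τ) (∫ τ in a..b, f' x₀ τ) x₀ := by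
  obtain ⟨C, hC⟩ := ((isCompact_Icc (a := x₀ - 1) (b := x₀ + 1)).prod
    (isCompact_uIcc (a := a) (b := b))).exists_bound_of_continuousOn hf'.continuousOn
  refine (intervalIntegral.hasDerivAt_integral_of_dominated_loc_of_deriv_le
    (s := Ioo (x₀ - 1) (x₀ + 1)) (bound := fun _ => C) (Ioo_mem_nhds (by linarith) (by linarith))
    ?_ ?_ ?_ ?_ ?_ ?_).2
  · exact Eventually.of_forall fun x =>
      (hf.comp (Continuous.prodMk_right x)).aestronglyMeasurable
  · exact (hf.comp (Continuous.prodMk_right x₀)).intervalIntegrable _ _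
  · exact (hf'.comp (Continuous.prodMk_right x₀)).aestronglyMeasurable
  · exact Eventually.of_forall fun τ hτ x hx =>
      hC (x, τ) ⟨Ioo_subset_Icc_self hx, uIoc_subset_uIcc hτ⟩
  · exact intervalIntegrable_const
  · exact Eventually.of_forall fun τ _ x _ => h x τ

theorem exists_real_between {T : EReal} (hT : 0 < T) : ∃ t₀ : ℝ, 0 < t₀ ∧ (t₀ : EReal) < T := by
  obtain ⟨t, h1, h2⟩ := EReal.lt_iff_exists_real_btwn.1 hT
  exact ⟨t, by exact_mod_cast h1, h2⟩

/-- The equation holds on the closed domain. -/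
theorem SolvesCLLNLS.pt_eq {T : EReal} (hT : 0 < T) {r : 𝓢(ℝ × ℝ, ℂ)} (hr : SolvesCLLNLS T r)
    {z t : ℝ} (h : (z, t) ∈ closedDomain T) :
    pt r (z, t) = Complex.I * pz (pz r) (z, t)
      + Complex.I * (r (z, t) * conj (r (z, t))) * r (z, t)
      + (r (z, t) * conj (r (z, t))) * pz r (z, t) := by
  obtain ⟨t₀, ht₀, ht₀T⟩ := exists_real_between hT
  set Q : ℝ × ℝ → ℂ := fun p => Complex.I * pz (pz r) p
      + Complex.I * (r p * conj (r p)) * r p + (r p * conj (r p)) * pz r p with hQ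
  have hQc : Continuous Q := by
    have h1 := r.continuous
    have h2 := (pz r).continuous
    have h3 := (pz (pz r)).continuous
    have h4 : Continuous fun p => conj (r p) := Complex.continuous_conj.comp h1
    fun_prop
  have hin : ∀ z t : ℝ, 0 < z → 0 < t → (t : EReal) < T → pt r (z, t) = Q (z, t) := by
    intro z t hz ht htT
    have := hr z t hz ht htT
    rw [dt_eq, dzz_eq, dz_eq] at this
    have hn : ((‖r (z, t)‖ : ℝ) : ℂ) ^ 2 = r (z, t) * conj (r (z, t)) := by
      rw [Complex.mul_conj, Complex.normSq_eq_norm_sq]; push_cast; ring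
    rw [hn] at this
    simp only [hQ]
    linear_combination (-Complex.I) * this + (pt r (z, t) -
      (r (z, t) * conj (r (z, t))) * pz r (z, t)) * Complex.I_sq
  let γ : ℝ → ℝ × ℝ := fun ε => (z + ε, (1 - ε) * t + ε * t₀)
  have hγ : Continuous γ := by fun_prop
  have hγ0 : γ 0 = (z, t) := by simp [γ]
  have hev : ∀ᶠ ε in 𝓝[>] (0 : ℝ), pt r (γ ε) = Q (γ ε) := by
    filter_upwards [Ioo_mem_nhdsGT (zero_lt_one)] with ε hε
    refine hin _ _ (by linarith [h.1, hε.1]) ?_ ?_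
    · have := h.2.1
      nlinarith [mul_pos hε.1 ht₀, mul_nonneg (by linarith [hε.2] : (0 : ℝ) ≤ 1 - ε) this]
    · rcases le_or_gt t t₀ with h' | h'
      · refine lt_of_le_of_lt (EReal.coe_le_coe_iff.2 ?_) ht₀T
        nlinarith [hε.1, hε.2]
      · refine lt_of_lt_of_le (EReal.coe_lt_coe_iff.2 ?_) h.2.2
        change (1 - ε) * t + ε * t₀ < t
        nlinarith [hε.1, hε.2]
  have l1 : Tendsto (fun ε => pt r (γ ε)) (𝓝[>] 0) (𝓝 (pt r (γ 0))) :=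
    (((pt r).continuous.comp hγ).tendsto 0).mono_left nhdsWithin_le_nhds
  have l2 : Tendsto (fun ε => Q (γ ε)) (𝓝[>] 0) (𝓝 (Q (γ 0))) :=
    ((hQc.comp hγ).tendsto 0).mono_left nhdsWithin_le_nhds
  have := tendsto_nhds_unique l1 (l2.congr' (hev.mono fun ε h => h.symm))
  rwa [hγ0] at this

theorem hasDerivAt_conj {f : ℝ → ℂ} {f' : ℂ} {x : ℝ} (h : HasDerivAt f f' x) :
    HasDerivAt (fun x => conj (f x)) (conj f') x := h.star

/-- `Θ` is closed. -/
theorem hasDerivAt_thetaInt_snd {T : EReal} (hT : 0 < T) {r : 𝓢(ℝ × ℝ, ℂ)}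
    (hr : SolvesCLLNLS T r) {z t : ℝ} (h : (z, t) ∈ closedDomain T) :
    HasDerivAt (fun t => thetaInt r z t) (theta2 r z t) t := by
  set g : ℝ → ℝ → ℂ := fun t ζ =>
    (pt r (ζ, t) * conj (r (ζ, t)) + r (ζ, t) * conj (pt r (ζ, t))) / 4
  have hcc : ∀ f : 𝓢(ℝ × ℝ, ℂ), Continuous fun p : ℝ × ℝ => f (p.2, p.1) := fun f =>
    f.continuous.comp continuous_swap
  have hcj : ∀ f : 𝓢(ℝ × ℝ, ℂ), Continuous fun p : ℝ × ℝ => conj (f (p.2, p.1)) := fun f =>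
    Complex.continuous_conj.comp (hcc f)
  have hgc : Continuous fun p : ℝ × ℝ => g p.1 p.2 :=
    (((hcc _).mul (hcj _)).add ((hcc _).mul (hcj _))).div_const 4
  have h1 : HasDerivAt (fun t => ∫ ζ in (0 : ℝ)..z, (theta1 r ζ t : ℂ))
      (∫ ζ in (0 : ℝ)..z, g t ζ) t := by
    refine hasDerivAt_intervalIntegral_param (f := fun t ζ => (theta1 r ζ t : ℂ)) ?_ hgc ?_ _ _ _
    · exact Complex.continuous_ofReal.comp ((continuous_theta1 r).comp continuous_swap)
    · intro t ζ
      simp_rw [ofReal_theta1]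
      exact ((hasDerivAt_snd r ζ t).mul (hasDerivAt_conj (hasDerivAt_snd r ζ t))).div_const 4
  have h2 : ∫ ζ in (0 : ℝ)..z, g t ζ = (theta2 r z t : ℂ) - theta2 r 0 t := by
    refine intervalIntegral.integral_eq_sub_of_hasDerivAt (f := fun ζ => (theta2 r ζ t : ℂ)) ?_
      ((hgc.comp (Continuous.prodMk_right t)).intervalIntegrable _ _)
    intro ζ hζ
    rw [uIcc_of_le h.1] at hζ
    simp_rw [ofReal_theta2]
    have d := hasDerivAt_fst r ζ t
    have dd := hasDerivAt_fst (pz r) ζ t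
    have dc := hasDerivAt_conj d
    have ddc := hasDerivAt_conj dd
    refine ((((d.mul dc).pow 2).div_const 8).add
      (((dc.mul dd).sub (d.mul ddc)).const_mul (Complex.I / 4))).congr_deriv ?_
    have e := hr.pt_eq hT (z := ζ) (t := t) ⟨hζ.1, h.2⟩
    have ec := congrArg conj e
    simp only [map_add, map_mul, Complex.conj_I, Complex.conj_conj] at ec
    simp only [g]
    rw [ec, e]
    simp only [Pi.mul_apply]
    ring
  rw [h2] at h1
  have h3 : HasDerivAt (fun t => ∫ τ in (0 : ℝ)..t, theta2 r 0 τ) (theta2 r 0 t) t := by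
    have hc : Continuous fun τ => theta2 r 0 τ :=
      (continuous_theta2 r).comp (f := fun τ : ℝ => (0, τ)) (by fun_prop)
    exact intervalIntegral.integral_hasDerivAt_right (hc.intervalIntegrable _ _)
      (hc.stronglyMeasurableAtFilter _ _) hc.continuousAt
  have h4 := Complex.reCLM.hasFDerivAt.comp_hasDerivAt t h1
  have h5 : (⇑Complex.reCLM ∘ fun t => ∫ ζ in (0 : ℝ)..z, (theta1 r ζ t : ℂ))
      = fun t => ∫ ζ in (0 : ℝ)..z, theta1 r ζ t := by
    ext t
    simp only [Function.comp_apply, intervalIntegral.integral_ofReal, Complex.reCLM_apply,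
      Complex.ofReal_re]
  rw [h5] at h4
  refine (h3.add h4).congr_deriv ?_
  simp

/-! ### The coefficient matrices in explicit form -/

/-- The phase factor `e^{2 i a ∫Θ}`, `a = ±1`. -/
def phase (r : 𝓢(ℝ × ℝ, ℂ)) (a : ℂ) (z t : ℝ) : ℂ :=
  Complex.exp (2 * a * Complex.I * (thetaInt r z t : ℂ))

theorem phase_mul (r : 𝓢(ℝ × ℝ, ℂ)) (z t : ℝ) : phase r (-1) z t * phase r 1 z t = 1 := by
  rw [phase, phase, ← Complex.exp_add, ← Complex.exp_zero]
  congr 1; ring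

theorem continuous_phase (r : 𝓢(ℝ × ℝ, ℂ)) (a : ℂ) :
    Continuous fun p : ℝ × ℝ => phase r a p.1 p.2 :=
  Complex.continuous_exp.comp
    (continuous_const.mul (Complex.continuous_ofReal.comp (continuous_thetaInt r)))

theorem conj_phase (r : 𝓢(ℝ × ℝ, ℂ)) (a : ℝ) (z t : ℝ) :
    conj (phase r a z t) = phase r (-a) z t := by
  rw [phase, phase, ← Complex.exp_conj]
  congr 1
  simp [Complex.conj_ofNat]

theorem norm_phase (r : 𝓢(ℝ × ℝ, ℂ)) (a : ℝ) (z t : ℝ) : ‖phase r a z t‖ = 1 := by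
  have : (2 * (a : ℂ) * Complex.I * (thetaInt r z t : ℂ))
      = ((2 * a * thetaInt r z t : ℝ) : ℂ) * Complex.I := by push_cast; ring
  rw [phase, this, Complex.norm_exp_ofReal_mul_I]

theorem hasDerivAt_phase_fst (r : 𝓢(ℝ × ℝ, ℂ)) (a : ℂ) (z t : ℝ) :
    HasDerivAt (fun z => phase r a z t)
      (2 * a * Complex.I * theta1 r z t * phase r a z t) z :=
  ((hasDerivAt_thetaInt_fst r z t).ofReal_comp.const_mul (2 * a * Complex.I)).cexp.congr_deriv
    (by rw [phase]; ring)

theorem hasDerivAt_phase_snd {T : EReal} (hT : 0 < T) {r : 𝓢(ℝ × ℝ, ℂ)} (hr : SolvesCLLNLS T r)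
    (a : ℂ) {z t : ℝ} (h : (z, t) ∈ closedDomain T) :
    HasDerivAt (fun t => phase r a z t)
      (2 * a * Complex.I * theta2 r z t * phase r a z t) t :=
  ((hasDerivAt_thetaInt_snd hT hr h).ofReal_comp.const_mul (2 * a * Complex.I)).cexp.congr_deriv
    (by rw [phase]; ring)

/-- The coefficient of `e^{-2i∫Θ}` in the upper right entry of `B₁`. -/
def coeffB (r : 𝓢(ℝ × ℝ, ℂ)) (s : ℂ) (p : ℝ × ℝ) : ℂ :=
  -2 * s ^ 3 * r p + s * (r p + Complex.I * pz r p + r p ^ 2 * conj (r p) / 2)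

/-- The upper left entry of `B₁`. -/
def diagB (r : 𝓢(ℝ × ℝ, ℂ)) (s : ℂ) (p : ℝ × ℝ) : ℂ :=
  Complex.I * s ^ 2 * (r p * conj (r p)) - Complex.I / 4 * (r p * conj (r p)) ^ 2
    + (conj (r p) * pz r p - r p * conj (pz r p)) / 2

theorem A1_eq (r : 𝓢(ℝ × ℝ, ℂ)) (z t : ℝ) (s : ℂ) :
    A1 r z t s = !![-(Complex.I / 2) * (r (z, t) * conj (r (z, t))),
        s * r (z, t) * phase r (-1) z t;
      -s * conj (r (z, t)) * phase r 1 z t,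
        Complex.I / 2 * (r (z, t) * conj (r (z, t)))] := by
  have hm : phase r (-1) z t = Complex.exp (-Complex.I * (thetaInt r z t : ℂ)) ^ 2 := by
    rw [phase, ← Complex.exp_nat_mul]; congr 1; push_cast; ring
  have hp : phase r 1 z t = Complex.exp (-(-Complex.I * (thetaInt r z t : ℂ))) ^ 2 := by
    rw [phase, ← Complex.exp_nat_mul]; congr 1; push_cast; ring
  have h1 : Complex.exp (-Complex.I * (thetaInt r z t : ℂ))
      * Complex.exp (-(-Complex.I * (thetaInt r z t : ℂ))) = 1 := by
    rw [← Complex.exp_add, ← Complex.exp_zero]; congr 1; ring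
  rw [hm, hp, A1, expHat, laxA, ofReal_theta1]
  generalize Complex.exp (-Complex.I * (thetaInt r z t : ℂ)) = x at *
  generalize Complex.exp (-(-Complex.I * (thetaInt r z t : ℂ))) = y at *
  generalize r (z, t) = q
  ext i j
  fin_cases i <;> fin_cases j <;>
    simp [offDiag, sigma, pow_two, Matrix.mul_apply, Matrix.diagonal]
  · linear_combination (-(Complex.I / 2) * (q * conj q)) * h1
  · ring
  · ring
  · linear_combination (Complex.I / 2 * (q * conj q)) * h1

theorem B1_eq (r : 𝓢(ℝ × ℝ, ℂ)) (z t : ℝ) (s : ℂ) :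
    B1 r z t s = !![diagB r s (z, t), coeffB r s (z, t) * phase r (-1) z t;
      -conj (coeffB r (conj s) (z, t)) * phase r 1 z t, -diagB r s (z, t)] := by
  have hm : phase r (-1) z t = Complex.exp (-Complex.I * (thetaInt r z t : ℂ)) ^ 2 := by
    rw [phase, ← Complex.exp_nat_mul]; congr 1; push_cast; ring
  have hp : phase r 1 z t = Complex.exp (-(-Complex.I * (thetaInt r z t : ℂ))) ^ 2 := by
    rw [phase, ← Complex.exp_nat_mul]; congr 1; push_cast; ring
  have h1 : Complex.exp (-Complex.I * (thetaInt r z t : ℂ))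
      * Complex.exp (-(-Complex.I * (thetaInt r z t : ℂ))) = 1 := by
    rw [← Complex.exp_add, ← Complex.exp_zero]; congr 1; ring
  rw [hm, hp, B1, expHat, laxB, ofReal_theta2, dz_eq, diagB, coeffB, coeffB]
  generalize Complex.exp (-Complex.I * (thetaInt r z t : ℂ)) = x at *
  generalize Complex.exp (-(-Complex.I * (thetaInt r z t : ℂ))) = y at *
  generalize r (z, t) = q
  generalize pz r (z, t) = q'
  have e3 : ∀ M : Matrix (Fin 2) (Fin 2) ℂ, M ^ 3 = M * M * M := fun M => by
    rw [pow_succ, pow_two]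
  have e4 : ∀ M : Matrix (Fin 2) (Fin 2) ℂ, M ^ 4 = M * M * (M * M) := fun M => by
    rw [pow_succ, e3, mul_assoc (M * M)]
  ext i j
  rw [e3, e4, pow_two (offDiag q)]
  fin_cases i <;> fin_cases j <;>
    simp [offDiag, sigma, Matrix.mul_apply, Matrix.diagonal, Complex.conj_ofNat]
  · linear_combination (Complex.I * s ^ 2 * (q * conj q) - Complex.I / 4 * (q * conj q) ^ 2
      + (conj q * q' - q * conj q') / 2) * h1
      + (x * y * (q * conj q' - conj q * q') / 4) * Complex.I_sq
  · ring
  · ring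
  · linear_combination (-(Complex.I * s ^ 2 * (q * conj q) - Complex.I / 4 * (q * conj q) ^ 2
      + (conj q * q' - q * conj q') / 2)) * h1
      + (x * y * (conj q * q' - q * conj q') / 4) * Complex.I_sq

/-- The `t`-derivative of `A₁`. -/
def A1t (r : 𝓢(ℝ × ℝ, ℂ)) (z t : ℝ) (s : ℂ) : Matrix (Fin 2) (Fin 2) ℂ :=
  let q := r (z, t)
  let q' := pt r (z, t)
  !![-(Complex.I / 2) * (q' * conj q + q * conj q'),
      s * (q' - 2 * Complex.I * theta2 r z t * q) * phase r (-1) z t;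
    -s * (conj q' + 2 * Complex.I * theta2 r z t * conj q) * phase r 1 z t,
      Complex.I / 2 * (q' * conj q + q * conj q')]

theorem hasDerivAt_A1 {T : EReal} (hT : 0 < T) {r : 𝓢(ℝ × ℝ, ℂ)} (hr : SolvesCLLNLS T r)
    {z t : ℝ} (h : (z, t) ∈ closedDomain T) (s : ℂ) (i j : Fin 2) :
    HasDerivAt (fun t => A1 r z t s i j) (A1t r z t s i j) t := by
  have d := hasDerivAt_snd r z t
  have dc := hasDerivAt_conj d
  have hm := hasDerivAt_phase_snd hT hr (-1) h
  have hp := hasDerivAt_phase_snd hT hr 1 h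
  simp_rw [A1_eq]
  fin_cases i <;> fin_cases j <;> simp only [A1t]
  · exact (d.mul dc).const_mul (-(Complex.I / 2))
  · exact ((d.const_mul s).mul hm).congr_deriv (by simp; ring)
  · exact ((dc.const_mul (-s)).mul hp).congr_deriv (by simp; ring)
  · exact (d.mul dc).const_mul (Complex.I / 2)

/-- The `z`-derivative of `coeffB`. -/
def coeffBz (r : 𝓢(ℝ × ℝ, ℂ)) (s : ℂ) (p : ℝ × ℝ) : ℂ :=
  -2 * s ^ 3 * pz r p + s * (pz r p + Complex.I * pz (pz r) p
    + (2 * r p * pz r p * conj (r p) + r p ^ 2 * conj (pz r p)) / 2)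

/-- The `z`-derivative of `diagB`. -/
def diagBz (r : 𝓢(ℝ × ℝ, ℂ)) (s : ℂ) (p : ℝ × ℝ) : ℂ :=
  Complex.I * s ^ 2 * (pz r p * conj (r p) + r p * conj (pz r p))
    - Complex.I / 2 * (r p * conj (r p)) * (pz r p * conj (r p) + r p * conj (pz r p))
    + (conj (r p) * pz (pz r) p - r p * conj (pz (pz r) p)) / 2

theorem hasDerivAt_coeffB (r : 𝓢(ℝ × ℝ, ℂ)) (s : ℂ) (z t : ℝ) :
    HasDerivAt (fun z => coeffB r s (z, t)) (coeffBz r s (z, t)) z := by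
  have d := hasDerivAt_fst r z t
  have dc := hasDerivAt_conj d
  have dd := hasDerivAt_fst (pz r) z t
  refine ((d.const_mul (-2 * s ^ 3)).add (((d.add (dd.const_mul Complex.I)).add
    (((d.pow 2).mul dc).div_const 2)).const_mul s)).congr_deriv ?_
  simp [coeffBz]

theorem hasDerivAt_diagB (r : 𝓢(ℝ × ℝ, ℂ)) (s : ℂ) (z t : ℝ) :
    HasDerivAt (fun z => diagB r s (z, t)) (diagBz r s (z, t)) z := by
  have d := hasDerivAt_fst r z t
  have dc := hasDerivAt_conj d
  have dd := hasDerivAt_fst (pz r) z t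
  have ddc := hasDerivAt_conj dd
  refine ((((d.mul dc).const_mul (Complex.I * s ^ 2)).sub
    (((d.mul dc).pow 2).const_mul (Complex.I / 4))).add
    (((dc.mul dd).sub (d.mul ddc)).div_const 2)).congr_deriv ?_
  simp [diagBz]
  ring

/-- The `z`-derivative of `B₁`. -/
def B1z (r : 𝓢(ℝ × ℝ, ℂ)) (z t : ℝ) (s : ℂ) : Matrix (Fin 2) (Fin 2) ℂ :=
  !![diagBz r s (z, t),
      (coeffBz r s (z, t) - 2 * Complex.I * theta1 r z t * coeffB r s (z, t)) * phase r (-1) z t;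
    -(conj (coeffBz r (conj s) (z, t))
        + 2 * Complex.I * theta1 r z t * conj (coeffB r (conj s) (z, t))) * phase r 1 z t,
      -diagBz r s (z, t)]

theorem hasDerivAt_B1 (r : 𝓢(ℝ × ℝ, ℂ)) (z t : ℝ) (s : ℂ) (i j : Fin 2) :
    HasDerivAt (fun z => B1 r z t s i j) (B1z r z t s i j) z := by
  have d := hasDerivAt_coeffB r s z t
  have dc := hasDerivAt_conj (hasDerivAt_coeffB r (conj s) z t)
  have dd := hasDerivAt_diagB r s z t
  have hm := hasDerivAt_phase_fst r (-1) z t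
  have hp := hasDerivAt_phase_fst r 1 z t
  simp_rw [B1_eq]
  fin_cases i <;> fin_cases j <;> simp only [B1z]
  · exact dd
  · exact (d.mul hm).congr_deriv (by simp; ring)
  · exact (dc.neg.mul hp).congr_deriv (by simp; ring)
  · exact dd.neg

/-- The diagonal matrix `c (σ - σ_kk)`. -/
def adMat (k : Fin 2) (c : ℂ) : Matrix (Fin 2) (Fin 2) ℂ :=
  Matrix.diagonal fun i => c * (sgn i - sgn k)

theorem adMat_mulVec (k : Fin 2) (c : ℂ) (v : Fin 2 → ℂ) : (adMat k c).mulVec v = adCol k c v := by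
  ext i; simp [adMat, adCol, Matrix.mulVec_diagonal]

/-- The compatibility of the `z`- and `t`-parts of the Lax pair. -/
theorem zero_curvature {T : EReal} (hT : 0 < T) {r : 𝓢(ℝ × ℝ, ℂ)} (hr : SolvesCLLNLS T r)
    {z t : ℝ} (h : (z, t) ∈ closedDomain T) (k : Fin 2) (s : ℂ) :
    A1t r z t s + (adMat k (Complex.I * lam s) + A1 r z t s)
        * (adMat k (-2 * Complex.I * lam s ^ 2) + B1 r z t s)
      = B1z r z t s + (adMat k (-2 * Complex.I * lam s ^ 2) + B1 r z t s)
        * (adMat k (Complex.I * lam s) + A1 r z t s) := by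
  have e := hr.pt_eq hT h
  have ec := congrArg conj e
  have hI := Complex.I_sq
  simp only [map_add, map_mul, Complex.conj_I, Complex.conj_conj] at ec
  have hph := phase_mul r z t
  have s0 : sgn 0 = 1 := rfl
  have s1 : sgn 1 = -1 := rfl
  rw [A1_eq, B1_eq, A1t, B1z, ofReal_theta1, ofReal_theta2, diagB, coeffB, coeffB, diagBz,
    coeffBz, coeffBz]
  simp only [e]
  clear e ec
  generalize phase r (-1) z t = x at *
  generalize phase r 1 z t = y at *
  generalize r (z, t) = q at *
  generalize pz r (z, t) = q' at *
  generalize pz (pz r) (z, t) = q'' at *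
  simp only [map_add, map_mul, map_pow, map_neg, map_div₀, Complex.conj_conj,
    Complex.conj_I, map_ofNat]
  generalize conj q = p
  generalize conj q' = p'
  generalize conj q'' = p''
  generalize Complex.I = I at *
  generalize hk : sgn k = κ
  clear h hr hT
  ext i j
  fin_cases i <;> fin_cases j <;>
    simp [adMat, Matrix.mul_apply, Fin.sum_univ_two, lam, hk, s0, s1] <;>
    clear hk s0 s1
  · grind
  · grind
  · grind
  · grind

/-! ### Decay and continuity of the coefficients -/

theorem isBigO_conj {f : ℝ × ℝ → ℂ} {g : ℝ × ℝ → ℝ} (h : f =O[⊤] g) :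
    (fun p => conj (f p)) =O[⊤] g :=
  (IsBigO.of_norm_left (by simpa using h.norm_left))

theorem isBigO_mul_bounded {f g : ℝ × ℝ → ℂ} {w : ℝ × ℝ → ℝ} (hf : f =O[⊤] w)
    (hg : g =O[⊤] fun _ => (1 : ℝ)) : (fun p => f p * g p) =O[⊤] w := by
  simpa using hf.mul hg

theorem isBigO_phase (r : 𝓢(ℝ × ℝ, ℂ)) (a : ℝ) :
    (fun p : ℝ × ℝ => phase r a p.1 p.2) =O[⊤] fun _ => (1 : ℝ) :=
  IsBigO.of_bound 1 (Eventually.of_forall fun p => by simp [norm_phase])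

theorem isBigO_theta2 (r : 𝓢(ℝ × ℝ, ℂ)) :
    (fun p : ℝ × ℝ => (theta2 r p.1 p.2 : ℂ)) =O[⊤] fun _ => (1 : ℝ) := by
  simp_rw [ofReal_theta2]
  have h := isBigO_one r
  have hc := isBigO_conj h
  have h' := isBigO_one (pz r)
  have hc' := isBigO_conj h'
  have h1 := isBigO_mul_bounded h hc
  simp_rw [pow_two, div_eq_mul_inv, mul_comm _ (8⁻¹ : ℂ)]
  exact ((isBigO_mul_bounded h1 h1).const_mul_left _).add
    (((isBigO_mul_bounded hc h').sub (isBigO_mul_bounded h hc')).const_mul_left _)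

theorem isBigO_A1 (r : 𝓢(ℝ × ℝ, ℂ)) (s : ℂ) (i j : Fin 2) :
    (fun p : ℝ × ℝ => A1 r p.1 p.2 s i j) =O[⊤] decayFun := by
  have h := isBigO_decayFun r
  have hc := isBigO_conj h
  have hc1 := isBigO_conj (isBigO_one r)
  have e1 := isBigO_phase r 1
  have e2 := isBigO_phase r (-1)
  push_cast at e1 e2
  simp_rw [A1_eq]
  fin_cases i <;> fin_cases j
  · exact (isBigO_mul_bounded h hc1).const_mul_left _
  · exact isBigO_mul_bounded (h.const_mul_left _) e2
  · exact isBigO_mul_bounded (hc.const_mul_left _) e1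
  · exact (isBigO_mul_bounded h hc1).const_mul_left _

theorem isBigO_A1t (r : 𝓢(ℝ × ℝ, ℂ)) (s : ℂ) (i j : Fin 2) :
    (fun p : ℝ × ℝ => A1t r p.1 p.2 s i j) =O[⊤] decayFun := by
  have h := isBigO_decayFun r
  have hc := isBigO_conj h
  have hc1 := isBigO_conj (isBigO_one r)
  have h' := isBigO_decayFun (pt r)
  have hc' := isBigO_conj h'
  have hc1' := isBigO_conj (isBigO_one (pt r))
  have hθ := isBigO_theta2 r
  have hθ2 := hθ.const_mul_left (2 * Complex.I)
  have e1 := isBigO_phase r 1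
  have e2 := isBigO_phase r (-1)
  push_cast at e1 e2
  have hq : ∀ {g : ℝ × ℝ → ℂ}, g =O[⊤] decayFun →
      (fun p : ℝ × ℝ => 2 * Complex.I * theta2 r p.1 p.2 * g p) =O[⊤] decayFun := fun hg => by
    have := isBigO_mul_bounded hg hθ2
    simpa only [mul_comm] using this
  have hd := (isBigO_mul_bounded h' hc1).add (isBigO_mul_bounded h hc1')
  simp only [A1t]
  fin_cases i <;> fin_cases j
  · exact hd.const_mul_left _
  · exact isBigO_mul_bounded ((h'.sub (hq h)).const_mul_left _) e2
  · exact isBigO_mul_bounded ((hc'.add (hq hc)).const_mul_left _) e1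
  · exact hd.const_mul_left _

theorem isBigO_coeffB (r : 𝓢(ℝ × ℝ, ℂ)) (s : ℂ) : coeffB r s =O[⊤] decayFun := by
  have h := isBigO_decayFun r
  have h1 := isBigO_one r
  have hc1 := isBigO_conj h1
  have h' := isBigO_decayFun (pz r)
  have h3 : (fun p => r p ^ 2 * conj (r p) / 2) =O[⊤] decayFun := by
    have := (isBigO_mul_bounded (isBigO_mul_bounded h h1) hc1).const_mul_left (1 / 2)
    refine this.congr_left fun p => ?_
    ring
  exact (h.const_mul_left _).add (((h.add (h'.const_mul_left _)).add h3).const_mul_left _)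

theorem isBigO_diagB (r : 𝓢(ℝ × ℝ, ℂ)) (s : ℂ) : diagB r s =O[⊤] decayFun := by
  have h := isBigO_decayFun r
  have h1 := isBigO_one r
  have hc := isBigO_conj h
  have hc1 := isBigO_conj h1
  have h1' := isBigO_one (pz r)
  have hc1' := isBigO_conj h1'
  have hm := isBigO_mul_bounded h hc1
  have hm1 := isBigO_mul_bounded h1 hc1
  have h2 := isBigO_mul_bounded hm hm1
  have h3 := ((isBigO_mul_bounded hc h1').sub (isBigO_mul_bounded h hc1')).const_mul_left (1 / 2)
  refine (((hm.const_mul_left (Complex.I * s ^ 2)).sub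
    (h2.const_mul_left (Complex.I / 4))).add h3).congr_left fun p => ?_
  rw [diagB]; ring

theorem isBigO_B1 (r : 𝓢(ℝ × ℝ, ℂ)) (s : ℂ) (i j : Fin 2) :
    (fun p : ℝ × ℝ => B1 r p.1 p.2 s i j) =O[⊤] decayFun := by
  have e1 := isBigO_phase r 1
  have e2 := isBigO_phase r (-1)
  push_cast at e1 e2
  simp_rw [B1_eq]
  fin_cases i <;> fin_cases j
  · exact isBigO_diagB r s
  · exact isBigO_mul_bounded (isBigO_coeffB r s) e2
  · exact isBigO_mul_bounded (isBigO_conj (isBigO_coeffB r (conj s))).neg_left e1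
  · exact (isBigO_diagB r s).neg_left

theorem exists_entry_bound {G : ℝ × ℝ → Matrix (Fin 2) (Fin 2) ℂ}
    (h : ∀ i j, (fun p => G p i j) =O[⊤] decayFun) :
    ∃ C : ℝ, 0 ≤ C ∧ ∀ p i j, ‖G p i j‖ ≤ C * decayFun p := by
  choose c hc using fun i j => isBigO_top.1 (h i j)
  refine ⟨∑ i, ∑ j, |c i j|, by positivity, fun p i j => ?_⟩
  have h1 := hc i j p
  rw [Real.norm_of_nonneg (decayFun_nonneg p)] at h1
  refine h1.trans (mul_le_mul_of_nonneg_right ?_ (decayFun_nonneg p))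
  calc c i j ≤ |c i j| := le_abs_self _
    _ ≤ ∑ j, |c i j| := Finset.single_le_sum (f := fun j => |c i j|)
        (fun _ _ => abs_nonneg _) (Finset.mem_univ j)
    _ ≤ _ := Finset.single_le_sum (f := fun i => ∑ j, |c i j|)
        (fun _ _ => Finset.sum_nonneg fun _ _ => abs_nonneg _) (Finset.mem_univ i)

theorem exists_A1_bound (r : 𝓢(ℝ × ℝ, ℂ)) (s : ℂ) :
    ∃ C : ℝ, 0 ≤ C ∧ ∀ z t i j, ‖A1 r z t s i j‖ ≤ C / (1 + z ^ 2) := by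
  obtain ⟨C, hC, h⟩ := exists_entry_bound (isBigO_A1 r s)
  refine ⟨C, hC, fun z t i j => (h (z, t) i j).trans ?_⟩
  rw [div_eq_mul_one_div]
  exact mul_le_mul_of_nonneg_left (decayFun_le_fst (z, t)) hC

theorem exists_A1t_bound (r : 𝓢(ℝ × ℝ, ℂ)) (s : ℂ) :
    ∃ C : ℝ, 0 ≤ C ∧ ∀ z t i j, ‖A1t r z t s i j‖ ≤ C / (1 + z ^ 2) := by
  obtain ⟨C, hC, h⟩ := exists_entry_bound (isBigO_A1t r s)
  refine ⟨C, hC, fun z t i j => (h (z, t) i j).trans ?_⟩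
  rw [div_eq_mul_one_div]
  exact mul_le_mul_of_nonneg_left (decayFun_le_fst (z, t)) hC

theorem exists_B1_bound (r : 𝓢(ℝ × ℝ, ℂ)) (s : ℂ) :
    ∃ C : ℝ, 0 ≤ C ∧ (∀ z t i j, ‖B1 r z t s i j‖ ≤ C / (1 + z ^ 2)) ∧
      ∀ z t i j, ‖B1 r z t s i j‖ ≤ C / (1 + t ^ 2) := by
  obtain ⟨C, hC, h⟩ := exists_entry_bound (isBigO_B1 r s)
  refine ⟨C, hC, fun z t i j => (h (z, t) i j).trans ?_, fun z t i j => (h (z, t) i j).trans ?_⟩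
  · rw [div_eq_mul_one_div]
    exact mul_le_mul_of_nonneg_left (decayFun_le_fst (z, t)) hC
  · rw [div_eq_mul_one_div]
    exact mul_le_mul_of_nonneg_left (decayFun_le_snd (z, t)) hC

theorem continuous_conj_schwartz (f : 𝓢(ℝ × ℝ, ℂ)) : Continuous fun p => conj (f p) :=
  Complex.continuous_conj.comp f.continuous

theorem continuous_A1 (r : 𝓢(ℝ × ℝ, ℂ)) (s : ℂ) :
    Continuous fun p : ℝ × ℝ => A1 r p.1 p.2 s := by
  simp_rw [A1_eq]
  have h := r.continuous
  have hc := continuous_conj_schwartz r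
  have e1 := continuous_phase r 1
  have e2 := continuous_phase r (-1)
  refine continuous_matrix fun i j => ?_
  fin_cases i <;> fin_cases j
  · exact continuous_const.mul (h.mul hc)
  · exact (continuous_const.mul h).mul e2
  · exact (continuous_const.mul hc).mul e1
  · exact continuous_const.mul (h.mul hc)

theorem continuous_A1t (r : 𝓢(ℝ × ℝ, ℂ)) (s : ℂ) :
    Continuous fun p : ℝ × ℝ => A1t r p.1 p.2 s := by
  have h := r.continuous
  have hc := continuous_conj_schwartz r
  have h' := (pt r).continuous
  have hc' := continuous_conj_schwartz (pt r)
  have e1 := continuous_phase r 1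
  have e2 := continuous_phase r (-1)
  have hθ : Continuous fun p : ℝ × ℝ => 2 * Complex.I * (theta2 r p.1 p.2 : ℂ) :=
    continuous_const.mul (Complex.continuous_ofReal.comp (continuous_theta2 r))
  refine continuous_matrix fun i j => ?_
  simp only [A1t]
  fin_cases i <;> fin_cases j
  · exact continuous_const.mul ((h'.mul hc).add (h.mul hc'))
  · exact (continuous_const.mul (h'.sub (hθ.mul h))).mul e2
  · exact (continuous_const.mul (hc'.add (hθ.mul hc))).mul e1
  · exact continuous_const.mul ((h'.mul hc).add (h.mul hc'))

theorem continuous_coeffB (r : 𝓢(ℝ × ℝ, ℂ)) (s : ℂ) : Continuous (coeffB r s) := by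
  unfold coeffB
  have h := r.continuous
  have hc := continuous_conj_schwartz r
  have h' := (pz r).continuous
  fun_prop

theorem continuous_coeffBz (r : 𝓢(ℝ × ℝ, ℂ)) (s : ℂ) : Continuous (coeffBz r s) := by
  unfold coeffBz
  have h := r.continuous
  have hc := continuous_conj_schwartz r
  have h' := (pz r).continuous
  have hc' := continuous_conj_schwartz (pz r)
  have h'' := (pz (pz r)).continuous
  fun_prop

theorem continuous_diagB (r : 𝓢(ℝ × ℝ, ℂ)) (s : ℂ) : Continuous (diagB r s) := by
  unfold diagB
  have h := r.continuous
  have hc := continuous_conj_schwartz r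
  have h' := (pz r).continuous
  have hc' := continuous_conj_schwartz (pz r)
  fun_prop

theorem continuous_diagBz (r : 𝓢(ℝ × ℝ, ℂ)) (s : ℂ) : Continuous (diagBz r s) := by
  unfold diagBz
  have h := r.continuous
  have hc := continuous_conj_schwartz r
  have h' := (pz r).continuous
  have hc' := continuous_conj_schwartz (pz r)
  have h'' := (pz (pz r)).continuous
  have hc'' := continuous_conj_schwartz (pz (pz r))
  fun_prop

theorem continuous_B1 (r : 𝓢(ℝ × ℝ, ℂ)) (s : ℂ) :
    Continuous fun p : ℝ × ℝ => B1 r p.1 p.2 s := by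
  simp_rw [B1_eq]
  have hd := continuous_diagB r s
  have h := continuous_coeffB r s
  have hc := Complex.continuous_conj.comp (continuous_coeffB r (conj s))
  have e1 := continuous_phase r 1
  have e2 := continuous_phase r (-1)
  refine continuous_matrix fun i j => ?_
  fin_cases i <;> fin_cases j
  · exact hd
  · exact h.mul e2
  · exact hc.neg.mul e1
  · exact hd.neg

theorem continuous_B1z (r : 𝓢(ℝ × ℝ, ℂ)) (s : ℂ) :
    Continuous fun p : ℝ × ℝ => B1z r p.1 p.2 s := by
  have hd := continuous_diagBz r s
  have h := continuous_coeffB r s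
  have hc := Complex.continuous_conj.comp (continuous_coeffB r (conj s))
  have h' := continuous_coeffBz r s
  have hc' := Complex.continuous_conj.comp (continuous_coeffBz r (conj s))
  have e1 := continuous_phase r 1
  have e2 := continuous_phase r (-1)
  have hθ : Continuous fun p : ℝ × ℝ => 2 * Complex.I * (theta1 r p.1 p.2 : ℂ) :=
    continuous_const.mul (Complex.continuous_ofReal.comp (continuous_theta1 r))
  refine continuous_matrix fun i j => ?_
  simp only [B1z]
  fin_cases i <;> fin_cases j
  · exact hd
  · exact (h'.sub (hθ.mul h)).mul e2
  · exact ((hc'.add (hθ.mul hc)).neg).mul e1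
  · exact hd.neg

/-! ### Existence of the eigenfunctions -/

/-- The times before `T`. -/
def timesBefore (T : EReal) : Set ℝ := {τ : ℝ | (τ : EReal) < T}

theorem measurableSet_timesBefore (T : EReal) : MeasurableSet (timesBefore T) :=
  measurable_coe_real_ereal measurableSet_Iio

theorem exists_H3_plane (r : 𝓢(ℝ × ℝ, ℂ)) {k : Fin 2} {s : ℂ}
    (hz : ∀ i, 0 ≤ (Complex.I * lam s * (sgn i - sgn k)).re) :
    ∃ F : ℝ → ℝ → Fin 2 → ℂ, (Continuous fun p : ℝ × ℝ => F p.1 p.2) ∧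
      (∃ N, ∀ z t, ‖F z t‖ ≤ N) ∧
      ∀ t, SolvesBackward k (Complex.I * lam s) (fun ζ => A1 r ζ t s) univ univ
        fun z => F z t := by
  obtain ⟨C, -, hC⟩ := exists_A1_bound r s
  obtain ⟨F, hF, hN, h⟩ := exists_volterra_Ioi hz (continuous_A1 r s) hC MeasurableSet.univ
    (f := fun _ _ => Pi.single k 1) continuous_const (N := ‖(Pi.single k 1 : Fin 2 → ℂ)‖)
    fun _ _ => le_rfl
  exact ⟨F, hF, hN, fun t z _ => h z t⟩

theorem isH3Col_of_plane {T : EReal} {r : 𝓢(ℝ × ℝ, ℂ)} {k : Fin 2} {s : ℂ}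
    {F : ℝ → ℝ → Fin 2 → ℂ} (hF : Continuous fun p : ℝ × ℝ => F p.1 p.2)
    (hN : ∃ N, ∀ z t, ‖F z t‖ ≤ N)
    (h : ∀ t, SolvesBackward k (Complex.I * lam s) (fun ζ => A1 r ζ t s) univ univ
        fun z => F z t) : IsH3Col T r k s F := by
  obtain ⟨N, hN⟩ := hN
  refine ⟨⟨hF.continuousOn, N, fun p _ => hN _ _⟩, fun z t _ => ?_⟩
  have := h t z (mem_univ z)
  rwa [inter_univ] at this

theorem H3_spec {T : EReal} {r : 𝓢(ℝ × ℝ, ℂ)} {k : Fin 2} {s : ℂ}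
    (hz : ∀ i, 0 ≤ (Complex.I * lam s * (sgn i - sgn k)).re) : IsH3Col T r k s (H3 T r k s) := by
  obtain ⟨F, hF, hN, h⟩ := exists_H3_plane r hz
  exact Classical.epsilon_spec ⟨F, isH3Col_of_plane hF hN h⟩

/-- Extending a boundary function to the domain by the `z`-part. -/
theorem exists_extension (r : 𝓢(ℝ × ℝ, ℂ)) {k : Fin 2} {s : ℂ}
    (hz : ∀ i, (Complex.I * lam s * (sgn i - sgn k)).re ≤ 0) {f : ℝ → Fin 2 → ℂ}
    (hf : Continuous f) (hN : ∃ N, ∀ t, ‖f t‖ ≤ N) :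
    ∃ F : ℝ → ℝ → Fin 2 → ℂ, (Continuous fun p : ℝ × ℝ => F p.1 p.2) ∧
      (∃ N, ∀ z t, ‖F z t‖ ≤ N) ∧ (∀ t, F 0 t = f t) ∧
      ∀ z t, 0 ≤ z → F z t = expHatCol k (Complex.I * lam s * z) (f t)
        + ∫ ζ in (0 : ℝ)..z,
          expHatCol k (Complex.I * lam s * ((z : ℂ) - ζ)) ((A1 r ζ t s).mulVec (F ζ t)) := by
  obtain ⟨C, -, hC⟩ := exists_A1_bound r s
  obtain ⟨N, hN⟩ := hN
  obtain ⟨F, hF, hb, h⟩ := exists_volterra_Ioc hz (continuous_A1 r s) hC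
    (f := fun z t => expHatCol k (Complex.I * lam s * ((max z 0 : ℝ) : ℂ)) (f t)) (N := N)
    (continuous_expHatCol k (by fun_prop) (hf.comp continuous_snd))
    (fun z t => (norm_expHatCol_le (fun i => by
      have : Complex.I * lam s * ((max z 0 : ℝ) : ℂ) * (sgn i - sgn k)
        = ((max z 0 : ℝ) : ℂ) * (Complex.I * lam s * (sgn i - sgn k)) := by ring
      rw [this, Complex.re_ofReal_mul]
      exact mul_nonpos_of_nonneg_of_nonpos (le_max_right _ _) (hz i)) _).trans (hN t))
  have h' : ∀ z t, 0 ≤ z → F z t = expHatCol k (Complex.I * lam s * z) (f t)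
        + ∫ ζ in (0 : ℝ)..z, kernelCol k (Complex.I * lam s) (A1 r ζ t s) z ζ (F ζ t) := by
    intro z t hz
    have := h z t hz
    rwa [max_eq_left hz] at this
  refine ⟨F, hF, hb, fun t => ?_, h'⟩
  rw [h' 0 t le_rfl]
  simp [expHatCol_zero]

theorem H1_spec {T : EReal} {r : 𝓢(ℝ × ℝ, ℂ)} {k : Fin 2} {s : ℂ}
    (hz : ∀ i, (Complex.I * lam s * (sgn i - sgn k)).re ≤ 0)
    (ht : ∀ i, (-2 * Complex.I * lam s ^ 2 * (sgn i - sgn k)).re ≤ 0) :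
    IsH1Col T r k s (H1 T r k s) := by
  obtain ⟨C, -, -, hC⟩ := exists_B1_bound r s
  have hB : Continuous fun p : ℝ × ℝ => B1 r 0 p.1 s :=
    (continuous_B1 r s).comp (f := fun p : ℝ × ℝ => ((0 : ℝ), p.1)) (by fun_prop)
  obtain ⟨f, hf, ⟨N, hN⟩, h⟩ := exists_volterra_Ioc ht (M := fun τ _ => B1 r 0 τ s) hB
    (fun τ _ => hC 0 τ) (f := fun _ _ => Pi.single k 1) continuous_const
    (N := ‖(Pi.single k 1 : Fin 2 → ℂ)‖) fun _ _ => le_rfl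
  obtain ⟨F, hF, ⟨N', hN'⟩, hF0, hFz⟩ := exists_extension r hz (f := fun t => f t 0)
    (hf.comp (continuous_id.prodMk continuous_const)) ⟨N, fun t => hN t 0⟩
  refine Classical.epsilon_spec (p := IsH1Col T r k s)
    ⟨F, ⟨hF.continuousOn, N', fun p _ => hN' _ _⟩, fun z t hzt => ?_⟩
  rw [hFz z t hzt.1, h t 0 hzt.2.1, expHatCol_add_right, expHatCol_single]
  simp_rw [hF0]
  exact add_right_comm _ _ _

theorem H2_spec {T : EReal} {r : 𝓢(ℝ × ℝ, ℂ)} {k : Fin 2} {s : ℂ}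
    (hz : ∀ i, (Complex.I * lam s * (sgn i - sgn k)).re ≤ 0)
    (ht : ∀ i, 0 ≤ (-2 * Complex.I * lam s ^ 2 * (sgn i - sgn k)).re) :
    IsH2Col T r k s (H2 T r k s) := by
  obtain ⟨C, -, -, hC⟩ := exists_B1_bound r s
  have hB : Continuous fun p : ℝ × ℝ => B1 r 0 p.1 s :=
    (continuous_B1 r s).comp (f := fun p : ℝ × ℝ => ((0 : ℝ), p.1)) (by fun_prop)
  obtain ⟨f, hf, ⟨N, hN⟩, h⟩ := exists_volterra_Ioi ht (M := fun τ _ => B1 r 0 τ s) hB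
    (fun τ _ => hC 0 τ) (measurableSet_timesBefore T) (f := fun _ _ => Pi.single k 1)
    continuous_const (N := ‖(Pi.single k 1 : Fin 2 → ℂ)‖) fun _ _ => le_rfl
  obtain ⟨F, hF, ⟨N', hN'⟩, hF0, hFz⟩ := exists_extension r hz (f := fun t => f t 0)
    (hf.comp (continuous_id.prodMk continuous_const)) ⟨N, fun t => hN t 0⟩
  refine Classical.epsilon_spec (p := IsH2Col T r k s)
    ⟨F, ⟨hF.continuousOn, N', fun p _ => hN' _ _⟩, fun z t hzt => ?_⟩
  rw [hFz z t hzt.1, h t 0, expHatCol_sub_right, expHatCol_single]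
  simp_rw [hF0]
  exact sub_add_eq_add_sub _ _ _

/-! ### Slices of the eigenfunctions -/

/-- The closed time interval. -/
def timesUpTo (T : EReal) : Set ℝ := {τ : ℝ | 0 ≤ τ ∧ (τ : EReal) ≤ T}

theorem BoundedCont.slice_fst {T : EReal} {F : ℝ → ℝ → Fin 2 → ℂ} (h : BoundedCont T F) {t : ℝ}
    (ht : t ∈ timesUpTo T) :
    ContinuousOn (fun z => F z t) (Ici 0) ∧ ∃ N, ∀ z ∈ Ici (0 : ℝ), ‖F z t‖ ≤ N := by
  obtain ⟨hc, N, hN⟩ := h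
  exact ⟨hc.comp (f := fun z : ℝ => (z, t)) (by fun_prop) fun z hz => ⟨hz, ht⟩,
    N, fun z hz => hN (z, t) ⟨hz, ht⟩⟩

theorem BoundedCont.slice_zero {T : EReal} {F : ℝ → ℝ → Fin 2 → ℂ} (h : BoundedCont T F) :
    ContinuousOn (fun t => F 0 t) (timesUpTo T) ∧ ∃ N, ∀ t ∈ timesUpTo T, ‖F 0 t‖ ≤ N := by
  obtain ⟨hc, N, hN⟩ := h
  exact ⟨hc.comp (f := fun t : ℝ => ((0 : ℝ), t)) (by fun_prop) fun t ht => ⟨le_rfl, ht⟩,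
    N, fun t ht => hN (0, t) ⟨le_rfl, ht⟩⟩

theorem IsH3Col.solvesBackward {T : EReal} {r : 𝓢(ℝ × ℝ, ℂ)} {k : Fin 2} {s : ℂ}
    {F : ℝ → ℝ → Fin 2 → ℂ} (h : IsH3Col T r k s F) {t : ℝ} (ht : t ∈ timesUpTo T) :
    SolvesBackward k (Complex.I * lam s) (fun ζ => A1 r ζ t s) (Ici 0) univ fun z => F z t :=
  fun z hz => by
    rw [inter_univ]
    exact h.2 z t ⟨hz, ht⟩

theorem IsH2Col.solvesBackward {T : EReal} {r : 𝓢(ℝ × ℝ, ℂ)} {k : Fin 2} {s : ℂ}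
    {F : ℝ → ℝ → Fin 2 → ℂ} (h : IsH2Col T r k s F) :
    SolvesBackward k (-2 * Complex.I * lam s ^ 2) (fun τ => B1 r 0 τ s) (timesUpTo T)
      (timesBefore T) fun t => F 0 t := fun t ht => by
  have := h.2 0 t ⟨le_rfl, ht⟩
  rw [intervalIntegral.integral_same, Complex.ofReal_zero, mul_zero, expHatCol_zero,
    add_zero] at this
  exact this

theorem Ioi_inter_timesBefore_subset {T : EReal} {t : ℝ} (ht : t ∈ timesUpTo T) :
    Ioi t ∩ timesBefore T ⊆ timesUpTo T := fun _ hτ =>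
  ⟨ht.1.trans (le_of_lt hτ.1), le_of_lt hτ.2⟩

theorem continuous_A1_fst (r : 𝓢(ℝ × ℝ, ℂ)) (t : ℝ) (s : ℂ) :
    Continuous fun ζ => A1 r ζ t s :=
  (continuous_A1 r s).comp (f := fun ζ : ℝ => (ζ, t)) (by fun_prop)

theorem continuous_B1_zero (r : 𝓢(ℝ × ℝ, ℂ)) (s : ℂ) : Continuous fun τ => B1 r 0 τ s :=
  (continuous_B1 r s).comp (f := fun τ : ℝ => ((0 : ℝ), τ)) (by fun_prop)

theorem IsH3Col.integrableOn {T : EReal} {r : 𝓢(ℝ × ℝ, ℂ)} {k : Fin 2} {s : ℂ}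
    (hz : ∀ i, 0 ≤ (Complex.I * lam s * (sgn i - sgn k)).re)
    {F : ℝ → ℝ → Fin 2 → ℂ} (h : IsH3Col T r k s F) {t : ℝ} (ht : t ∈ timesUpTo T) {z : ℝ}
    (hz0 : 0 ≤ z) :
    IntegrableOn (fun ζ => kernelCol k (Complex.I * lam s) (A1 r ζ t s) z ζ (F ζ t))
      (Ioi z ∩ univ) := by
  obtain ⟨C, -, hC⟩ := exists_A1_bound r s
  obtain ⟨hc, N, hN⟩ := h.1.slice_fst ht
  have hsub : Ioi z ∩ univ ⊆ Ici 0 := fun ζ hζ => hz0.trans (le_of_lt hζ.1)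
  exact integrableOn_kernelCol hz (fun ζ => hC ζ t) (measurableSet_Ioi.inter MeasurableSet.univ)
    (fun ζ hζ => le_of_lt hζ.1) (continuous_A1_fst r t s).continuousOn (hc.mono hsub)
    fun ζ hζ => hN ζ (hsub hζ)

theorem IsH2Col.integrableOn {T : EReal} {r : 𝓢(ℝ × ℝ, ℂ)} {k : Fin 2} {s : ℂ}
    (ht : ∀ i, 0 ≤ (-2 * Complex.I * lam s ^ 2 * (sgn i - sgn k)).re)
    {F : ℝ → ℝ → Fin 2 → ℂ} (h : IsH2Col T r k s F) {t : ℝ} (htT : t ∈ timesUpTo T) :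
    IntegrableOn
      (fun τ => kernelCol k (-2 * Complex.I * lam s ^ 2) (B1 r 0 τ s) t τ (F 0 τ))
      (Ioi t ∩ timesBefore T) := by
  obtain ⟨C, -, -, hC⟩ := exists_B1_bound r s
  obtain ⟨hc, N, hN⟩ := h.1.slice_zero
  have hsub := Ioi_inter_timesBefore_subset htT
  exact integrableOn_kernelCol ht (fun τ => hC 0 τ)
    (measurableSet_Ioi.inter (measurableSet_timesBefore T))
    (fun ζ hζ => le_of_lt hζ.1) (continuous_B1_zero r s).continuousOn (hc.mono hsub)
    fun ζ hζ => hN ζ (hsub hζ)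

theorem lam_conj (s : ℂ) : lam (conj s) = conj (lam s) := by
  simp [lam, Complex.conj_ofNat]

theorem A1_conj (r : 𝓢(ℝ × ℝ, ℂ)) (z t : ℝ) (s : ℂ) :
    A1 r z t s = !![conj (A1 r z t (conj s) 1 1), -conj (A1 r z t (conj s) 1 0);
      -conj (A1 r z t (conj s) 0 1), conj (A1 r z t (conj s) 0 0)] := by
  have h1 := conj_phase r 1 z t
  have h2 := conj_phase r (-1) z t
  push_cast at h1 h2
  rw [neg_neg] at h2
  rw [A1_eq, A1_eq]
  ext i j
  fin_cases i <;> fin_cases j <;> simp [h1, h2, Complex.conj_ofNat] <;> ring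

theorem B1_conj (r : 𝓢(ℝ × ℝ, ℂ)) (z t : ℝ) (s : ℂ) :
    B1 r z t s = !![conj (B1 r z t (conj s) 1 1), -conj (B1 r z t (conj s) 1 0);
      -conj (B1 r z t (conj s) 0 1), conj (B1 r z t (conj s) 0 0)] := by
  have h1 := conj_phase r 1 z t
  have h2 := conj_phase r (-1) z t
  push_cast at h1 h2
  rw [neg_neg] at h2
  rw [B1_eq, B1_eq]
  ext i j
  fin_cases i <;> fin_cases j <;>
    simp [h1, h2, Complex.conj_ofNat, diagB] <;> ring

theorem re_nonneg_conj {c : ℂ} (h : ∀ i, 0 ≤ (c * (sgn i - sgn 0)).re) :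
    ∀ i, 0 ≤ (-conj c * (sgn i - sgn 1)).re := by
  have := h 1
  intro i
  fin_cases i
  · simp [sgn] at *
    linarith
  · simp [sgn]

/-- The Schwarz symmetry of `H₃`. -/
theorem H3_conj {T : EReal} {r : 𝓢(ℝ × ℝ, ℂ)} {s : ℂ}
    (hz : ∀ i, 0 ≤ (Complex.I * lam s * (sgn i - sgn 0)).re) {z t : ℝ} (hz0 : 0 ≤ z)
    (ht : t ∈ timesUpTo T) : H3 T r 0 s z t = conjSwap (H3 T r 1 (conj s) z t) := by
  have e : Complex.I * lam (conj s) = -conj (Complex.I * lam s) := by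
    rw [lam_conj, map_mul, Complex.conj_I]; ring
  have e' : -conj (Complex.I * lam (conj s)) = Complex.I * lam s := by
    rw [e, map_neg, Complex.conj_conj, neg_neg]
  have hz' : ∀ i, 0 ≤ (Complex.I * lam (conj s) * (sgn i - sgn 1)).re := by
    rw [e]; exact re_nonneg_conj hz
  have h0 := H3_spec (T := T) (r := r) hz
  have h1 := H3_spec (T := T) (r := r) hz'
  have b1 := (h1.solvesBackward ht).conjSwap (M' := fun ζ => A1 r ζ t s)
    (fun ζ => A1_conj r ζ t s) fun z hz0 => h1.integrableOn hz' ht hz0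
  rw [e'] at b1
  obtain ⟨C, -, hC⟩ := exists_A1_bound r s
  obtain ⟨c0, N0, hN0⟩ := h0.1.slice_fst ht
  obtain ⟨c1, N1, hN1⟩ := h1.1.slice_fst ht
  exact (h0.solvesBackward ht).unique hz (continuous_A1_fst r t s) (fun ζ => hC ζ t)
    MeasurableSet.univ (fun z hz ζ hζ => mem_Ici.2 (le_trans (mem_Ici.1 hz) (le_of_lt hζ.1))) b1 c0
    (conjSwap.continuous.comp_continuousOn c1) hN0
    (fun z hz => (conjSwap.le_opNorm _).trans
      (mul_le_mul_of_nonneg_left (hN1 z hz) (norm_nonneg _))) z hz0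

/-- The Schwarz symmetry of `H₂` at the boundary. -/
theorem H2_conj {T : EReal} {r : 𝓢(ℝ × ℝ, ℂ)} {s : ℂ}
    (hz : ∀ i, (Complex.I * lam s * (sgn i - sgn 0)).re ≤ 0)
    (hp : ∀ i, 0 ≤ (-2 * Complex.I * lam s ^ 2 * (sgn i - sgn 0)).re) {t : ℝ}
    (ht : t ∈ timesUpTo T) : H2 T r 0 s 0 t = conjSwap (H2 T r 1 (conj s) 0 t) := by
  have e : -2 * Complex.I * lam (conj s) ^ 2 = -conj (-2 * Complex.I * lam s ^ 2) := by
    rw [lam_conj]; simp [Complex.conj_ofNat]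
  have e' : -conj (-2 * Complex.I * lam (conj s) ^ 2) = -2 * Complex.I * lam s ^ 2 := by
    rw [e, map_neg, Complex.conj_conj, neg_neg]
  have hp' : ∀ i, 0 ≤ (-2 * Complex.I * lam (conj s) ^ 2 * (sgn i - sgn 1)).re := by
    rw [e]; exact re_nonneg_conj hp
  have hz' : ∀ i, (Complex.I * lam (conj s) * (sgn i - sgn 1)).re ≤ 0 := by
    have h := re_nonneg_conj (c := -(Complex.I * lam s)) fun i => by
      rw [neg_mul, Complex.neg_re]; linarith [hz i]
    intro i
    have := h i
    rw [map_neg, neg_neg, map_mul, Complex.conj_I, ← lam_conj, neg_mul, neg_mul,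
      Complex.neg_re] at this
    linarith
  have h0 := H2_spec (T := T) (r := r) hz hp
  have h1 := H2_spec (T := T) (r := r) hz' hp'
  have b1 := h1.solvesBackward.conjSwap (M' := fun τ => B1 r 0 τ s)
    (fun τ => B1_conj r 0 τ s) fun t ht => h1.integrableOn hp' ht
  rw [e'] at b1
  obtain ⟨C, -, -, hC⟩ := exists_B1_bound r s
  obtain ⟨c0, N0, hN0⟩ := h0.1.slice_zero
  obtain ⟨c1, N1, hN1⟩ := h1.1.slice_zero
  exact h0.solvesBackward.unique hp (continuous_B1_zero r s) (fun τ => hC 0 τ)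
    (measurableSet_timesBefore T) (fun t ht => Ioi_inter_timesBefore_subset ht) b1 c0
    (conjSwap.continuous.comp_continuousOn c1) hN0
    (fun z hz => (conjSwap.le_opNorm _).trans
      (mul_le_mul_of_nonneg_left (hN1 z hz) (norm_nonneg _))) t ht

/-! ### Linear differential equations for the columns -/

/-- `X' = c (σ - σ_kk) X + M X` on `[0, b]`, as a right derivative. -/
def ColODE (k : Fin 2) (c : ℂ) (M : ℝ → Matrix (Fin 2) (Fin 2) ℂ) (b : ℝ)
    (X : ℝ → Fin 2 → ℂ) : Prop :=
  ContinuousOn X (Icc 0 b) ∧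
    ∀ x ∈ Ico 0 b, HasDerivWithinAt X (adCol k c (X x) + (M x).mulVec (X x)) (Ici x) x

/-- `X' = c σ X + M X` on `[0, b]`, as a right derivative. -/
def LinODE (c : ℂ) (M : ℝ → Matrix (Fin 2) (Fin 2) ℂ) (b : ℝ) (X : ℝ → Fin 2 → ℂ) : Prop :=
  ContinuousOn X (Icc 0 b) ∧
    ∀ x ∈ Ico 0 b, HasDerivWithinAt X ((fun i => c * sgn i * X x i) + (M x).mulVec (X x)) (Ici x) x

theorem colODE_of_forward {k : Fin 2} {c : ℂ} {M : ℝ → Matrix (Fin 2) (Fin 2) ℂ}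
    (hM : Continuous M) {b : ℝ} {X : ℝ → Fin 2 → ℂ} (hX : ContinuousOn X (Icc 0 b))
    {g : Fin 2 → ℂ}
    (h : ∀ x ∈ Icc 0 b, X x = expHatCol k (c * x) g
      + ∫ ζ in (0 : ℝ)..x, kernelCol k c (M ζ) x ζ (X ζ)) : ColODE k c M b X := by
  refine ⟨hX, fun x hx => ?_⟩
  have hb : 0 ≤ b := hx.1.trans hx.2.le
  set Y := IccExtend hb ((Icc 0 b).domRestrict X)
  have hY : Continuous Y := hX.domRestrict.Icc_extend'
  have hYX : ∀ ζ ∈ Icc 0 b, Y ζ = X ζ := fun ζ hζ => IccExtend_of_mem hb _ hζ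
  have hd := hasDerivAt_duhamel k c g (hM.matrix_mulVec hY) 0 x
  simp only [Complex.ofReal_zero, sub_zero] at hd
  have heq : ∀ x ∈ Icc 0 b, X x = expHatCol k (c * x) g
      + ∫ ζ in (0 : ℝ)..x, expHatCol k (c * ((x : ℂ) - ζ)) ((M ζ).mulVec (Y ζ)) := by
    intro x hx
    rw [h x hx]
    congr 1
    refine intervalIntegral.integral_congr fun ζ hζ => ?_
    rw [uIcc_of_le hx.1] at hζ
    change kernelCol k c (M ζ) x ζ (X ζ) = kernelCol k c (M ζ) x ζ (Y ζ)
    rw [hYX ζ ⟨hζ.1, hζ.2.trans hx.2⟩]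
  have hx' : x ∈ Icc 0 b := Ico_subset_Icc_self hx
  rw [← heq x hx', hYX x hx'] at hd
  refine hd.hasDerivWithinAt.congr_of_eventuallyEq ?_ (heq x hx')
  filter_upwards [Icc_mem_nhdsGE hx.2] with y hy
  exact heq y ⟨hx.1.trans hy.1, hy.2⟩

theorem ColODE.linODE {k : Fin 2} {c : ℂ} {M : ℝ → Matrix (Fin 2) (Fin 2) ℂ} {b : ℝ}
    {X : ℝ → Fin 2 → ℂ} (h : ColODE k c M b X) (a : ℂ) :
    LinODE c M b fun x => (a * Complex.exp (c * sgn k * x)) • X x := by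
  have hE : ∀ x : ℝ, HasDerivAt (fun x : ℝ => a * Complex.exp (c * sgn k * x))
      (a * Complex.exp (c * sgn k * x) * (c * sgn k)) x := fun x => by
    have := (((Complex.ofRealCLM.hasDerivAt (x := x)).const_mul (c * sgn k)).cexp).const_mul a
    simpa [mul_assoc] using this
  refine ⟨(continuous_iff_continuousAt.2 fun x => (hE x).continuousAt).continuousOn.smul h.1,
    fun x hx => ?_⟩
  refine ((hE x).hasDerivWithinAt.smul (h.2 x hx)).congr_deriv ?_
  rw [Matrix.mulVec_smul]
  ext i
  simp only [adCol, Pi.add_apply, Pi.smul_apply, smul_eq_mul]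
  ring

theorem LinODE.add {c : ℂ} {M : ℝ → Matrix (Fin 2) (Fin 2) ℂ} {b : ℝ}
    {X Y : ℝ → Fin 2 → ℂ} (hX : LinODE c M b X) (hY : LinODE c M b Y) :
    LinODE c M b fun x => X x + Y x := by
  refine ⟨hX.1.add hY.1, fun x hx => ((hX.2 x hx).add (hY.2 x hx)).congr_deriv ?_⟩
  rw [Matrix.mulVec_add]
  ext i
  simp only [Pi.add_apply]
  ring

theorem LinODE.smul {c : ℂ} {M : ℝ → Matrix (Fin 2) (Fin 2) ℂ} {b : ℝ}
    {X : ℝ → Fin 2 → ℂ} (hX : LinODE c M b X) (a : ℂ) : LinODE c M b fun x => a • X x := by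
  refine ⟨hX.1.const_smul a, fun x hx => ((hX.2 x hx).const_smul a).congr_deriv ?_⟩
  rw [Matrix.mulVec_smul]
  ext i
  simp only [Pi.add_apply, Pi.smul_apply, smul_eq_mul]
  ring

theorem LinODE.eq_zero {c : ℂ} {M : ℝ → Matrix (Fin 2) (Fin 2) ℂ} {b C : ℝ}
    (hM : ∀ x i j, ‖M x i j‖ ≤ C) {X : ℝ → Fin 2 → ℂ} (hX : LinODE c M b X) (h0 : X 0 = 0) :
    ∀ x ∈ Icc 0 b, X x = 0 := by
  have hC : 0 ≤ C := (norm_nonneg _).trans (hM 0 0 0)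
  have hs : ∀ i, ‖sgn i‖ = 1 := fun i => by fin_cases i <;> simp [sgn]
  have hL : ∀ x ∈ Ico 0 b, LipschitzOnWith (‖c‖₊ + 2 * ⟨C, hC⟩)
      (fun v : Fin 2 → ℂ => (fun i => c * sgn i * v i) + (M x).mulVec v) univ := by
    intro x _
    refine LipschitzOnWith.of_dist_le_mul fun v _ w _ => ?_
    rw [dist_eq_norm, dist_eq_norm]
    have : ((fun i => c * sgn i * v i) + (M x).mulVec v)
        - ((fun i => c * sgn i * w i) + (M x).mulVec w)
        = (fun i => c * sgn i * (v - w) i) + (M x).mulVec (v - w) := by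
      rw [Matrix.mulVec_sub]
      ext i
      simp only [Pi.add_apply, Pi.sub_apply]
      ring
    rw [this]
    have h1 : ‖fun i => c * sgn i * (v - w) i‖ ≤ ‖c‖ * ‖v - w‖ := by
      refine (pi_norm_le_iff_of_nonneg (by positivity)).2 fun i => ?_
      rw [norm_mul, norm_mul, hs, mul_one]
      exact mul_le_mul_of_nonneg_left (norm_le_pi_norm (v - w) i) (norm_nonneg _)
    have h2 := norm_mulVec_le (hM x) (v - w)
    have h3 := norm_add_le (fun i => c * sgn i * (v - w) i) ((M x).mulVec (v - w))
    have h4 : ((‖c‖₊ + 2 * ⟨C, hC⟩ : NNReal) : ℝ) = ‖c‖ + 2 * C := by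
      push_cast; rfl
    rw [h4]
    linarith
  have key := ODE_solution_unique_of_mem_Icc_right (g := fun _ => (0 : Fin 2 → ℂ))
    hL hX.1 hX.2 (fun _ _ => mem_univ _)
    continuousOn_const (fun x _ => ?_) (fun _ _ => mem_univ _) h0
  · exact fun x hx => key hx
  · refine (hasDerivWithinAt_const x (Ici x) (0 : Fin 2 → ℂ)).congr_deriv ?_
    rw [Matrix.mulVec_zero]
    ext i
    simp

/-! ### The `t`-part of the Lax pair for `H₃` -/

theorem hasDerivAt_mulVec {M : ℝ → Matrix (Fin 2) (Fin 2) ℂ} {M' : Matrix (Fin 2) (Fin 2) ℂ}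
    {v : ℝ → Fin 2 → ℂ} {v' : Fin 2 → ℂ} {x : ℝ}
    (hM : ∀ i j, HasDerivAt (fun x => M x i j) (M' i j) x) (hv : HasDerivAt v v' x) :
    HasDerivAt (fun x => (M x).mulVec (v x)) (M'.mulVec (v x) + (M x).mulVec v') x := by
  rw [hasDerivAt_pi] at hv ⊢
  intro i
  simp only [Matrix.mulVec, dotProduct, Fin.sum_univ_two, Pi.add_apply]
  refine (((hM i 0).mul (hv 0)).add ((hM i 1).mul (hv 1))).congr_deriv ?_
  ring

theorem hasDerivAt_expHatCol (k : Fin 2) (c : ℂ) (z x : ℝ) {v : ℝ → Fin 2 → ℂ} {h : Fin 2 → ℂ}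
    (hv : HasDerivAt v (adCol k c (v x) + h) x) :
    HasDerivAt (fun x : ℝ => expHatCol k (c * ((z : ℂ) - x)) (v x))
      (expHatCol k (c * ((z : ℂ) - x)) h) x := by
  rw [hasDerivAt_pi] at hv ⊢
  intro i
  have h1 : HasDerivAt (fun x : ℝ => Complex.exp (c * ((z : ℂ) - x) * (sgn i - sgn k)))
      (Complex.exp (c * ((z : ℂ) - x) * (sgn i - sgn k)) * (-(c * (sgn i - sgn k)))) x := by
    have := (((Complex.ofRealCLM.hasDerivAt (x := x)).const_sub (z : ℂ)).const_mul c).mul_const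
      (sgn i - sgn k)
    simpa using this.cexp
  refine (h1.mul (hv i)).congr_deriv ?_
  simp only [adCol, expHatCol, Pi.add_apply]
  ring

theorem SolvesBackward.hasDerivAt {k : Fin 2} {c : ℂ} (hc : ∀ i, 0 ≤ (c * (sgn i - sgn k)).re)
    {M : ℝ → Matrix (Fin 2) (Fin 2) ℂ} (hMc : Continuous M) {C : ℝ}
    (hM : ∀ ζ i j, ‖M ζ i j‖ ≤ C / (1 + ζ ^ 2)) {D : ℝ → Fin 2 → ℂ}
    (hD : SolvesBackward k c M univ univ D) (hDc : Continuous D) {N : ℝ} (hN : ∀ z, ‖D z‖ ≤ N)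
    (z : ℝ) : HasDerivAt D ((adMat k c + M z).mulVec (D z)) z := by
  have hd := hasDerivAt_duhamel k c (D (z - 1)) (hMc.matrix_mulVec hDc) (z - 1) z
  have heq : ∀ x : ℝ, z - 1 ≤ x → D x = expHatCol k (c * ((x : ℂ) - ((z - 1 : ℝ) : ℂ))) (D (z - 1))
      + ∫ ζ in (z - 1)..x, expHatCol k (c * ((x : ℂ) - ζ)) ((M ζ).mulVec (D ζ)) := fun x hx =>
    hD.eq_forward MeasurableSet.univ hx (mem_univ _) (mem_univ _) (subset_univ _)
      (integrableOn_kernelCol hc hM (measurableSet_Ioi.inter MeasurableSet.univ)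
        (fun ζ hζ => le_of_lt hζ.1) hMc.continuousOn hDc.continuousOn fun ζ _ => hN ζ)
  rw [← heq z (by linarith)] at hd
  rw [Matrix.add_mulVec, adMat_mulVec]
  refine hd.congr_of_eventuallyEq ?_
  filter_upwards [Ioi_mem_nhds (by linarith : z - 1 < z)] with x hx
  exact heq x (le_of_lt hx)

theorem norm_sgn_sub_le (i k : Fin 2) : ‖sgn i - sgn k‖ ≤ 2 := by
  fin_cases i <;> fin_cases k <;> simp [sgn] <;> norm_num

theorem norm_adCol_le (k : Fin 2) (c : ℂ) (v : Fin 2 → ℂ) : ‖adCol k c v‖ ≤ 2 * ‖c‖ * ‖v‖ := by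
  refine (pi_norm_le_iff_of_nonneg (by positivity)).2 fun i => ?_
  rw [adCol, norm_mul, norm_mul]
  have h1 := norm_sgn_sub_le i k
  have h2 := norm_le_pi_norm v i
  calc ‖c‖ * ‖sgn i - sgn k‖ * ‖v i‖ ≤ ‖c‖ * 2 * ‖v‖ := by gcongr
    _ = _ := by ring

theorem adCol_sub_single (k : Fin 2) (c : ℂ) (v : Fin 2 → ℂ) :
    adCol k c (v - Pi.single k 1) = adCol k c v := by
  ext i
  by_cases h : i = k
  · subst h; simp [adCol]
  · simp [adCol, h]

/-- The defect of a function with respect to the `t`-part of the Lax pair. -/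
def defect (V : ℝ → ℝ → Matrix (Fin 2) (Fin 2) ℂ) (F : ℝ → ℝ → Fin 2 → ℂ) (z t : ℝ) :
    Fin 2 → ℂ :=
  F z t - F z 0 - ∫ τ in (0 : ℝ)..t, (V z τ).mulVec (F z τ)

/-- By the zero curvature condition, the defect solves a linear homogeneous equation. -/
theorem hasDerivAt_defect {U V Ut Vz : ℝ → ℝ → Matrix (Fin 2) (Fin 2) ℂ}
    (hU : Continuous fun p : ℝ × ℝ => U p.1 p.2) (hV : Continuous fun p : ℝ × ℝ => V p.1 p.2)
    (hUt : Continuous fun p : ℝ × ℝ => Ut p.1 p.2) (hVz : Continuous fun p : ℝ × ℝ => Vz p.1 p.2)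
    (hVd : ∀ z t i j, HasDerivAt (fun z => V z t i j) (Vz z t i j) z)
    {F : ℝ → ℝ → Fin 2 → ℂ} (hF : Continuous fun p : ℝ × ℝ => F p.1 p.2)
    (hFd : ∀ z t, HasDerivAt (fun z => F z t) ((U z t).mulVec (F z t)) z) {z t : ℝ} (ht : 0 ≤ t)
    (hUd : ∀ τ ∈ Icc 0 t, ∀ i j, HasDerivAt (fun τ => U z τ i j) (Ut z τ i j) τ)
    (hzc : ∀ τ ∈ Icc 0 t, Ut z τ + U z τ * V z τ = Vz z τ + V z τ * U z τ) :
    HasDerivAt (fun z => defect V F z t)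
      ((U z t).mulVec (defect V F z t)
        - ∫ τ in (0 : ℝ)..t, (Ut z τ).mulVec (defect V F z τ)) z := by
  have hVF : Continuous fun p : ℝ × ℝ => (V p.1 p.2).mulVec (F p.1 p.2) := hV.matrix_mulVec hF
  have hUF : Continuous fun p : ℝ × ℝ => (U p.1 p.2).mulVec (F p.1 p.2) := hU.matrix_mulVec hF
  have sVF : Continuous fun τ => (V z τ).mulVec (F z τ) := hVF.comp (Continuous.prodMk_right z)
  have sUVF : Continuous fun τ => (U z τ).mulVec ((V z τ).mulVec (F z τ)) :=
    (hU.matrix_mulVec hVF).comp (Continuous.prodMk_right z)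
  have sUt : Continuous fun τ => Ut z τ := hUt.comp (Continuous.prodMk_right z)
  have sF : Continuous fun τ => F z τ := hF.comp (Continuous.prodMk_right z)
  have hd := ((hFd z t).sub (hFd z 0)).sub (hasDerivAt_intervalIntegral_param
    (f := fun z τ => (V z τ).mulVec (F z τ))
    (f' := fun z τ => (Vz z τ).mulVec (F z τ) + (V z τ).mulVec ((U z τ).mulVec (F z τ)))
    hVF ((hVz.matrix_mulVec hF).add (hV.matrix_mulVec hUF))
    (fun z τ => hasDerivAt_mulVec (hVd z τ) (hFd z τ)) 0 t z)
  refine hd.congr_deriv ?_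
  set P : ℝ → Fin 2 → ℂ := fun τ => F z 0 + ∫ τ in (0 : ℝ)..τ, (V z τ).mulVec (F z τ) with hP
  have hPd : ∀ τ, HasDerivAt P ((V z τ).mulVec (F z τ)) τ := fun τ => by
    exact (intervalIntegral.integral_hasDerivAt_right (sVF.intervalIntegrable _ _)
      (sVF.stronglyMeasurableAtFilter _ _) sVF.continuousAt).const_add _
  have hPc : Continuous P := continuous_iff_continuousAt.2 fun τ => (hPd τ).continuousAt
  have hPF : ∀ τ, P τ = F z τ - defect V F z τ := fun τ => by
    simp only [hP, defect]; abel
  have hP0 : P 0 = F z 0 := by simp [hP]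
  have hftc : (U z t).mulVec (P t) - (U z 0).mulVec (P 0)
      = ∫ τ in (0 : ℝ)..t, ((Ut z τ).mulVec (P τ) + (U z τ).mulVec ((V z τ).mulVec (F z τ))) := by
    refine (intervalIntegral.integral_eq_sub_of_hasDerivAt
      (f := fun τ => (U z τ).mulVec (P τ)) (fun τ hτ => ?_) ?_).symm
    · rw [uIcc_of_le ht] at hτ
      exact hasDerivAt_mulVec (hUd τ hτ) (hPd τ)
    · exact ((sUt.matrix_mulVec hPc).add sUVF).intervalIntegrable _ _
  have hdc : Continuous fun τ => defect V F z τ := by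
    have : (fun τ => defect V F z τ) = fun τ => F z τ - P τ := by
      ext1 τ; rw [hPF]; abel
    rw [this]
    exact sF.sub hPc
  have hint : ∫ τ in (0 : ℝ)..t,
        ((Vz z τ).mulVec (F z τ) + (V z τ).mulVec ((U z τ).mulVec (F z τ)))
      = (∫ τ in (0 : ℝ)..t,
          ((Ut z τ).mulVec (P τ) + (U z τ).mulVec ((V z τ).mulVec (F z τ))))
        + ∫ τ in (0 : ℝ)..t, (Ut z τ).mulVec (defect V F z τ) := by
    rw [← intervalIntegral.integral_add]
    · refine intervalIntegral.integral_congr fun τ hτ => ?_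
      rw [uIcc_of_le ht] at hτ
      have h1 := congrArg (fun M => M.mulVec (F z τ)) (hzc τ hτ)
      simp only [Matrix.add_mulVec, ← Matrix.mulVec_mulVec] at h1
      simp only [hPF, Matrix.mulVec_sub]
      rw [← h1]
      exact (by intros; abel : ∀ a b e : Fin 2 → ℂ, a + b = a - e + b + e) _ _ _
    · exact ((sUt.matrix_mulVec hPc).add sUVF).intervalIntegrable _ _
    · exact (sUt.matrix_mulVec hdc).intervalIntegrable _ _
  change (U z t).mulVec (F z t) - (U z 0).mulVec (F z 0)
    - ∫ τ in (0 : ℝ)..t, ((Vz z τ).mulVec (F z τ) + (V z τ).mulVec ((U z τ).mulVec (F z τ))) = _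
  rw [hint, ← hftc, hP0, hPF t, Matrix.mulVec_sub]
  exact (by intros; abel : ∀ a b d i : Fin 2 → ℂ, a - b - (a - d - b + i) = d - i) _ _ _ _

/-- Decay of a solution based at `+∞` towards its normalization. -/
theorem SolvesBackward.norm_sub_le {k : Fin 2} {c : ℂ}
    (hc : ∀ i, 0 ≤ (c * (sgn i - sgn k)).re) {M : ℝ → Matrix (Fin 2) (Fin 2) ℂ} {C : ℝ}
    (hM : ∀ ζ i j, ‖M ζ i j‖ ≤ C / (1 + ζ ^ 2)) {D : ℝ → Fin 2 → ℂ}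
    (hD : SolvesBackward k c M univ univ D) {N : ℝ} (hN : ∀ z, ‖D z‖ ≤ N) (z : ℝ) :
    ‖D z - Pi.single k 1‖ ≤ 2 * C * N * (Real.pi / 2 - Real.arctan z) := by
  rw [hD z (mem_univ z), inter_univ, sub_sub_cancel_left, norm_neg,
    ← integral_Ioi_inv_one_add_sq, ← integral_const_mul]
  refine norm_integral_le_of_norm_le
    (integrable_inv_one_add_sq.const_mul _).integrableOn ?_
  refine (ae_restrict_iff' measurableSet_Ioi).2 (Eventually.of_forall fun ζ hζ => ?_)
  have hC : 0 ≤ C / (1 + ζ ^ 2) := (norm_nonneg _).trans (hM ζ 0 0)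
  refine (norm_kernelCol_le hc (hM ζ) (le_of_lt hζ) _).trans ?_
  calc _ ≤ 2 * (C / (1 + ζ ^ 2)) * N := mul_le_mul_of_nonneg_left (hN _) (by positivity)
    _ = _ := by ring

theorem tendsto_pi_div_two_sub_arctan :
    Tendsto (fun z => Real.pi / 2 - Real.arctan z) atTop (𝓝 0) := by
  have := (Real.tendsto_arctan_atTop.mono_right nhdsWithin_le_nhds).const_sub (Real.pi / 2)
  simpa using this

theorem tendsto_const_div_one_add_sq (C : ℝ) :
    Tendsto (fun z : ℝ => C / (1 + z ^ 2)) atTop (𝓝 0) :=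
  tendsto_const_nhds.div_atTop
    (tendsto_atTop_add_const_left _ _ (tendsto_pow_atTop two_ne_zero))

/-- A family of functions solving a homogeneous Volterra-type differential equation and vanishing
at `+∞` vanishes. -/
theorem eq_zero_of_tendsto_zero {k : Fin 2} {c : ℂ} (hc : ∀ i, 0 ≤ (c * (sgn i - sgn k)).re)
    {A At : ℝ → ℝ → Matrix (Fin 2) (Fin 2) ℂ} {C C' : ℝ}
    (hA : ∀ z t i j, ‖A z t i j‖ ≤ C / (1 + z ^ 2))
    (hAt : ∀ z t i j, ‖At z t i j‖ ≤ C' / (1 + z ^ 2)) {b : ℝ} {Y : ℝ → ℝ → Fin 2 → ℂ}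
    {ε : ℝ → ℝ} (hε : Tendsto ε atTop (𝓝 0)) (hYε : ∀ z, ∀ t ∈ Icc 0 b, ‖Y z t‖ ≤ ε z)
    {N : ℝ} (hN : ∀ z, ε z ≤ N)
    (hY : ∀ z, 0 ≤ z → ∀ t ∈ Icc 0 b, HasDerivAt (fun z => Y z t)
      ((adMat k c + A z t).mulVec (Y z t) - ∫ τ in (0 : ℝ)..t, (At z τ).mulVec (Y z τ)) z) :
    ∀ z, 0 ≤ z → ∀ t ∈ Icc 0 b, Y z t = 0 := by
  rcases lt_or_ge b 0 with hb | hb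
  · intro z _ t ht
    exact absurd (ht.1.trans ht.2) (not_le.2 hb)
  have hC : 0 ≤ C := by simpa using (norm_nonneg _).trans (hA 0 0 0 0)
  have hC' : 0 ≤ C' := by simpa using (norm_nonneg _).trans (hAt 0 0 0 0)
  have hN0 : 0 ≤ N := (norm_nonneg _).trans ((hYε 0 0 ⟨le_rfl, hb⟩).trans (hN 0))
  set L := 2 * C + 2 * C' * b with hL
  have hL0 : 0 ≤ L := by positivity
  obtain ⟨K, hK, hLK⟩ : ∃ K : ℝ, 0 < K ∧ L / K ≤ 1 / 2 := by
    refine ⟨2 * L + 1, by positivity, ?_⟩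
    rw [div_le_div_iff₀ (by positivity) (by norm_num)]
    linarith
  have key := eq_zero_of_halving (S := Ici (0 : ℝ) ×ˢ Icc 0 b) (Y := fun p => Y p.1 p.2)
    (w := fun p => weight K p.1) (N₀ := N * (Real.exp (-(K * Real.pi)))⁻¹) (by positivity) ?_ ?_
  · exact fun z hz t ht => key (z, t) ⟨hz, ht⟩
  · rintro ⟨z, t⟩ ⟨hz, ht⟩
    have h1 : 1 ≤ (Real.exp (-(K * Real.pi)))⁻¹ * weight K z := by
      rw [inv_mul_eq_div, one_le_div (Real.exp_pos _)]
      exact le_weight hK.le z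
    calc ‖Y z t‖ ≤ N := (hYε z t ht).trans (hN z)
      _ ≤ N * ((Real.exp (-(K * Real.pi)))⁻¹ * weight K z) := le_mul_of_one_le_right hN0 h1
      _ = _ := by ring
  · rintro B hB hb' ⟨z, t⟩ ⟨hz, ht⟩
    have hz : 0 ≤ z := hz
    set h : ℝ → Fin 2 → ℂ := fun x =>
      (A x t).mulVec (Y x t) - ∫ τ in (0 : ℝ)..t, (At x τ).mulVec (Y x τ) with hh
    have hhb : ∀ x, 0 ≤ x → ‖h x‖ ≤ L * B * (weight K x / (1 + x ^ 2)) := by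
      intro x hx
      have hw := weight_pos K x
      have h1 : ‖(A x t).mulVec (Y x t)‖ ≤ 2 * (C / (1 + x ^ 2)) * (B * weight K x) :=
        (norm_mulVec_le (hA x t) _).trans
          (mul_le_mul_of_nonneg_left (hb' (x, t) ⟨hx, ht⟩) (by positivity))
      have h2 : ‖∫ τ in (0 : ℝ)..t, (At x τ).mulVec (Y x τ)‖
          ≤ 2 * (C' / (1 + x ^ 2)) * (B * weight K x) * |t - 0| := by
        refine intervalIntegral.norm_integral_le_of_norm_le_const fun τ hτ => ?_
        rw [uIoc_of_le ht.1] at hτ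
        exact (norm_mulVec_le (hAt x τ) _).trans (mul_le_mul_of_nonneg_left
          (hb' (x, τ) ⟨hx, hτ.1.le, hτ.2.trans ht.2⟩) (by positivity))
      rw [sub_zero, abs_of_nonneg ht.1] at h2
      have h3 : 2 * (C' / (1 + x ^ 2)) * (B * weight K x) * t
          ≤ 2 * (C' / (1 + x ^ 2)) * (B * weight K x) * b :=
        mul_le_mul_of_nonneg_left ht.2 (by positivity)
      calc ‖h x‖ ≤ _ := norm_sub_le _ _
        _ ≤ 2 * (C / (1 + x ^ 2)) * (B * weight K x)
            + 2 * (C' / (1 + x ^ 2)) * (B * weight K x) * b := by linarith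
        _ = _ := by rw [hL]; ring
    have hfd : ∀ x : ℝ, 0 ≤ x → HasDerivAt
        (fun x : ℝ => expHatCol k (c * ((z : ℂ) - x)) (Y x t))
        (expHatCol k (c * ((z : ℂ) - x)) (h x)) x := fun x hx =>
      hasDerivAt_expHatCol k c z x ((hY x hx t ht).congr_deriv (by
        rw [Matrix.add_mulVec, adMat_mulVec, add_sub_assoc]))
    have hexp : ∀ x : ℝ, z ≤ x → ∀ v, ‖expHatCol k (c * ((z : ℂ) - x)) v‖ ≤ ‖v‖ := fun x hx v =>
      norm_expHatCol_le (fun i => by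
        have : c * ((z : ℂ) - x) * (sgn i - sgn k)
          = ((z - x : ℝ) : ℂ) * (c * (sgn i - sgn k)) := by push_cast; ring
        rw [this, Complex.re_ofReal_mul]
        exact mul_nonpos_of_nonpos_of_nonneg (by linarith) (hc i)) v
    have hmain : ∀ X, z ≤ X → ‖Y z t‖ ≤ ε X + B / 2 * weight K z := by
      intro X hX
      have hB' : ∀ x, HasDerivAt (fun x => L * B / K * (weight K z - weight K x))
          (L * B * (weight K x / (1 + x ^ 2))) x := fun x => by
        refine (((hasDerivAt_weight K x).const_sub (weight K z)).const_mul
          (L * B / K)).congr_deriv ?_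
        field_simp
      have h1 := image_norm_le_of_norm_deriv_right_le_deriv_boundary
        (f := fun x : ℝ => expHatCol k (c * ((z : ℂ) - x)) (Y x t)
          - expHatCol k (c * ((z : ℂ) - z)) (Y z t)) (a := z) (b := X)
        (f' := fun x => expHatCol k (c * ((z : ℂ) - x)) (h x))
        (fun x hx => ((hfd x (hz.trans hx.1)).continuousAt.sub
          continuousAt_const).continuousWithinAt)
        (fun x hx => ((hfd x (hz.trans hx.1)).sub_const _).hasDerivWithinAt)
        (by simp) hB' (fun x hx => (hexp x hx.1 _).trans (hhb x (hz.trans hx.1)))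
        (right_mem_Icc.2 hX)
      simp only [sub_self, mul_zero, expHatCol_zero] at h1
      have h2 := (hexp X hX (Y X t)).trans (hYε X t ht)
      have h3 : ‖Y z t‖ ≤ ‖expHatCol k (c * ((z : ℂ) - X)) (Y X t)‖
          + ‖expHatCol k (c * ((z : ℂ) - X)) (Y X t) - Y z t‖ := by
        rw [add_comm]
        have := norm_sub_norm_le (Y z t) (expHatCol k (c * ((z : ℂ) - X)) (Y X t))
        rw [norm_sub_rev] at this
        linarith
      have hwX := weight_pos K X
      have hwz := weight_pos K z
      have h4 : L * B / K * (weight K z - weight K X) ≤ B / 2 * weight K z := by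
        have h5 : L * B / K * (weight K z - weight K X) ≤ L * B / K * weight K z :=
          mul_le_mul_of_nonneg_left (by linarith) (by positivity)
        have h6 : L / K * (B * weight K z) ≤ 1 / 2 * (B * weight K z) :=
          mul_le_mul_of_nonneg_right hLK (by positivity)
        calc _ ≤ _ := h5
          _ = L / K * (B * weight K z) := by ring
          _ ≤ _ := h6
          _ = _ := by ring
      linarith
    have hlim : Tendsto (fun X => ε X + B / 2 * weight K z) atTop (𝓝 (0 + B / 2 * weight K z)) :=
      hε.add_const _
    rw [zero_add] at hlim
    exact ge_of_tendsto hlim ((eventually_ge_atTop z).mono hmain)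

theorem H3_eq_plane {T : EReal} {r : 𝓢(ℝ × ℝ, ℂ)} {k : Fin 2} {s : ℂ}
    (hz : ∀ i, 0 ≤ (Complex.I * lam s * (sgn i - sgn k)).re)
    {F : ℝ → ℝ → Fin 2 → ℂ} (hF : Continuous fun p : ℝ × ℝ => F p.1 p.2)
    {N : ℝ} (hN : ∀ z t, ‖F z t‖ ≤ N)
    (h : ∀ t, SolvesBackward k (Complex.I * lam s) (fun ζ => A1 r ζ t s) univ univ
        fun z => F z t) {z t : ℝ} (hz0 : 0 ≤ z) (ht : t ∈ timesUpTo T) :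
    H3 T r k s z t = F z t := by
  have h0 := H3_spec (T := T) (r := r) hz
  obtain ⟨C, -, hC⟩ := exists_A1_bound r s
  obtain ⟨c0, N0, hN0⟩ := h0.1.slice_fst ht
  exact (h0.solvesBackward ht).unique hz (continuous_A1_fst r t s) (fun ζ => hC ζ t)
    MeasurableSet.univ (fun z hz ζ hζ => mem_Ici.2 (le_trans (mem_Ici.1 hz) (le_of_lt hζ.1)))
    (fun z _ => h t z (mem_univ z)) c0
    (hF.comp (f := fun z : ℝ => (z, t)) (by fun_prop)).continuousOn hN0 (fun z _ => hN z t) z hz0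

/-- The full-plane solution satisfies the `t`-part of the Lax pair. -/
theorem defect_eq_zero {T : EReal} (hT : 0 < T) {r : 𝓢(ℝ × ℝ, ℂ)} (hr : SolvesCLLNLS T r)
    {k : Fin 2} {s : ℂ} (hz : ∀ i, 0 ≤ (Complex.I * lam s * (sgn i - sgn k)).re)
    {F : ℝ → ℝ → Fin 2 → ℂ} (hF : Continuous fun p : ℝ × ℝ => F p.1 p.2)
    {N : ℝ} (hN : ∀ z t, ‖F z t‖ ≤ N)
    (h : ∀ t, SolvesBackward k (Complex.I * lam s) (fun ζ => A1 r ζ t s) univ univ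
        fun z => F z t) {b : ℝ} (hb : b ∈ timesUpTo T) :
    ∀ z, 0 ≤ z → ∀ t ∈ Icc 0 b,
      defect (fun z t => adMat k (-2 * Complex.I * lam s ^ 2) + B1 r z t s) F z t = 0 := by
  obtain ⟨C, hC0, hC⟩ := exists_A1_bound r s
  obtain ⟨C', -, hC'⟩ := exists_A1t_bound r s
  obtain ⟨CB, hCB0, hCB, -⟩ := exists_B1_bound r s
  have hN0 : 0 ≤ N := (norm_nonneg _).trans (hN 0 0)
  have hb0 : 0 ≤ b := hb.1
  set c' := -2 * Complex.I * lam s ^ 2 with hc'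
  set ε₀ : ℝ → ℝ := fun z => 2 * C * N * (Real.pi / 2 - Real.arctan z) with hε₀
  have hFε : ∀ z t, ‖F z t - Pi.single k 1‖ ≤ ε₀ z := fun z t =>
    (h t).norm_sub_le hz (fun ζ => hC ζ t) (fun z => hN z t) z
  have hε₀0 : ∀ z, 0 ≤ ε₀ z := fun z => (norm_nonneg _).trans (hFε z 0)
  have hε₀b : ∀ z, ε₀ z ≤ 2 * C * N * Real.pi := fun z =>
    mul_le_mul_of_nonneg_left (by linarith [Real.neg_pi_div_two_lt_arctan z]) (by positivity)
  have hε₀t : Tendsto ε₀ atTop (𝓝 0) := by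
    simpa using tendsto_pi_div_two_sub_arctan.const_mul (2 * C * N)
  set ε : ℝ → ℝ := fun z =>
    2 * ε₀ z + (2 * ‖c'‖ * ε₀ z + 2 * (CB / (1 + z ^ 2)) * N) * b with hε
  have hεt : Tendsto ε atTop (𝓝 0) := by
    have := (hε₀t.const_mul 2).add ((((hε₀t.const_mul (2 * ‖c'‖)).add
      (((tendsto_const_div_one_add_sq CB).const_mul 2).mul_const N))).mul_const b)
    simpa using this
  have hεb : ∀ z, ε z ≤ 2 * (2 * C * N * Real.pi)
      + (2 * ‖c'‖ * (2 * C * N * Real.pi) + 2 * CB * N) * b := fun z => by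
    have h1 := hε₀b z
    have h2 : CB / (1 + z ^ 2) ≤ CB := div_le_self hCB0 (by nlinarith [sq_nonneg z])
    simp only [hε]
    gcongr
  refine eq_zero_of_tendsto_zero hz hC hC' hεt ?_ hεb ?_
  · intro z t ht
    have h1 : ‖∫ τ in (0 : ℝ)..t, (adMat k c' + B1 r z τ s).mulVec (F z τ)‖
        ≤ (2 * ‖c'‖ * ε₀ z + 2 * (CB / (1 + z ^ 2)) * N) * |t - 0| := by
      refine intervalIntegral.norm_integral_le_of_norm_le_const fun τ _ => ?_
      rw [Matrix.add_mulVec, adMat_mulVec, ← adCol_sub_single]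
      refine (norm_add_le _ _).trans (add_le_add ?_ ?_)
      · exact (norm_adCol_le _ _ _).trans
          (mul_le_mul_of_nonneg_left (hFε z τ) (by positivity))
      · exact (norm_mulVec_le (hCB z τ) _).trans
          (mul_le_mul_of_nonneg_left (hN z τ) (by positivity))
    rw [sub_zero, abs_of_nonneg ht.1] at h1
    have h2 : (2 * ‖c'‖ * ε₀ z + 2 * (CB / (1 + z ^ 2)) * N) * t
        ≤ (2 * ‖c'‖ * ε₀ z + 2 * (CB / (1 + z ^ 2)) * N) * b := by
      have := hε₀0 z
      exact mul_le_mul_of_nonneg_left ht.2 (by positivity)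
    have h3 : ‖F z t - F z 0‖ ≤ 2 * ε₀ z := by
      have := norm_sub_le (F z t - Pi.single k 1) (F z 0 - Pi.single k 1)
      rw [sub_sub_sub_cancel_right] at this
      linarith [hFε z t, hFε z 0]
    refine (norm_sub_le _ _).trans ?_
    simp only [hε]
    linarith
  · intro z hz0 t ht
    have hdom : ∀ τ ∈ Icc 0 t, (z, τ) ∈ closedDomain T := fun τ hτ =>
      ⟨hz0, hτ.1, (EReal.coe_le_coe_iff.2 (hτ.2.trans ht.2)).trans hb.2⟩
    refine hasDerivAt_defect (U := fun z t => adMat k (Complex.I * lam s) + A1 r z t s)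
      (Ut := fun z t => A1t r z t s) (Vz := fun z t => B1z r z t s)
      (continuous_const.add (continuous_A1 r s)) (continuous_const.add (continuous_B1 r s))
      (continuous_A1t r s) (continuous_B1z r s) (fun z t i j => ?_) hF (fun z t => ?_) ht.1
      (fun τ hτ i j => ?_) (fun τ hτ => zero_curvature hT hr (hdom τ hτ) k s)
    · exact (hasDerivAt_B1 r z t s i j).const_add _
    · exact (h t).hasDerivAt hz (continuous_A1_fst r t s) (fun ζ => hC ζ t)
        (hF.comp (f := fun z : ℝ => (z, t)) (by fun_prop)) (fun z => hN z t) z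
    · exact (hasDerivAt_A1 hT hr (hdom τ hτ) s i j).const_add _

/-- The `t`-part of the Lax pair for `H₃` at the boundary. -/
theorem H3_colODE_time {T : EReal} (hT : 0 < T) {r : 𝓢(ℝ × ℝ, ℂ)} (hr : SolvesCLLNLS T r)
    {k : Fin 2} {s : ℂ} (hz : ∀ i, 0 ≤ (Complex.I * lam s * (sgn i - sgn k)).re) {b : ℝ}
    (hb : b ∈ timesUpTo T) :
    ColODE k (-2 * Complex.I * lam s ^ 2) (fun τ => B1 r 0 τ s) b
      fun t => H3 T r k s 0 t := by
  obtain ⟨F, hF, ⟨N, hN⟩, h⟩ := exists_H3_plane r hz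
  have hmem : ∀ t ∈ Icc 0 b, t ∈ timesUpTo T := fun t ht =>
    ⟨ht.1, (EReal.coe_le_coe_iff.2 ht.2).trans hb.2⟩
  have heq : ∀ t ∈ Icc 0 b, H3 T r k s 0 t = F 0 t := fun t ht =>
    H3_eq_plane hz hF hN h le_rfl (hmem t ht)
  set V := fun τ => (adMat k (-2 * Complex.I * lam s ^ 2) + B1 r 0 τ s).mulVec (F 0 τ) with hV
  have hF0 : Continuous fun t => F 0 t := hF.comp (f := fun t : ℝ => ((0 : ℝ), t)) (by fun_prop)
  have hVc : Continuous V := (continuous_const.add (continuous_B1_zero r s)).matrix_mulVec hF0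
  have hI : ∀ t ∈ Icc 0 b, H3 T r k s 0 t = F 0 0 + ∫ τ in (0 : ℝ)..t, V τ := fun t ht => by
    have := defect_eq_zero hT hr hz hF hN h hb 0 le_rfl t ht
    rw [defect, sub_sub, sub_eq_zero] at this
    rw [heq t ht, this]
  refine ⟨(continuousOn_congr heq).2 hF0.continuousOn, fun t ht => ?_⟩
  have ht' : t ∈ Icc 0 b := Ico_subset_Icc_self ht
  have hd : HasDerivAt (fun t => F 0 0 + ∫ τ in (0 : ℝ)..t, V τ) (V t) t :=
    (intervalIntegral.integral_hasDerivAt_right (hVc.intervalIntegrable _ _)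
      (hVc.stronglyMeasurableAtFilter _ _) hVc.continuousAt).const_add _
  have hVt : V t = adCol k (-2 * Complex.I * lam s ^ 2) (H3 T r k s 0 t)
      + (B1 r 0 t s).mulVec (H3 T r k s 0 t) := by
    rw [heq t ht', hV, ← adMat_mulVec, ← Matrix.add_mulVec]
  rw [← hVt]
  refine hd.hasDerivWithinAt.congr_of_eventuallyEq ?_ (hI t ht')
  filter_upwards [Icc_mem_nhdsGE ht.2] with y hy
  exact hI y ⟨ht.1.trans hy.1, hy.2⟩

theorem H3_colODE_space {T : EReal} {r : 𝓢(ℝ × ℝ, ℂ)} {k : Fin 2} {s : ℂ}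
    (hz : ∀ i, 0 ≤ (Complex.I * lam s * (sgn i - sgn k)).re) {t : ℝ} (ht : t ∈ timesUpTo T)
    (b : ℝ) :
    ColODE k (Complex.I * lam s) (fun ζ => A1 r ζ t s) b fun z => H3 T r k s z t := by
  have h0 := H3_spec (T := T) (r := r) hz
  refine colODE_of_forward (continuous_A1_fst r t s)
    ((h0.1.slice_fst ht).1.mono Icc_subset_Ici_self) (g := H3 T r k s 0 t) fun x hx => ?_
  have := (h0.solvesBackward ht).eq_forward MeasurableSet.univ hx.1 (mem_Ici.2 le_rfl)
    (mem_Ici.2 hx.1) (subset_univ _) (h0.integrableOn hz ht le_rfl)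
  simpa only [Complex.ofReal_zero, sub_zero] using this

/-! ### Lax solutions -/

/-- Solutions of the `z`-part of the Lax pair which satisfy the `t`-part on the boundary. -/
structure IsLaxSol (T : EReal) (r : ℝ × ℝ → ℂ) (s : ℂ) (Φ : ℝ → ℝ → Fin 2 → ℂ) : Prop where
  space : ∀ t ∈ timesUpTo T, ∀ b,
    LinODE (Complex.I * lam s) (fun ζ => A1 r ζ t s) b fun z => Φ z t
  time : ∀ b ∈ timesUpTo T,
    LinODE (-2 * Complex.I * lam s ^ 2) (fun τ => B1 r 0 τ s) b fun t => Φ 0 t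

theorem IsLaxSol.add {T : EReal} {r : ℝ × ℝ → ℂ} {s : ℂ} {Φ Ψ : ℝ → ℝ → Fin 2 → ℂ}
    (hΦ : IsLaxSol T r s Φ) (hΨ : IsLaxSol T r s Ψ) :
    IsLaxSol T r s fun z t => Φ z t + Ψ z t :=
  ⟨fun t ht b => (hΦ.space t ht b).add (hΨ.space t ht b),
    fun b hb => (hΦ.time b hb).add (hΨ.time b hb)⟩

theorem IsLaxSol.smul {T : EReal} {r : ℝ × ℝ → ℂ} {s : ℂ} {Φ : ℝ → ℝ → Fin 2 → ℂ}
    (hΦ : IsLaxSol T r s Φ) (a : ℂ) : IsLaxSol T r s fun z t => a • Φ z t :=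
  ⟨fun t ht b => (hΦ.space t ht b).smul a, fun b hb => (hΦ.time b hb).smul a⟩

theorem IsLaxSol.eq_zero {T : EReal} {r : 𝓢(ℝ × ℝ, ℂ)} {s : ℂ} {Φ : ℝ → ℝ → Fin 2 → ℂ}
    (hΦ : IsLaxSol T r s Φ) (h0 : Φ 0 0 = 0) {z t : ℝ} (hzt : (z, t) ∈ closedDomain T) :
    Φ z t = 0 := by
  have hle : ∀ {C : ℝ}, 0 ≤ C → ∀ x : ℝ, C / (1 + x ^ 2) ≤ C := fun hC x =>
    div_le_self hC (by nlinarith [sq_nonneg x])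
  obtain ⟨C, hC0, hC⟩ := exists_A1_bound r s
  obtain ⟨CB, hCB0, hCB, -⟩ := exists_B1_bound r s
  have h1 : Φ 0 t = 0 := (hΦ.time t hzt.2).eq_zero
    (fun τ i j => (hCB 0 τ i j).trans (hle hCB0 0)) h0 t ⟨hzt.2.1, le_rfl⟩
  exact (hΦ.space t hzt.2 z).eq_zero
    (fun ζ i j => (hC ζ t i j).trans (hle hC0 ζ)) h1 z ⟨hzt.1, le_rfl⟩

/-- The factor turning `k`-th columns into Lax solutions. -/
def gaugeExp (k : Fin 2) (s : ℂ) (z t : ℝ) : ℂ := Complex.exp (-(sgn k * Complex.I * eta z t s))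

theorem isLaxSol_of_colODE {T : EReal} {r : 𝓢(ℝ × ℝ, ℂ)} {k : Fin 2} {s : ℂ}
    {F : ℝ → ℝ → Fin 2 → ℂ}
    (hz : ∀ t ∈ timesUpTo T, ∀ b,
      ColODE k (Complex.I * lam s) (fun ζ => A1 r ζ t s) b fun z => F z t)
    (ht : ∀ b ∈ timesUpTo T,
      ColODE k (-2 * Complex.I * lam s ^ 2) (fun τ => B1 r 0 τ s) b fun t => F 0 t) :
    IsLaxSol T r s fun z t => gaugeExp k s z t • F z t := by
  refine ⟨fun t htT b => ?_, fun b hb => ?_⟩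
  · have h := (hz t htT b).linODE (Complex.exp (-2 * Complex.I * lam s ^ 2 * sgn k * t))
    have e : ∀ z : ℝ, gaugeExp k s z t = Complex.exp (-2 * Complex.I * lam s ^ 2 * sgn k * t)
        * Complex.exp (Complex.I * lam s * sgn k * z) := fun z => by
      rw [gaugeExp, eta, ← Complex.exp_add]; congr 1; ring
    simpa only [e] using h
  · have h := (ht b hb).linODE 1
    have e : ∀ t : ℝ, gaugeExp k s 0 t
        = 1 * Complex.exp (-2 * Complex.I * lam s ^ 2 * sgn k * t) := fun t => by
      rw [gaugeExp, eta, one_mul]; congr 1; push_cast; ring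
    simpa only [e] using h

theorem isLaxSol_H3 {T : EReal} (hT : 0 < T) {r : 𝓢(ℝ × ℝ, ℂ)} (hr : SolvesCLLNLS T r)
    {k : Fin 2} {s : ℂ} (hz : ∀ i, 0 ≤ (Complex.I * lam s * (sgn i - sgn k)).re) :
    IsLaxSol T r s fun z t => gaugeExp k s z t • H3 T r k s z t :=
  isLaxSol_of_colODE (fun _ ht b => H3_colODE_space hz ht b) fun _ hb =>
    H3_colODE_time hT hr hz hb

theorem Icc_subset_timesUpTo {T : EReal} {b : ℝ} (hb : b ∈ timesUpTo T) :
    Icc 0 b ⊆ timesUpTo T := fun _ ht =>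
  ⟨ht.1, (EReal.coe_le_coe_iff.2 ht.2).trans hb.2⟩

theorem H1_zero {T : EReal} (hT : 0 < T) {r : 𝓢(ℝ × ℝ, ℂ)} {k : Fin 2} {s : ℂ}
    (hz : ∀ i, (Complex.I * lam s * (sgn i - sgn k)).re ≤ 0)
    (ht : ∀ i, (-2 * Complex.I * lam s ^ 2 * (sgn i - sgn k)).re ≤ 0) :
    H1 T r k s 0 0 = Pi.single k 1 := by
  rw [(H1_spec (T := T) (r := r) hz ht).2 0 0 ⟨le_rfl, le_rfl, by simpa using hT.le⟩]
  simp [expHatCol_zero]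

theorem isLaxSol_H1 {T : EReal} {r : 𝓢(ℝ × ℝ, ℂ)} {k : Fin 2} {s : ℂ}
    (hz : ∀ i, (Complex.I * lam s * (sgn i - sgn k)).re ≤ 0)
    (ht : ∀ i, (-2 * Complex.I * lam s ^ 2 * (sgn i - sgn k)).re ≤ 0) :
    IsLaxSol T r s fun z t => gaugeExp k s z t • H1 T r k s z t := by
  have h := H1_spec (T := T) (r := r) hz ht
  have hbd : ∀ t ∈ timesUpTo T, H1 T r k s 0 t = Pi.single k 1 + ∫ τ in (0 : ℝ)..t,
      expHatCol k (-2 * Complex.I * lam s ^ 2 * ((t : ℂ) - τ))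
        ((B1 r 0 τ s).mulVec (H1 T r k s 0 τ)) := fun t ht => by
    have := h.2 0 t ⟨le_rfl, ht⟩
    rwa [intervalIntegral.integral_same, Complex.ofReal_zero, mul_zero, expHatCol_zero,
      add_zero] at this
  refine isLaxSol_of_colODE (fun t ht b => ?_) fun b hb => ?_
  · refine colODE_of_forward (continuous_A1_fst r t s)
      ((h.1.slice_fst ht).1.mono Icc_subset_Ici_self) (g := H1 T r k s 0 t) fun x hx => ?_
    rw [h.2 x t ⟨hx.1, ht⟩, hbd t ht, expHatCol_add_right, expHatCol_single]
    exact add_right_comm _ _ _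
  · refine colODE_of_forward (continuous_B1_zero r s)
      (h.1.slice_zero.1.mono (Icc_subset_timesUpTo hb)) (g := Pi.single k 1) fun x hx => ?_
    rw [hbd x (Icc_subset_timesUpTo hb hx), expHatCol_single]
    rfl

theorem isLaxSol_H2 {T : EReal} {r : 𝓢(ℝ × ℝ, ℂ)} {k : Fin 2} {s : ℂ}
    (hz : ∀ i, (Complex.I * lam s * (sgn i - sgn k)).re ≤ 0)
    (ht : ∀ i, 0 ≤ (-2 * Complex.I * lam s ^ 2 * (sgn i - sgn k)).re) :
    IsLaxSol T r s fun z t => gaugeExp k s z t • H2 T r k s z t := by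
  have h := H2_spec (T := T) (r := r) hz ht
  refine isLaxSol_of_colODE (fun t htT b => ?_) fun b hb => ?_
  · refine colODE_of_forward (continuous_A1_fst r t s)
      ((h.1.slice_fst htT).1.mono Icc_subset_Ici_self) (g := H2 T r k s 0 t) fun x hx => ?_
    have hbd : H2 T r k s 0 t = Pi.single k 1 - ∫ τ in {τ : ℝ | t < τ ∧ (τ : EReal) < T},
        expHatCol k (-2 * Complex.I * lam s ^ 2 * ((t : ℂ) - τ))
          ((B1 r 0 τ s).mulVec (H2 T r k s 0 τ)) := h.solvesBackward t htT
    rw [h.2 x t ⟨hx.1, htT⟩, hbd, expHatCol_sub_right, expHatCol_single]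
    exact (sub_add_eq_add_sub _ _ _).symm
  · refine colODE_of_forward (continuous_B1_zero r s)
      (h.1.slice_zero.1.mono (Icc_subset_timesUpTo hb)) (g := H2 T r k s 0 0) fun x hx => ?_
    have hx' := Icc_subset_timesUpTo hb hx
    have h0 : (0 : ℝ) ∈ timesUpTo T := Icc_subset_timesUpTo hb ⟨le_rfl, hb.1⟩
    have := h.solvesBackward.eq_forward (measurableSet_timesBefore T) hx.1 h0 hx'
      (fun τ hτ => lt_of_lt_of_le (EReal.coe_lt_coe_iff.2 hτ.2) hx'.2) (h.integrableOn ht h0)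
    simpa only [Complex.ofReal_zero, sub_zero] using this

theorem re_nonneg_zero {c : ℂ} (h : c.re ≤ 0) : ∀ i, 0 ≤ (c * (sgn i - sgn 0)).re := by
  intro i; fin_cases i
  · simp [sgn]
  · simp [sgn]; linarith

theorem re_nonpos_zero {c : ℂ} (h : 0 ≤ c.re) : ∀ i, (c * (sgn i - sgn 0)).re ≤ 0 := by
  intro i; fin_cases i
  · simp [sgn]
  · simp [sgn]; linarith

theorem re_nonneg_one {c : ℂ} (h : 0 ≤ c.re) : ∀ i, 0 ≤ (c * (sgn i - sgn 1)).re := by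
  intro i; fin_cases i
  · simp [sgn]; linarith
  · simp [sgn]

theorem re_nonpos_one {c : ℂ} (h : c.re ≤ 0) : ∀ i, (c * (sgn i - sgn 1)).re ≤ 0 := by
  intro i; fin_cases i
  · simp [sgn]; linarith
  · simp [sgn]

theorem phi_re (s : ℂ) : (phi s).re = (lam s).im := by simp [phi]

theorem psi_re (s : ℂ) : (psi s).re = 4 * (lam s).re * (lam s).im := by
  simp [psi, pow_two]; ring

theorem I_mul_lam_re (s : ℂ) : (Complex.I * lam s).re = -(phi s).re := by simp [phi]

/-! ### Values at the origin -/

theorem zero_mem_timesUpTo {T : EReal} (hT : 0 < T) : (0 : ℝ) ∈ timesUpTo T :=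
  ⟨le_rfl, by simpa using hT.le⟩

theorem schwarzConj_beta (T : EReal) (r : ℝ × ℝ → ℂ) (s : ℂ) :
    schwarzConj (beta T r) s = schwarzConj (uFun T r) s * UFun T r s
      + schwarzConj (vFun T r) s * VFun T r s := by
  simp [schwarzConj, beta]

theorem schwarzConj_delta (T : EReal) (r : ℝ × ℝ → ℂ) (s : ℂ) :
    schwarzConj (delta T r) s = schwarzConj (vFun T r) s / uFun T r s := by
  simp [schwarzConj, delta]

theorem schwarzConj_Delta (T : EReal) (r : ℝ × ℝ → ℂ) (s : ℂ) :
    schwarzConj (Delta T r) s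
      = -VFun T r s / (schwarzConj (uFun T r) s * schwarzConj (beta T r) s) := by
  simp [schwarzConj, Delta]

theorem H3_zero_origin {T : EReal} (hT : 0 < T) {r : 𝓢(ℝ × ℝ, ℂ)} {s : ℂ}
    (hs : 0 ≤ (phi s).re) :
    H3 T r 0 s 0 0 = ![schwarzConj (uFun T r) s, -schwarzConj (vFun T r) s] := by
  rw [H3_conj (re_nonneg_zero (by rw [I_mul_lam_re]; linarith)) le_rfl (zero_mem_timesUpTo hT),
    conjSwap_apply]
  rfl

theorem H2_zero_origin {T : EReal} (hT : 0 < T) {r : 𝓢(ℝ × ℝ, ℂ)} {s : ℂ}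
    (hs : (phi s).re ≤ 0) (hp : (psi s).re ≤ 0) :
    H2 T r 0 s 0 0 = ![schwarzConj (UFun T r) s, -schwarzConj (VFun T r) s] := by
  rw [H2_conj (re_nonpos_zero (by rw [I_mul_lam_re]; linarith)) (re_nonneg_zero hp)
    (zero_mem_timesUpTo hT), conjSwap_apply]
  rfl

/-- The determinant of `H₃` equals one where both columns exist. -/
theorem uFun_mul_add_vFun_mul {T : EReal} (hT : 0 < T) {r : 𝓢(ℝ × ℝ, ℂ)} {s : ℂ}
    (hs : (phi s).re = 0) :
    uFun T r s * schwarzConj (uFun T r) s + vFun T r s * schwarzConj (vFun T r) s = 1 := by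
  have h0 := re_nonneg_zero (c := Complex.I * lam s) (by rw [I_mul_lam_re, hs, neg_zero])
  have h1 := re_nonneg_one (c := Complex.I * lam s) (by rw [I_mul_lam_re, hs, neg_zero])
  obtain ⟨F, hF, ⟨N, hN⟩, hFs⟩ := exists_H3_plane r h0
  obtain ⟨G, hG, ⟨N', hN'⟩, hGs⟩ := exists_H3_plane r h1
  obtain ⟨C, -, hC⟩ := exists_A1_bound r s
  have hFd := fun z => (hFs 0).hasDerivAt h0 (continuous_A1_fst r 0 s) (fun ζ => hC ζ 0)
    (hF.comp (f := fun z : ℝ => (z, (0 : ℝ))) (by fun_prop)) (fun z => hN z 0) z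
  have hGd := fun z => (hGs 0).hasDerivAt h1 (continuous_A1_fst r 0 s) (fun ζ => hC ζ 0)
    (hG.comp (f := fun z : ℝ => (z, (0 : ℝ))) (by fun_prop)) (fun z => hN' z 0) z
  set W : ℝ → ℂ := fun z => F z 0 0 * G z 0 1 - F z 0 1 * G z 0 0 with hW
  have hWd : ∀ z, HasDerivAt W 0 z := fun z => by
    have f := hasDerivAt_pi.1 (hFd z)
    have g := hasDerivAt_pi.1 (hGd z)
    refine (((f 0).mul (g 1)).sub ((f 1).mul (g 0))).congr_deriv ?_
    rw [A1_eq]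
    simp [adMat, Matrix.mulVec, dotProduct, Fin.sum_univ_two, sgn]
    ring
  have hconst : ∀ z, W z = W 0 := fun z =>
    is_const_of_deriv_eq_zero (fun z => (hWd z).differentiableAt) (fun z => (hWd z).deriv) z 0
  have hlim : ∀ {k : Fin 2} {H : ℝ → ℝ → Fin 2 → ℂ} {N : ℝ}
      (_ : ∀ i, 0 ≤ (Complex.I * lam s * (sgn i - sgn k)).re)
      (_ : SolvesBackward k (Complex.I * lam s) (fun ζ => A1 r ζ 0 s) univ univ fun z => H z 0)
      (_ : ∀ z t, ‖H z t‖ ≤ N), Tendsto (fun z => H z 0) atTop (𝓝 (Pi.single k 1)) := by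
    intro k H N hk hH hN
    rw [tendsto_iff_norm_sub_tendsto_zero]
    refine squeeze_zero (fun _ => norm_nonneg _)
      (fun z => hH.norm_sub_le hk (fun ζ => hC ζ 0) (fun z => hN z 0) z) ?_
    simpa using tendsto_pi_div_two_sub_arctan.const_mul (2 * C * N)
  have lF := tendsto_pi_nhds.1 (hlim h0 (hFs 0) hN)
  have lG := tendsto_pi_nhds.1 (hlim h1 (hGs 0) hN')
  have lW : Tendsto W atTop (𝓝 1) := by
    have := ((lF 0).mul (lG 1)).sub ((lF 1).mul (lG 0))
    simpa using this
  have hW0 : W 0 = 1 :=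
    tendsto_nhds_unique (tendsto_const_nhds.congr fun z => (hconst z).symm) lW
  have hz := zero_mem_timesUpTo hT
  have e0 : F 0 0 = ![schwarzConj (uFun T r) s, -schwarzConj (vFun T r) s] := by
    rw [← H3_eq_plane h0 hF hN hFs le_rfl hz, H3_zero_origin hT hs.ge]
  have e1 : G 0 0 = H3 T r 1 s 0 0 := (H3_eq_plane h1 hG hN' hGs le_rfl hz).symm
  simp only [hW, e0, e1] at hW0
  simp only [Matrix.cons_val_zero, Matrix.cons_val_one] at hW0
  rw [uFun, vFun]
  linear_combination hW0

/-! ### The jump relations -/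

theorem gaugeExp_ne_zero (k : Fin 2) (s : ℂ) (z t : ℝ) : gaugeExp k s z t ≠ 0 :=
  Complex.exp_ne_zero _

theorem gaugeExp_origin (k : Fin 2) (s : ℂ) : gaugeExp k s 0 0 = 1 := by
  simp [gaugeExp, eta]

theorem gaugeExp_one_eq (s : ℂ) (z t : ℝ) :
    gaugeExp 1 s z t = gaugeExp 0 s z t * Complex.exp (2 * Complex.I * eta z t s) := by
  rw [gaugeExp, gaugeExp, ← Complex.exp_add]
  congr 1
  simp [sgn]
  ring

theorem gaugeExp_zero_eq (s : ℂ) (z t : ℝ) :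
    gaugeExp 0 s z t = gaugeExp 1 s z t * Complex.exp (-2 * Complex.I * eta z t s) := by
  rw [gaugeExp, gaugeExp, ← Complex.exp_add]
  congr 1
  simp [sgn]
  ring

theorem exp_eta_mul (s : ℂ) (z t : ℝ) :
    Complex.exp (-2 * Complex.I * eta z t s) * Complex.exp (2 * Complex.I * eta z t s) = 1 := by
  rw [← Complex.exp_add, ← Complex.exp_zero]
  congr 1; ring

/-- A linear relation between three columns that holds at the origin holds everywhere. -/
theorem relation_of_origin {T : EReal} {r : 𝓢(ℝ × ℝ, ℂ)} {s : ℂ} {k l m : Fin 2}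
    {F G H : ℝ → ℝ → Fin 2 → ℂ} (hF : IsLaxSol T r s fun z t => gaugeExp k s z t • F z t)
    (hG : IsLaxSol T r s fun z t => gaugeExp l s z t • G z t)
    (hH : IsLaxSol T r s fun z t => gaugeExp m s z t • H z t) {a b c : ℂ}
    (h : a • F 0 0 = b • G 0 0 + c • H 0 0) {z t : ℝ} (hzt : (z, t) ∈ closedDomain T) :
    (a * gaugeExp k s z t) • F z t
      = (b * gaugeExp l s z t) • G z t + (c * gaugeExp m s z t) • H z t := by
  have h1 := ((hF.smul a).add (hG.smul (-b))).add (hH.smul (-c))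
  have h2 := h1.eq_zero (by
    simp only [gaugeExp_origin, one_smul, neg_smul]
    rw [h, add_neg_cancel_comm, add_neg_cancel]) hzt
  simp only [smul_smul, neg_mul, neg_smul] at h2
  rw [add_assoc, ← neg_add, ← sub_eq_add_neg, sub_eq_zero] at h2
  exact h2

section Jumps

variable {T : EReal} {r : 𝓢(ℝ × ℝ, ℂ)} {s : ℂ} {z t : ℝ}

theorem E3_eq_E4_mul_G1 (hT : 0 < T) (hr : SolvesCLLNLS T r) (hzt : (z, t) ∈ closedDomain T)
    (hs : (phi s).re ≤ 0) (hp : (psi s).re = 0) (hu : uFun T r s ≠ 0) (hβ : beta T r s ≠ 0) :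
    E3 T r z t s = E4 T r z t s * G1 T r z t s := by
  have hI : 0 ≤ (Complex.I * lam s).re := by rw [I_mul_lam_re]; linarith
  have f := isLaxSol_H2 (T := T) (r := r) (re_nonpos_zero hI) (re_nonneg_zero hp.le)
  have g := isLaxSol_H1 (T := T) (r := r) (re_nonpos_zero hI) (re_nonpos_zero hp.ge)
  have h := isLaxSol_H3 hT hr (re_nonneg_one hI)
  have key := relation_of_origin f g h (a := (beta T r s)⁻¹) (b := (uFun T r s)⁻¹)
    (c := Delta T r s) (by
      rw [H2_zero_origin hT hs hp.le, H1_zero hT (re_nonpos_zero hI) (re_nonpos_zero hp.ge)]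
      ext i
      fin_cases i
      · simp only [Fin.zero_eta, Pi.smul_apply, Pi.add_apply, Matrix.cons_val_zero, smul_eq_mul,
          Pi.single_eq_same]
        change _ = _ + _ * vFun T r s
        rw [Delta]
        field_simp
        rw [beta]; ring
      · simp
        change _ = _ * uFun T r s
        rw [Delta]
        field_simp) hzt
  rw [gaugeExp_one_eq] at key
  have h0 := gaugeExp_ne_zero 0 s z t
  have e : ∀ i, (beta T r s)⁻¹ * H2 T r 0 s z t i = (uFun T r s)⁻¹ * H1 T r 0 s z t i
      + Delta T r s * Complex.exp (2 * Complex.I * eta z t s) * H3 T r 1 s z t i := fun i => by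
    have := congrFun key i
    simp only [Pi.add_apply, Pi.smul_apply, smul_eq_mul] at this
    refine mul_left_cancel₀ h0 ?_
    linear_combination this
  ext i j
  fin_cases i <;> fin_cases j <;>
    simp [E3, E4, G1, ofCols, Matrix.mul_apply, Fin.sum_univ_two, e] <;> ring

theorem E2_eq_E1_mul_G3 (hT : 0 < T) (hr : SolvesCLLNLS T r) (hzt : (z, t) ∈ closedDomain T)
    (hs : 0 ≤ (phi s).re) (hp : (psi s).re = 0) (hu : schwarzConj (uFun T r) s ≠ 0)
    (hβ : schwarzConj (beta T r) s ≠ 0) :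
    E2 T r z t s = E1 T r z t s * G3 T r z t s := by
  have hI : (Complex.I * lam s).re ≤ 0 := by rw [I_mul_lam_re]; linarith
  have f := isLaxSol_H1 (T := T) (r := r) (re_nonpos_one hI) (re_nonpos_one hp.le)
  have g := isLaxSol_H2 (T := T) (r := r) (re_nonpos_one hI) (re_nonneg_one hp.ge)
  have h := isLaxSol_H3 hT hr (re_nonneg_zero hI)
  have key := relation_of_origin f g h (a := (schwarzConj (uFun T r) s)⁻¹)
    (b := (schwarzConj (beta T r) s)⁻¹) (c := schwarzConj (Delta T r) s) (by
      rw [H3_zero_origin hT hs, H1_zero hT (re_nonpos_one hI) (re_nonpos_one hp.le),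
        schwarzConj_Delta]
      ext i
      fin_cases i
      · simp
        change _ = _ * VFun T r s + _
        field_simp
        ring
      · simp
        change _ = _ * UFun T r s + _
        field_simp
        rw [schwarzConj_beta]; ring) hzt
  rw [gaugeExp_zero_eq] at key
  have h0 := gaugeExp_ne_zero 1 s z t
  have e : ∀ i, (schwarzConj (uFun T r) s)⁻¹ * H1 T r 1 s z t i
      = (schwarzConj (beta T r) s)⁻¹ * H2 T r 1 s z t i
      + schwarzConj (Delta T r) s * Complex.exp (-2 * Complex.I * eta z t s)
        * H3 T r 0 s z t i := fun i => by
    have := congrFun key i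
    simp only [Pi.add_apply, Pi.smul_apply, smul_eq_mul] at this
    refine mul_left_cancel₀ h0 ?_
    linear_combination this
  simp only [neg_mul] at e
  ext i j
  fin_cases i <;> fin_cases j <;>
    simp [E1, E2, G3, ofCols, Matrix.mul_apply, Fin.sum_univ_two, e] <;> ring

theorem E2_eq_E4_mul_G4 (hT : 0 < T) (hr : SolvesCLLNLS T r) (hzt : (z, t) ∈ closedDomain T)
    (hs : (phi s).re = 0) (hp : (psi s).re = 0) (hu : uFun T r s ≠ 0)
    (hu' : schwarzConj (uFun T r) s ≠ 0) :
    E2 T r z t s = E4 T r z t s * G4 T r z t s := by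
  have hI : (Complex.I * lam s).re = 0 := by rw [I_mul_lam_re]; linarith
  have hdet := uFun_mul_add_vFun_mul hT (r := r) hs
  have f0 := isLaxSol_H1 (T := T) (r := r) (re_nonpos_zero hI.ge) (re_nonpos_zero hp.ge)
  have f1 := isLaxSol_H1 (T := T) (r := r) (re_nonpos_one hI.le) (re_nonpos_one hp.le)
  have g0 := isLaxSol_H3 hT hr (re_nonneg_zero hI.le)
  have g1 := isLaxSol_H3 hT hr (re_nonneg_one hI.ge)
  have v0 := H1_zero (r := r) hT (re_nonpos_zero hI.ge) (re_nonpos_zero hp.ge)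
  have v1 := H1_zero (r := r) hT (re_nonpos_one hI.le) (re_nonpos_one hp.le)
  have key0 := relation_of_origin g0 f0 g1 (a := 1) (b := (uFun T r s)⁻¹)
    (c := -schwarzConj (delta T r) s) (by
      rw [H3_zero_origin hT hs.ge, v0, schwarzConj_delta]
      ext i
      fin_cases i
      · simp
        change _ = _ + -(_ * vFun T r s)
        field_simp
        linear_combination hdet
      · simp
        change _ = _ * uFun T r s
        field_simp) hzt
  have key1 := relation_of_origin f1 f0 g1 (a := (schwarzConj (uFun T r) s)⁻¹)
    (b := -delta T r s * (uFun T r s)⁻¹)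
    (c := 1 + delta T r s * schwarzConj (delta T r) s) (by
      rw [v0, v1, schwarzConj_delta, delta]
      ext i
      fin_cases i
      · simp
        change _ = _ + _ * vFun T r s
        field_simp
        linear_combination (-vFun T r s) * hdet
      · simp
        change _ = _ * uFun T r s
        field_simp
        linear_combination -hdet) hzt
  have hx := exp_eta_mul s z t
  have h0 := gaugeExp_ne_zero 0 s z t
  have h1 := gaugeExp_ne_zero 1 s z t
  rw [gaugeExp_one_eq] at key0
  rw [gaugeExp_zero_eq] at key1
  have e0 : ∀ i, H3 T r 0 s z t i = (uFun T r s)⁻¹ * H1 T r 0 s z t i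
      + -schwarzConj (delta T r) s * Complex.exp (2 * Complex.I * eta z t s)
        * H3 T r 1 s z t i := fun i => by
    have := congrFun key0 i
    simp only [Pi.add_apply, Pi.smul_apply, smul_eq_mul] at this
    refine mul_left_cancel₀ h0 ?_
    linear_combination this
  have e1 : ∀ i, (schwarzConj (uFun T r) s)⁻¹ * H1 T r 1 s z t i
      = -delta T r s * Complex.exp (-2 * Complex.I * eta z t s)
        * ((uFun T r s)⁻¹ * H1 T r 0 s z t i)
      + (1 + delta T r s * schwarzConj (delta T r) s) * H3 T r 1 s z t i := fun i => by
    have := congrFun key1 i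
    simp only [Pi.add_apply, Pi.smul_apply, smul_eq_mul] at this
    refine mul_left_cancel₀ h1 ?_
    linear_combination this
  simp only [neg_mul] at e1
  ext i j
  fin_cases i <;> fin_cases j <;>
    simp [E2, E4, G4, ofCols, Matrix.mul_apply, Fin.sum_univ_two, e1, e0] <;> ring

theorem E3_eq_E1_mul_G2 (hT : 0 < T) (hr : SolvesCLLNLS T r) (hzt : (z, t) ∈ closedDomain T)
    (hs : (phi s).re = 0) (hp : (psi s).re = 0) (hu : uFun T r s ≠ 0)
    (hu' : schwarzConj (uFun T r) s ≠ 0) (hβ : beta T r s ≠ 0)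
    (hβ' : schwarzConj (beta T r) s ≠ 0) :
    E3 T r z t s = E1 T r z t s * G2 T r z t s := by
  have hdet : (G4 T r z t s).det = 1 := by
    rw [G4, Matrix.det_fin_two_of]
    linear_combination (-delta T r s * schwarzConj (delta T r) s) * exp_eta_mul s z t
  have h4 : E4 T r z t s = E2 T r z t s * (G4 T r z t s)⁻¹ := by
    rw [E2_eq_E4_mul_G4 hT hr hzt hs hp hu hu', Matrix.mul_assoc, Matrix.mul_nonsing_inv,
      Matrix.mul_one]
    rw [hdet]; exact isUnit_one
  rw [E3_eq_E4_mul_G1 hT hr hzt hs.le hp hu hβ, h4,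
    E2_eq_E1_mul_G3 hT hr hzt hs.ge hp hu' hβ', G2]
  simp only [Matrix.mul_assoc]

end Jumps

/-! ### Closures of the regions -/

theorem isOpenMap_lam : IsOpenMap lam := by
  have h : AnalyticOnNhd ℂ lam univ := by
    have : Differentiable ℂ lam := by unfold lam; fun_prop
    exact this.differentiableOn.analyticOnNhd isOpen_univ
  refine h.is_constant_or_isOpenMap.resolve_left ?_
  rintro ⟨w, hw⟩
  have h0 := hw 0
  have h1 := hw 1
  rw [← h0] at h1
  norm_num [lam] at h1

theorem continuous_lam : Continuous lam := by unfold lam; fun_prop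

theorem D1_eq : D1 = lam ⁻¹' (Ioi 0 ×ℂ Ioi 0) := by
  ext s
  simp only [D1, mem_ofPred_eq, phi_re, psi_re, mem_preimage, Complex.mem_reProdIm, mem_Ioi]
  constructor
  · rintro ⟨h1, h2⟩
    exact ⟨by nlinarith, h1⟩
  · rintro ⟨h1, h2⟩
    exact ⟨h2, by positivity⟩

theorem D2_eq : D2 = lam ⁻¹' (Iio 0 ×ℂ Ioi 0) := by
  ext s
  simp only [D2, mem_ofPred_eq, phi_re, psi_re, mem_preimage, Complex.mem_reProdIm, mem_Ioi, mem_Iio]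
  constructor
  · rintro ⟨h1, h2⟩
    exact ⟨by nlinarith, h1⟩
  · rintro ⟨h1, h2⟩
    exact ⟨h2, by nlinarith⟩

theorem mem_closure_D1 {s : ℂ} : s ∈ closure D1 ↔ 0 ≤ (lam s).re ∧ 0 ≤ (lam s).im := by
  rw [D1_eq, ← isOpenMap_lam.preimage_closure_eq_closure_preimage continuous_lam,
    Complex.closure_reProdIm, closure_Ioi, mem_preimage, Complex.mem_reProdIm, mem_Ici, mem_Ici]

theorem mem_closure_D2 {s : ℂ} : s ∈ closure D2 ↔ (lam s).re ≤ 0 ∧ 0 ≤ (lam s).im := by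
  rw [D2_eq, ← isOpenMap_lam.preimage_closure_eq_closure_preimage continuous_lam,
    Complex.closure_reProdIm, closure_Ioi, closure_Iio, mem_preimage, Complex.mem_reProdIm,
    mem_Ici, mem_Iic]

end CLL

end

theorem theorem2p3 (T : EReal) (hT : 0 < T) (r : 𝓢(ℝ × ℝ, ℂ)) (hr : CLL.SolvesCLLNLS T r)
    (z t : ℝ) (hzt : (z, t) ∈ CLL.closedDomain T) (s : ℂ) (hs : s ^ 2 ≠ 1 / 2) :
    (Complex.arg (1 / 2 - s ^ 2) = Real.pi / 2 →
      CLL.uFun T r s ≠ 0 → CLL.beta T r s ≠ 0 →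
        CLL.EMinus T r z t s = CLL.EPlus T r z t s * CLL.G1 T r z t s) ∧
    (Complex.arg (1 / 2 - s ^ 2) = Real.pi →
      CLL.uFun T r s ≠ 0 → CLL.schwarzConj (CLL.uFun T r) s ≠ 0 →
      CLL.beta T r s ≠ 0 → CLL.schwarzConj (CLL.beta T r) s ≠ 0 →
        CLL.EMinus T r z t s = CLL.EPlus T r z t s * CLL.G2 T r z t s) ∧
    (Complex.arg (1 / 2 - s ^ 2) = -(Real.pi / 2) →
      CLL.schwarzConj (CLL.uFun T r) s ≠ 0 → CLL.schwarzConj (CLL.beta T r) s ≠ 0 →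
        CLL.EMinus T r z t s = CLL.EPlus T r z t s * CLL.G3 T r z t s) ∧
    (Complex.arg (1 / 2 - s ^ 2) = 0 →
      CLL.uFun T r s ≠ 0 → CLL.schwarzConj (CLL.uFun T r) s ≠ 0 →
        CLL.EMinus T r z t s = CLL.EPlus T r z t s * CLL.G4 T r z t s) := by
  have hlam : (1 / 2 - s ^ 2 : ℂ) = -CLL.lam s := by rw [CLL.lam]; ring
  have hne : CLL.lam s ≠ 0 := fun h => hs (by rw [CLL.lam, sub_eq_zero] at h; exact h)
  rw [hlam]
  refine ⟨fun ha hu hβ => ?_, fun ha hu hu' hβ hβ' => ?_, fun ha hu hβ => ?_, fun ha hu hu' => ?_⟩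
  · obtain ⟨h1, h2⟩ := Complex.arg_eq_pi_div_two_iff.1 ha
    rw [Complex.neg_re, neg_eq_zero] at h1
    rw [Complex.neg_im] at h2
    rw [CLL.EMinus, CLL.EPlus, if_neg (fun h => by linarith [(CLL.mem_closure_D2.1 h).2]),
      if_neg (fun h => by linarith [(CLL.mem_closure_D1.1 h).2])]
    exact CLL.E3_eq_E4_mul_G1 hT hr hzt (by rw [CLL.phi_re]; linarith)
      (by rw [CLL.psi_re, h1]; ring) hu hβ
  · obtain ⟨h1, h2⟩ := Complex.arg_eq_pi_iff.1 ha
    rw [Complex.neg_re] at h1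
    rw [Complex.neg_im, neg_eq_zero] at h2
    rw [CLL.EMinus, CLL.EPlus, if_neg (fun h => by linarith [(CLL.mem_closure_D2.1 h).1]),
      if_pos (CLL.mem_closure_D1.2 ⟨by linarith, h2.ge⟩)]
    exact CLL.E3_eq_E1_mul_G2 hT hr hzt (by rw [CLL.phi_re, h2])
      (by rw [CLL.psi_re, h2, mul_zero]) hu hu' hβ hβ'
  · obtain ⟨h1, h2⟩ := Complex.arg_eq_neg_pi_div_two_iff.1 ha
    rw [Complex.neg_re, neg_eq_zero] at h1
    rw [Complex.neg_im] at h2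
    rw [CLL.EMinus, CLL.EPlus, if_pos (CLL.mem_closure_D2.2 ⟨h1.le, by linarith⟩),
      if_pos (CLL.mem_closure_D1.2 ⟨h1.ge, by linarith⟩)]
    exact CLL.E2_eq_E1_mul_G3 hT hr hzt (by rw [CLL.phi_re]; linarith)
      (by rw [CLL.psi_re, h1]; ring) hu hβ
  · obtain ⟨h1, h2⟩ := Complex.arg_eq_zero_iff.1 ha
    rw [Complex.neg_re] at h1
    rw [Complex.neg_im, neg_eq_zero] at h2
    have h3 : (CLL.lam s).re < 0 :=
      lt_of_le_of_ne (by linarith) fun h => hne (Complex.ext h h2)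
    rw [CLL.EMinus, CLL.EPlus, if_pos (CLL.mem_closure_D2.2 ⟨h3.le, h2.ge⟩),
      if_neg (fun h => by linarith [(CLL.mem_closure_D1.1 h).1])]
    exact CLL.E2_eq_E4_mul_G4 hT hr hzt (by rw [CLL.phi_re, h2])
      (by rw [CLL.psi_re, h2, mul_zero]) hu hu'
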